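/- Let $k$ be a commutative ring and let $\mathcal{A}=(A=\bigoplus_{i\in\mathbb{Z}}A^i,d)$ be a differential graded (dg) $k$-algebra such that $A^i=0$ for $i<0$, the ring $A^0$ is semisimple, and $d(A^0)=0$. Let $(L_x)_{x\in W}$ be a system of representatives of the isomorphism classes of simple right $A^0$-modules, and let $\hat L_x = L_x\otimes_{A^0}A$ be the dg right $\mathcal{A}$-module with $L_x$ in degree $0$ and differential $l\otimes a\mapsto l\otimes d(a)$. Let $\mathrm{dgMod}$ be the category of dg right $\mathcal{A}$-modules (morphisms are the $A$-linear maps of degree $0$ that commute with the differentials) and $\mathrm{dgHot}$ its homotopy category, with the triangulated structure given by the shift $\{1\}$ and mapping cones. Let $\mathrm{dgPer}\subset\mathrm{dgHot}$ be the smallest strict full triangulated subcategory that contains $\mathcal{A}$ and is closed under direct summands. For a dg module $M$ put $\overline{M}=M/MA^+$, where $A^+=\bigoplus_{i>0}A^i$. Let $\mathrm{dgPer}^{\le 0}$ (respectively $\mathrm{dgPer}^{\ge 0}$) be the full subcategory of those $M\in\mathrm{dgPer}$ with $H^i(\overline{M})=0$ for all $i>0$ (respectively for all $i<0$), and let $\heartsuit=\mathrm{dgPer}^{\le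 0}\cap\mathrm{dgPer}^{\ge 0}$ be the heart of the t-structure $(\mathrm{dgPer}^{\le 0},\mathrm{dgPer}^{\ge 0})$ on $\mathrm{dgPer}$. Let $\mathrm{dgFlag}$ be the full subcategory of $\mathrm{dgMod}$ consisting of the dg modules $M$ that admit a finite filtration $0=F_0\subset F_1\subset\dots\subset F_n=M$ by dg submodules such that each $F_i/F_{i-1}$ is isomorphic in $\mathrm{dgMod}$ to some $\hat L_{x_i}$, $x_i\in W$. Then: 1. Every object of $\mathrm{dgFlag}$ lies in $\heartsuit$, and the functor $\mathrm{dgFlag}\to\heartsuit$ obtained by restricting the canonical functor $\mathrm{dgMod}\to\mathrm{dgHot}$ is an equivalence of categories. 2. Every object of $\heartsuit$ has finite length (it has a finite composition series in $\heartsuit$). 3. Each $\hat L_x$, $x\in W$, is a simple object of $\heartsuit$; every simple object of $\heartsuit$ is isomorphic to some $\hat L_x$; and for $x\ne y$ the objects $\hat L_x$ and $\hat L_y$ of $\heartsuit$ are not isomorphic. -/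

import Mathlib

open CategoryTheory CategoryTheory.Limits
open scoped TensorProduct RightActions

universe u v w

noncomputable section

namespace DGPerf

/-! ### Helper facts on internal gradings and quotients -/

section Helpers

variable {M : Type*} [AddCommGroup M]

/-- A family of subgroups spanning `M` is a grading as soon as it admits a family of projections. -/
theorem isInternal_of_proj (G : ℤ → AddSubgroup M) (p : ℤ → M →+ M)
    (h1 : ∀ i, ∀ x ∈ G i, p i x = x) (h2 : ∀ i j, i ≠ j → ∀ x ∈ G j, p i x = 0)
    (h3 : ⨆ i, G i = ⊤) : DirectSum.IsInternal G := by
  have key : ∀ (x : DirectSum ℤ fun i => G i) (i : ℤ),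
      p i (DirectSum.coeAddMonoidHom G x) = (x i : M) := by
    intro x i
    induction x using DirectSum.induction_on with
    | zero => simp
    | of j y =>
      rw [DirectSum.coeAddMonoidHom_of]
      by_cases hij : i = j
      · subst hij
        rw [h1 i _ y.2, DirectSum.of_eq_same]
      · rw [h2 i j hij _ y.2, DirectSum.of_eq_of_ne _ _ _ hij]
        rfl
    | add x y hx hy => simp [hx, hy]
  constructor
  · intro x y hxy
    refine DFinsupp.ext fun i => Subtype.ext ?_
    rw [← key x i, ← key y i, hxy]
  · intro m
    have hm : m ∈ ⨆ i, G i := by rw [h3]; trivial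
    induction hm using AddSubgroup.iSup_induction' with
    | hp i x hx => exact ⟨DirectSum.of (fun i => G i) i ⟨x, hx⟩, by simp⟩
    | h1 => exact ⟨0, map_zero _⟩
    | hadd x y _ _ hx hy =>
      obtain ⟨a, rfl⟩ := hx
      obtain ⟨b, rfl⟩ := hy
      exact ⟨a + b, map_add _ _ _⟩

/-- The additive projection onto the `i`-th component of an internal grading. -/
def gradeProj (G : ℤ → AddSubgroup M) (h : DirectSum.IsInternal G) (i : ℤ) : M →+ M :=
  (G i).subtype.comp ((DFinsupp.evalAddMonoidHom i).comp
    (AddEquiv.ofBijective (DirectSum.coeAddMonoidHom G) h).symm.toAddMonoidHom)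

variable {G : ℤ → AddSubgroup M} (h : DirectSum.IsInternal G)

theorem gradeProj_mem (i : ℤ) (x : M) : gradeProj G h i x ∈ G i :=
  Subtype.property _

theorem gradeProj_coe (x : DirectSum ℤ fun i => G i) (i : ℤ) :
    gradeProj G h i (DirectSum.coeAddMonoidHom G x) = (x i : M) := by
  have : (AddEquiv.ofBijective (DirectSum.coeAddMonoidHom G) h).symm
      (DirectSum.coeAddMonoidHom G x) = x :=
    (AddEquiv.ofBijective (DirectSum.coeAddMonoidHom G) h).symm_apply_apply x
  change (((AddEquiv.ofBijective (DirectSum.coeAddMonoidHom G) h).symm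
      (DirectSum.coeAddMonoidHom G x)) i : M) = _
  rw [this]

theorem gradeProj_same {i : ℤ} {x : M} (hx : x ∈ G i) : gradeProj G h i x = x := by
  have := gradeProj_coe h (DirectSum.of (fun i => G i) i ⟨x, hx⟩) i
  simpa [DirectSum.of_eq_same] using this

theorem gradeProj_ne {i j : ℤ} (hij : i ≠ j) {x : M} (hx : x ∈ G j) : gradeProj G h i x = 0 := by
  have := gradeProj_coe h (DirectSum.of (fun i => G i) j ⟨x, hx⟩) i
  rw [DirectSum.of_eq_of_ne _ _ _ hij] at this
  simpa using this

theorem iSup_eq_top_of_isInternal (h : DirectSum.IsInternal G) : ⨆ i, G i = ⊤ := by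
  rw [eq_top_iff]
  intro m _
  obtain ⟨x, rfl⟩ := h.2 m
  induction x using DirectSum.induction_on with
  | zero => simp
  | of j y =>
    rw [DirectSum.coeAddMonoidHom_of]
    exact AddSubgroup.mem_iSup_of_mem j y.2
  | add x y hx hy =>
    rw [map_add]
    exact add_mem (hx trivial) (hy trivial)

/-- Every element is a finite sum of its homogeneous components. -/
theorem mem_of_gradeProj_mem (S : AddSubgroup M) (m : M)
    (hm : ∀ i, gradeProj G h i m ∈ S) : m ∈ S := by
  obtain ⟨x, rfl⟩ := h.2 m
  classical
  rw [DirectSum.coeAddMonoidHom_eq_dfinsuppSum]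
  refine sum_mem fun i _ => ?_
  change ((x i : G i) : M) ∈ S
  rw [← gradeProj_coe h x i]
  exact hm i

/-- Two additive maps agreeing on homogeneous elements are equal. -/
theorem addHom_ext_of_isInternal {N : Type*} [AddCommGroup N] (h : DirectSum.IsInternal G)
    (f g : M →+ N) (hfg : ∀ i, ∀ x ∈ G i, f x = g x) (m : M) : f m = g m := by
  have : m ∈ (f - g).ker := mem_of_gradeProj_mem h _ _ fun i => by
    simp [AddMonoidHom.mem_ker, hfg i _ (gradeProj_mem h i m)]
  exact sub_eq_zero.1 this

/-- Additive maps respecting the gradings commute with the projections. -/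
theorem map_gradeProj {N : Type*} [AddCommGroup N] {G' : ℤ → AddSubgroup N}
    (h' : DirectSum.IsInternal G') (f : M →+ N) (hf : ∀ i, ∀ x ∈ G i, f x ∈ G' i) (i : ℤ) (m : M) :
    f (gradeProj G h i m) = gradeProj G' h' i (f m) := by
  refine addHom_ext_of_isInternal h (f.comp (gradeProj G h i)) ((gradeProj G' h' i).comp f)
    (fun j x hx => ?_) m
  by_cases hij : i = j
  · subst hij
    simp [gradeProj_same h hx, gradeProj_same h' (hf i x hx)]
  · simp [gradeProj_ne h hij hx, gradeProj_ne h' hij (hf j x hx)]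

/-- An additive map killing the submodule `S` factors through `M ⧸ S`. -/
def quotLift {R : Type*} [Ring R] [Module R M] (S : Submodule R M) {N : Type*} [AddCommGroup N]
    (f : M →+ N) (hf : ∀ x ∈ S, f x = 0) : M ⧸ S →+ N :=
  QuotientAddGroup.lift S.toAddSubgroup f hf

@[simp] theorem quotLift_mk {R : Type*} [Ring R] [Module R M] (S : Submodule R M) {N : Type*}
    [AddCommGroup N] (f : M →+ N) (hf : ∀ x ∈ S, f x = 0) (x : M) :
    quotLift S f hf (Submodule.Quotient.mk x) = f x := rfl

end Helpers

/-! ### Differential graded algebras -/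

/-- A differential (`ℤ`-)graded `k`-algebra. -/
structure DGAlgebra (k : Type v) [CommRing k] where
  /-- the underlying `k`-algebra `A` -/
  carrier : Type u
  [ring : Ring carrier]
  [algebra : Algebra k carrier]
  /-- the homogeneous component `A^i` -/
  gr : ℤ → Submodule k carrier
  [graded : GradedAlgebra gr]
  /-- the differential -/
  d : carrier →ₗ[k] carrier
  d_mem : ∀ {i : ℤ} {a : carrier}, a ∈ gr i → d a ∈ gr (i + 1)
  d_d : ∀ a : carrier, d (d a) = 0
  leibniz : ∀ {i : ℤ} {a : carrier} (b : carrier), a ∈ gr i →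
    d (a * b) = d a * b + i.negOnePow • (a * d b)

attribute [instance] DGAlgebra.ring DGAlgebra.algebra DGAlgebra.graded

variable {k : Type v} [CommRing k]

/-- The ring `A^0`. -/
abbrev DGAlgebra.zeroPart (𝒜 : DGAlgebra.{u} k) : Type u := 𝒜.gr 0

/-- The grading of `A` by the additive subgroups `A^i`. -/
abbrev DGAlgebra.addGr (𝒜 : DGAlgebra.{u} k) (i : ℤ) : AddSubgroup 𝒜.carrier :=
  (𝒜.gr i).toAddSubgroup

theorem DGAlgebra.isInternal (𝒜 : DGAlgebra.{u} k) : DirectSum.IsInternal 𝒜.addGr :=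
  DirectSum.Decomposition.isInternal 𝒜.gr

/-! ### Differential graded right modules -/

/-- A differential graded right module over `𝒜`. Right `A`-modules are modules over the opposite
ring, and `m <• a` is the right action. (The compatibility with the action of `k` through
`k → A^0` is automatic, as `d` vanishes on the image of `k` in `A`.) -/
structure DGMod (𝒜 : DGAlgebra.{u} k) where
  /-- the underlying right `A`-module `M` -/
  carrier : Type u
  [addCommGroup : AddCommGroup carrier]
  [module : Module 𝒜.carrierᵐᵒᵖ carrier]
  /-- the homogeneous component `M^i` -/
  gr : ℤ → AddSubgroup carrier
  isInternal : DirectSum.IsInternal gr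
  smul_mem : ∀ {i j : ℤ} {m : carrier} {a : 𝒜.carrier}, m ∈ gr i → a ∈ 𝒜.gr j →
    m <• a ∈ gr (i + j)
  /-- the differential -/
  d : carrier →+ carrier
  d_mem : ∀ {i : ℤ} {m : carrier}, m ∈ gr i → d m ∈ gr (i + 1)
  d_d : ∀ m : carrier, d (d m) = 0
  leibniz : ∀ {i : ℤ} {m : carrier} (a : 𝒜.carrier), m ∈ gr i →
    d (m <• a) = d m <• a + i.negOnePow • (m <• 𝒜.d a)

attribute [instance] DGMod.addCommGroup DGMod.module

namespace DGMod

variable {𝒜 : DGAlgebra.{u} k}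

/-- Morphisms of dg modules: `A`-linear maps of degree `0` commuting with the differentials. -/
structure Hom (M N : DGMod 𝒜) where
  /-- the underlying `A`-linear map -/
  toLin : M.carrier →ₗ[𝒜.carrierᵐᵒᵖ] N.carrier
  map_mem : ∀ {i : ℤ} {m : M.carrier}, m ∈ M.gr i → toLin m ∈ N.gr i
  comm : ∀ m : M.carrier, toLin (M.d m) = N.d (toLin m)

theorem Hom.toLin_injective {M N : DGMod 𝒜} : Function.Injective (Hom.toLin (M := M) (N := N)) := by
  rintro ⟨f, _, _⟩ ⟨g, _, _⟩ h
  cases h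
  rfl

/-- The category `dgMod(𝒜)`. -/
instance : Category (DGMod 𝒜) where
  Hom M N := Hom M N
  id M := ⟨LinearMap.id, fun h => h, fun _ => rfl⟩
  comp f g := ⟨g.toLin.comp f.toLin, fun h => g.map_mem (f.map_mem h), fun m => by
    simp [f.comm, g.comm]⟩

@[ext] theorem hom_ext {M N : DGMod 𝒜} {f g : M ⟶ N} (h : Hom.toLin f = Hom.toLin g) : f = g :=
  Hom.toLin_injective h

@[simp] theorem toLin_id (M : DGMod 𝒜) : Hom.toLin (𝟙 M) = LinearMap.id := rfl

@[simp] theorem toLin_comp {M N P : DGMod 𝒜} (f : M ⟶ N) (g : N ⟶ P) :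
    Hom.toLin (f ≫ g) = (Hom.toLin g).comp (Hom.toLin f) := rfl

section HomGroup

variable (M N : DGMod 𝒜)

instance : Zero (M ⟶ N) := ⟨⟨0, fun _ => zero_mem _, fun m => by simp⟩⟩

instance : Add (M ⟶ N) := ⟨fun f g => ⟨Hom.toLin f + Hom.toLin g,
  fun h => add_mem (Hom.map_mem f h) (Hom.map_mem g h),
  fun m => by simp [Hom.comm f, Hom.comm g]⟩⟩

instance : Neg (M ⟶ N) := ⟨fun f => ⟨-Hom.toLin f,
  fun h => neg_mem (Hom.map_mem f h), fun m => by simp [Hom.comm f]⟩⟩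

instance : Sub (M ⟶ N) := ⟨fun f g => ⟨Hom.toLin f - Hom.toLin g,
  fun h => sub_mem (Hom.map_mem f h) (Hom.map_mem g h),
  fun m => by simp [Hom.comm f, Hom.comm g]⟩⟩

instance : SMul ℕ (M ⟶ N) := ⟨fun n f => ⟨n • Hom.toLin f,
  fun h => nsmul_mem (Hom.map_mem f h) n, fun m => by simp [Hom.comm f]⟩⟩

instance : SMul ℤ (M ⟶ N) := ⟨fun n f => ⟨n • Hom.toLin f,
  fun h => zsmul_mem (Hom.map_mem f h) n, fun m => by simp [Hom.comm f]⟩⟩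

instance : AddCommGroup (M ⟶ N) :=
  Hom.toLin_injective.addCommGroup (fun f : M ⟶ N => Hom.toLin f)
    rfl (fun _ _ => rfl) (fun _ => rfl) (fun _ _ => rfl) (fun _ _ => rfl) (fun _ _ => rfl)

end HomGroup

@[simp] theorem toLin_zero (M N : DGMod 𝒜) : Hom.toLin (0 : M ⟶ N) = 0 := rfl

@[simp] theorem toLin_add {M N : DGMod 𝒜} (f g : M ⟶ N) :
    Hom.toLin (f + g) = Hom.toLin f + Hom.toLin g := rfl

instance : Preadditive (DGMod 𝒜) where
  add_comp _ _ _ f f' g := by ext1; simp [LinearMap.comp_add]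
  comp_add _ _ _ f g g' := by ext1; simp [LinearMap.add_comp]

/-! ### The homotopy category -/

/-- `f - g = d h + h d` for some `A`-linear map `h` of degree `-1`. -/
def Homotopic : HomRel (DGMod 𝒜) := fun M N f g =>
  ∃ h : M.carrier →ₗ[𝒜.carrierᵐᵒᵖ] N.carrier,
    (∀ (i : ℤ) (m : M.carrier), m ∈ M.gr i → h m ∈ N.gr (i - 1)) ∧
    ∀ m : M.carrier, Hom.toLin f m - Hom.toLin g m = N.d (h m) + h (M.d m)

instance : Congruence (Homotopic (𝒜 := 𝒜)) where
  equivalence := {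
    refl := fun f => ⟨0, fun _ _ _ => zero_mem _, fun m => by simp⟩
    symm := by
      rintro f g ⟨h, h1, h2⟩
      refine ⟨-h, fun i m hm => neg_mem (h1 i m hm), fun m => ?_⟩
      rw [← neg_sub, h2]
      simp only [LinearMap.neg_apply, map_neg]
      abel
    trans := by
      rintro f g e ⟨h, h1, h2⟩ ⟨h', h1', h2'⟩
      refine ⟨h + h', fun i m hm => add_mem (h1 i m hm) (h1' i m hm), fun m => ?_⟩
      rw [← sub_add_sub_cancel _ (Hom.toLin g m), h2, h2']
      simp only [LinearMap.add_apply, map_add]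
      abel }
  comp_left := by
    rintro X Y Z f g g' ⟨h, h1, h2⟩
    refine ⟨h.comp (Hom.toLin f), fun i m hm => h1 i _ (Hom.map_mem f hm), fun m => ?_⟩
    simp [h2, Hom.comm f]
  comp_right := by
    rintro X Y Z f f' g ⟨h, h1, h2⟩
    refine ⟨(Hom.toLin g).comp h, fun i m hm => Hom.map_mem g (h1 i m hm), fun m => ?_⟩
    simp [← map_sub, h2, Hom.comm g]

end DGMod

/-- The homotopy category `dgHot(𝒜)`. -/
abbrev DGHot (𝒜 : DGAlgebra.{u} k) := Quotient (DGMod.Homotopic (𝒜 := 𝒜))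

instance (𝒜 : DGAlgebra.{u} k) : Preadditive (DGHot 𝒜) :=
  Quotient.preadditive _ (by
    rintro X Y f₁ f₂ g₁ g₂ ⟨h, h1, h2⟩ ⟨h', h1', h2'⟩
    refine ⟨h + h', fun i m hm => add_mem (h1 i m hm) (h1' i m hm), fun m => ?_⟩
    simp only [DGMod.toLin_add, LinearMap.add_apply, map_add]
    rw [add_sub_add_comm, h2, h2']
    abel)

/-- The canonical functor `dgMod(𝒜) ⥤ dgHot(𝒜)`. -/
abbrev toHot (𝒜 : DGAlgebra.{u} k) : DGMod 𝒜 ⥤ DGHot 𝒜 := Quotient.functor _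

namespace DGMod

variable {𝒜 : DGAlgebra.{u} k}

/-! ### Shifts, mapping cones, and the free module of rank one -/

/-- The shift `{n}M`, with `({n}M)^i = M^{i+n}`, the same `A`-action and
differential `(-1)^n d_M`. -/
def shift (n : ℤ) (M : DGMod 𝒜) : DGMod 𝒜 where
  carrier := M.carrier
  gr i := M.gr (i + n)
  isInternal := by
    refine isInternal_of_proj _ (fun i => gradeProj M.gr M.isInternal (i + n))
      (fun i x hx => gradeProj_same _ hx)
      (fun i j hij x hx => gradeProj_ne _ (by omega) hx) ?_
    rw [← iSup_eq_top_of_isInternal M.isInternal]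
    exact (Equiv.addRight n).iSup_comp (g := M.gr)
  smul_mem {i j m a} hm ha := by
    have := M.smul_mem hm ha
    rwa [add_right_comm] at this
  d := n.negOnePow • M.d
  d_mem {i m} hm := by
    have := M.d_mem hm
    rw [add_right_comm] at this
    exact zsmul_mem this _
  d_d m := by
    change n.negOnePow • M.d (n.negOnePow • M.d m) = 0
    rw [Units.smul_def, Units.smul_def, map_zsmul, M.d_d, smul_zero, smul_zero]
  leibniz {i m} a hm := by
    change n.negOnePow • M.d (m <• a) = (n.negOnePow • M.d m) <• a + _
    rw [M.leibniz a hm, smul_add, Int.negOnePow_add, smul_smul, mul_left_comm, Int.units_mul_self,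
      mul_one, Units.smul_def, Units.smul_def n.negOnePow, smul_comm]

/-- The mapping cone `N ⊕ {1}M` of `f : M ⟶ N`, with differential
`(y, x) ↦ (d y + f x, - d x)`. -/
def cone {M N : DGMod 𝒜} (f : M ⟶ N) : DGMod 𝒜 where
  carrier := N.carrier × M.carrier
  gr i := (N.gr i).prod (M.gr (i + 1))
  isInternal := by
    refine isInternal_of_proj _ (fun i => (gradeProj N.gr N.isInternal i).prodMap
      (gradeProj M.gr M.isInternal (i + 1))) ?_ ?_ ?_
    · rintro i ⟨x, y⟩ ⟨hx, hy⟩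
      exact Prod.ext (gradeProj_same _ hx) (gradeProj_same _ hy)
    · rintro i j hij ⟨x, y⟩ ⟨hx, hy⟩
      exact Prod.ext (gradeProj_ne _ hij hx) (gradeProj_ne _ (by omega) hy)
    · rw [eq_top_iff]
      rintro ⟨x, y⟩ -
      set S : AddSubgroup (N.carrier × M.carrier) :=
        ⨆ i, (N.gr i).prod (M.gr (i + 1))
      have h1 : x ∈ S.comap (AddMonoidHom.inl _ _) :=
        mem_of_gradeProj_mem N.isInternal _ _ fun i =>
          AddSubgroup.mem_iSup_of_mem i ⟨gradeProj_mem _ i x, zero_mem _⟩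
      have h2 : y ∈ S.comap (AddMonoidHom.inr _ _) :=
        mem_of_gradeProj_mem M.isInternal _ _ fun i =>
          AddSubgroup.mem_iSup_of_mem (i - 1) ⟨zero_mem _, by
            simpa using gradeProj_mem M.isInternal i y⟩
      have h : (x, (0 : M.carrier)) + ((0 : N.carrier), y) ∈ S := add_mem h1 h2
      simpa using h
  smul_mem {i j m a} hm ha := by
    refine ⟨N.smul_mem hm.1 ha, ?_⟩
    have := M.smul_mem hm.2 ha
    rwa [add_right_comm] at this
  d := ((N.d.comp (AddMonoidHom.fst _ _)) +
      (Hom.toLin f).toAddMonoidHom.comp (AddMonoidHom.snd _ _)).prod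
    (-(M.d.comp (AddMonoidHom.snd _ _)))
  d_mem {i m} hm := ⟨add_mem (N.d_mem hm.1) (Hom.map_mem f hm.2), neg_mem (M.d_mem hm.2)⟩
  d_d m := by
    ext
    · simp [N.d_d, Hom.comm f]
    · simp [M.d_d]
  leibniz {i m} a hm := by
    refine Prod.ext ?_ ?_
    · have := N.leibniz a hm.1
      simp [this]
      abel
    · have := M.leibniz a hm.2
      simp [this, Int.negOnePow_succ]
      abel

/-- `𝒜` as a dg module over itself. -/
def self (𝒜 : DGAlgebra.{u} k) : DGMod 𝒜 where
  carrier := 𝒜.carrier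
  gr := 𝒜.addGr
  isInternal := 𝒜.isInternal
  smul_mem hm ha := SetLike.mul_mem_graded (A := 𝒜.gr) hm ha
  d := 𝒜.d.toAddMonoidHom
  d_mem hm := 𝒜.d_mem hm
  d_d := 𝒜.d_d
  leibniz a hm := 𝒜.leibniz a hm

/-! ### Dg submodules and subquotients -/

/-- A dg submodule: a graded `A`-submodule which is stable under the differential. -/
structure Sub (M : DGMod 𝒜) where
  /-- the underlying `A`-submodule -/
  toSubmodule : Submodule 𝒜.carrierᵐᵒᵖ M.carrier
  homogeneous : ∀ m ∈ toSubmodule, ∀ i, gradeProj M.gr M.isInternal i m ∈ toSubmodule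
  d_mem : ∀ m ∈ toSubmodule, M.d m ∈ toSubmodule

namespace Sub

variable {M : DGMod 𝒜}

/-- A dg submodule, as a dg module. -/
def toDGMod (V : Sub M) : DGMod 𝒜 where
  carrier := V.toSubmodule
  gr i := (M.gr i).comap V.toSubmodule.subtype.toAddMonoidHom
  isInternal := by
    refine isInternal_of_proj _ (fun i =>
      ((gradeProj M.gr M.isInternal i).comp V.toSubmodule.subtype.toAddMonoidHom).codRestrict
        V.toSubmodule fun x => V.homogeneous x x.2 i) ?_ ?_ ?_
    · intro i x hx
      exact Subtype.ext (gradeProj_same M.isInternal hx)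
    · intro i j hij x hx
      exact Subtype.ext (gradeProj_ne M.isInternal hij hx)
    · rw [eq_top_iff]
      rintro ⟨x, hx⟩ -
      set S : AddSubgroup V.toSubmodule :=
        ⨆ i, (M.gr i).comap V.toSubmodule.subtype.toAddMonoidHom
      have : x ∈ S.map V.toSubmodule.subtype.toAddMonoidHom :=
        mem_of_gradeProj_mem M.isInternal _ _ fun i =>
          ⟨⟨_, V.homogeneous x hx i⟩, AddSubgroup.mem_iSup_of_mem i (gradeProj_mem _ i x), rfl⟩
      obtain ⟨y, hy, rfl⟩ := this
      exact hy
  smul_mem hm ha := M.smul_mem hm ha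
  d := (M.d.comp V.toSubmodule.subtype.toAddMonoidHom).codRestrict V.toSubmodule
    fun x => V.d_mem x x.2
  d_mem hm := M.d_mem hm
  d_d m := Subtype.ext (M.d_d m)
  leibniz a hm := Subtype.ext <| by
    rw [Units.smul_def]
    exact M.leibniz a hm

/-- The inclusion of a dg submodule. -/
def incl (V : Sub M) : V.toDGMod ⟶ M where
  toLin := V.toSubmodule.subtype
  map_mem h := h
  comm _ := rfl

/-- The quotient of a dg module by a dg submodule. -/
def quotient (V : Sub M) : DGMod 𝒜 where
  carrier := M.carrier ⧸ V.toSubmodule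
  gr i := (M.gr i).map V.toSubmodule.mkQ.toAddMonoidHom
  isInternal := by
    refine isInternal_of_proj _ (fun i => quotLift V.toSubmodule
      (V.toSubmodule.mkQ.toAddMonoidHom.comp (gradeProj M.gr M.isInternal i)) fun x hx =>
        (Submodule.Quotient.mk_eq_zero _).2 (V.homogeneous x hx i)) ?_ ?_ ?_
    · rintro i _ ⟨x, hx, rfl⟩
      exact congrArg V.toSubmodule.mkQ (gradeProj_same M.isInternal hx)
    · rintro i j hij _ ⟨x, hx, rfl⟩
      exact (congrArg V.toSubmodule.mkQ (gradeProj_ne M.isInternal hij hx)).trans (map_zero _)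
    · rw [← AddSubgroup.map_iSup, iSup_eq_top_of_isInternal M.isInternal,
        AddSubgroup.map_top_of_surjective _ V.toSubmodule.mkQ_surjective]
  smul_mem := by
    rintro i j _ a ⟨m, hm, rfl⟩ ha
    exact ⟨m <• a, M.smul_mem hm ha, rfl⟩
  d := quotLift V.toSubmodule (V.toSubmodule.mkQ.toAddMonoidHom.comp M.d) fun x hx =>
    (Submodule.Quotient.mk_eq_zero _).2 (V.d_mem x hx)
  d_mem := by
    rintro i _ ⟨m, hm, rfl⟩
    exact ⟨M.d m, M.d_mem hm, rfl⟩
  d_d m := by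
    obtain ⟨m, rfl⟩ := V.toSubmodule.mkQ_surjective m
    exact (congrArg V.toSubmodule.mkQ (M.d_d m)).trans (map_zero _)
  leibniz := by
    rintro i _ a ⟨m, hm, rfl⟩
    refine (congrArg V.toSubmodule.mkQ (M.leibniz a hm)).trans ?_
    rw [map_add, Units.smul_def, map_zsmul]
    rfl

/-- For dg submodules `U`, `V` of `M`, the submodule `U ∩ V` of `V`. -/
def restrict (U V : Sub M) : Sub V.toDGMod where
  toSubmodule := U.toSubmodule.comap (Hom.toLin V.incl)
  homogeneous m hm i := by
    have h := map_gradeProj V.toDGMod.isInternal M.isInternal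
      (Hom.toLin V.incl).toAddMonoidHom (fun _ _ hx => hx) i m
    have h2 := U.homogeneous _ hm i
    change (Hom.toLin V.incl).toAddMonoidHom _ ∈ U.toSubmodule
    rw [h]
    exact h2
  d_mem m hm := U.d_mem _ hm

/-- The subquotient `V / (U ∩ V)`; it is `V / U` for `U ⊆ V`. -/
def subquotient (U V : Sub M) : DGMod 𝒜 := (U.restrict V).quotient

end Sub

/-! ### Reduction modulo `A⁺` -/

/-- The generators `m a` of `M A⁺`, with `m` homogeneous and `a` homogeneous of positive degree. -/
def plusGen (M : DGMod 𝒜) : Set M.carrier :=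
  {x | ∃ (i j : ℤ) (m : M.carrier) (a : 𝒜.carrier),
    m ∈ M.gr i ∧ a ∈ 𝒜.gr j ∧ 0 < j ∧ x = m <• a}

/-- The dg submodule `M A⁺`, where `A⁺` is the sum of all `A^i` with `i > 0`. -/
def plus (M : DGMod 𝒜) : Sub M where
  toSubmodule := Submodule.span _ M.plusGen
  homogeneous m hm i := by
    induction hm using Submodule.closure_induction with
    | zero => rw [map_zero]; exact zero_mem _
    | add x y _ _ hx hy => rw [map_add]; exact add_mem hx hy
    | smul_mem r x hx =>
      obtain ⟨n, hn⟩ : ∃ n, x ∈ M.gr n := by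
        obtain ⟨i, j, m, a, hm, ha, _, rfl⟩ := hx
        exact ⟨i + j, M.smul_mem hm ha⟩
      let φ : 𝒜.carrier →+ M.carrier :=
        { toFun := fun a => gradeProj M.gr M.isInternal i (x <• a)
          map_zero' := by simp
          map_add' := fun a b => by simp [add_smul] }
      have key : r.unop ∈ (Submodule.span 𝒜.carrierᵐᵒᵖ M.plusGen).toAddSubgroup.comap φ := by
        refine mem_of_gradeProj_mem 𝒜.isInternal _ r.unop fun j => ?_
        obtain ⟨a, ha, h1⟩ : ∃ a : 𝒜.carrier,
            gradeProj 𝒜.addGr 𝒜.isInternal j r.unop = a ∧ a ∈ 𝒜.gr j :=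
          ⟨_, rfl, gradeProj_mem 𝒜.isInternal j r.unop⟩
        rw [ha]
        have h2 : x <• a ∈ M.gr (n + j) := M.smul_mem hn h1
        change gradeProj M.gr M.isInternal i (x <• a) ∈ Submodule.span 𝒜.carrierᵐᵒᵖ M.plusGen
        by_cases hij : i = n + j
        · subst hij
          rw [gradeProj_same _ h2]
          exact Submodule.smul_mem _ _ (Submodule.subset_span hx)
        · rw [gradeProj_ne _ hij h2]
          exact zero_mem _
      exact key
  d_mem m hm := by
    induction hm using Submodule.closure_induction with
    | zero => rw [map_zero]; exact zero_mem _
    | add x y _ _ hx hy => rw [map_add]; exact add_mem hx hy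
    | smul_mem r x hx =>
      have hx' := hx
      obtain ⟨i, j, m, a, hm, ha, hj, rfl⟩ := hx
      have h1 := M.leibniz r.unop (M.smul_mem hm ha)
      rw [MulOpposite.op_unop] at h1
      rw [h1, M.leibniz a hm]
      refine add_mem (Submodule.smul_mem _ _ (add_mem ?_ ?_)) ?_
      · exact Submodule.subset_span ⟨i + 1, j, _, a, M.d_mem hm, ha, hj, rfl⟩
      · rw [Units.smul_def]
        have : m <• 𝒜.d a ∈ M.plusGen := ⟨i, j + 1, m, _, hm, 𝒜.d_mem ha, by omega, rfl⟩
        exact zsmul_mem (Submodule.subset_span this) _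
      · rw [Units.smul_def]
        exact zsmul_mem (Submodule.smul_mem _ _ (Submodule.subset_span hx')) _

/-- The reduction `M̄ = M / M A⁺`. -/
def bar (M : DGMod 𝒜) : DGMod 𝒜 := M.plus.quotient

/-- The cohomology `H^i(M)`: cocycles in `M^i` modulo coboundaries. -/
def cohomology (M : DGMod 𝒜) (i : ℤ) : Type u :=
  ↥(M.gr i ⊓ M.d.ker) ⧸ ((M.gr (i - 1)).map M.d).addSubgroupOf (M.gr i ⊓ M.d.ker)

/-- The support `{i | H^i(M) ≠ 0}` of the cohomology of `M`. -/
def cohomologySupport (M : DGMod 𝒜) : Set ℤ := {i | Nontrivial (M.cohomology i)}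

end DGMod

/-! ### Extension of scalars from `A^0` to `A` -/

section Hat

variable (𝒜 : DGAlgebra.{u} k) (L : Type u) [AddCommGroup L] [Module 𝒜.zeroPartᵐᵒᵖ L]

/-- The relations `l ⊗ b a = l b ⊗ a`, for `b ∈ A^0`. The simple tensor `l ⊗ a` of `L ⊗ A` is
written `a ⊗ₜ l`, so that Mathlib's action on the left factor is the right action of `A`. -/
def hatRel : Submodule 𝒜.carrierᵐᵒᵖ (𝒜.carrier ⊗[ℤ] L) :=
  Submodule.span _ {x | ∃ (b : 𝒜.zeroPart) (a : 𝒜.carrier) (l : L),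
    x = ((b : 𝒜.carrier) * a) ⊗ₜ[ℤ] l - a ⊗ₜ[ℤ] (l <• b)}

/-- The right `A`-module `L ⊗_{A^0} A`. -/
abbrev HatCarrier : Type u := (𝒜.carrier ⊗[ℤ] L) ⧸ hatRel 𝒜 L

variable {𝒜} {L}

/-- The simple tensor `l ⊗ a` in `L ⊗_{A^0} A`. -/
def hatMk (l : L) (a : 𝒜.carrier) : HatCarrier 𝒜 L := Submodule.Quotient.mk (a ⊗ₜ[ℤ] l)

theorem hatMk_smul (l : L) (a r : 𝒜.carrier) : hatMk l a <• r = hatMk l (a * r) := rfl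

@[elab_as_elim]
theorem hat_induction {P : HatCarrier 𝒜 L → Prop} (h0 : P 0) (hmk : ∀ l a, P (hatMk l a))
    (hadd : ∀ x y, P x → P y → P (x + y)) (x : HatCarrier 𝒜 L) : P x := by
  obtain ⟨x, rfl⟩ := (hatRel 𝒜 L).mkQ_surjective x
  induction x using TensorProduct.induction_on with
  | zero => rw [map_zero]; exact h0
  | tmul a l => exact hmk l a
  | add x y hx hy => rw [map_add]; exact hadd _ _ hx hy

/-- A left `A^0`-linear additive map `g : A → A` induces `id ⊗ g` on `L ⊗_{A^0} A`. -/
def hatMap (g : 𝒜.carrier →+ 𝒜.carrier)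
    (hg : ∀ b ∈ 𝒜.gr 0, ∀ a, g (b * a) = b * g a) : HatCarrier 𝒜 L →+ HatCarrier 𝒜 L :=
  quotLift (hatRel 𝒜 L) ((hatRel 𝒜 L).mkQ.toAddMonoidHom.comp
    (TensorProduct.map g.toIntLinearMap LinearMap.id).toAddMonoidHom) <| by
      intro x hx
      refine (Submodule.Quotient.mk_eq_zero _).2 ?_
      induction hx using Submodule.closure_induction with
      | zero => rw [map_zero]; exact zero_mem _
      | add x y _ _ hx hy => rw [map_add]; exact add_mem hx hy
      | smul_mem r x hx =>
        obtain ⟨b, a, l, rfl⟩ := hx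
        refine Submodule.subset_span ⟨b, g (a * r.unop), l, ?_⟩
        have h1 : r • (((b : 𝒜.carrier) * a) ⊗ₜ[ℤ] l - a ⊗ₜ[ℤ] (l <• b)) =
            ((b : 𝒜.carrier) * (a * r.unop)) ⊗ₜ[ℤ] l - (a * r.unop) ⊗ₜ[ℤ] (l <• b) := by
          rw [smul_sub, TensorProduct.smul_tmul', TensorProduct.smul_tmul', ← mul_assoc]
          rfl
        rw [h1, map_sub]
        change g _ ⊗ₜ[ℤ] l - g _ ⊗ₜ[ℤ] _ = _
        rw [hg b b.2]
        rfl

@[simp] theorem hatMap_mk (g : 𝒜.carrier →+ 𝒜.carrier)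
    (hg : ∀ b ∈ 𝒜.gr 0, ∀ a, g (b * a) = b * g a) (l : L) (a : 𝒜.carrier) :
    hatMap g hg (hatMk l a) = hatMk l (g a) := rfl

theorem hatMk_add (l : L) (a b : 𝒜.carrier) :
    hatMk l (a + b) = hatMk l a + hatMk l b :=
  congrArg (hatRel 𝒜 L).mkQ (TensorProduct.add_tmul a b l)

/-- The additive map `a ↦ l ⊗ a`. -/
def hatMkHom (l : L) : 𝒜.carrier →+ HatCarrier 𝒜 L := AddMonoidHom.mk' (hatMk l) (hatMk_add l)

theorem selfProj_mul (i : ℤ) (b : 𝒜.carrier) (hb : b ∈ 𝒜.gr 0) (a : 𝒜.carrier) :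
    gradeProj 𝒜.addGr 𝒜.isInternal i (b * a) =
      b * gradeProj 𝒜.addGr 𝒜.isInternal i a :=
  (map_gradeProj 𝒜.isInternal 𝒜.isInternal (AddMonoidHom.mulLeft b)
    (fun j x hx => by
      have : b * x ∈ 𝒜.gr (0 + j) := SetLike.mul_mem_graded hb hx
      rwa [zero_add] at this) i a).symm

variable (L)

/-- The dg module `L̂ = L ⊗_{A^0} A`, where `L` is concentrated in degree `0`; its component of
degree `i` is generated by the `l ⊗ a` with `a ∈ A^i`, and `d(l ⊗ a) = l ⊗ d a`. -/
def hat (h : ∀ a ∈ 𝒜.gr 0, 𝒜.d a = 0) : DGMod 𝒜 where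
  carrier := HatCarrier 𝒜 L
  gr i := AddSubgroup.closure {x | ∃ (l : L) (a : 𝒜.carrier), a ∈ 𝒜.gr i ∧ x = hatMk l a}
  isInternal := by
    refine isInternal_of_proj _ (fun i => hatMap (gradeProj 𝒜.addGr 𝒜.isInternal i)
      (selfProj_mul i)) ?_ ?_ ?_
    · intro i x hx
      induction hx using AddSubgroup.closure_induction with
      | mem x hx =>
        obtain ⟨l, a, ha, rfl⟩ := hx
        rw [hatMap_mk, gradeProj_same 𝒜.isInternal ha]
      | zero => rw [map_zero]
      | add x y _ _ hx hy => rw [map_add, hx, hy]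
      | neg x _ hx => rw [map_neg, hx]
    · intro i j hij x hx
      induction hx using AddSubgroup.closure_induction with
      | mem x hx =>
        obtain ⟨l, a, ha, rfl⟩ := hx
        rw [hatMap_mk, gradeProj_ne 𝒜.isInternal hij ha]
        exact map_zero (hatMkHom l)
      | zero => rw [map_zero]
      | add x y _ _ hx hy => rw [map_add, hx, hy, add_zero]
      | neg x _ hx => rw [map_neg, hx, neg_zero]
    · rw [eq_top_iff]
      rintro x -
      induction x using hat_induction with
      | h0 => exact zero_mem _
      | hadd x y hx hy => exact add_mem hx hy
      | hmk l a =>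
        set S : AddSubgroup (HatCarrier 𝒜 L) := ⨆ i, AddSubgroup.closure
          {x | ∃ (l : L) (a : 𝒜.carrier), a ∈ 𝒜.gr i ∧ x = hatMk l a}
        have key : a ∈ S.comap (hatMkHom l) :=
          mem_of_gradeProj_mem 𝒜.isInternal _ a fun i => ?_
        · exact key
        exact AddSubgroup.mem_iSup_of_mem i (AddSubgroup.subset_closure
          ⟨l, _, gradeProj_mem 𝒜.isInternal i a, rfl⟩)
  smul_mem {i j m a} hm ha := by
    induction hm using AddSubgroup.closure_induction with
    | mem x hx =>
      obtain ⟨l, b, hb, rfl⟩ := hx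
      exact AddSubgroup.subset_closure
        ⟨l, b * a, SetLike.mul_mem_graded hb ha, hatMk_smul l b a⟩
    | zero => rw [smul_zero]; exact zero_mem _
    | add x y _ _ hx hy => rw [smul_add]; exact add_mem hx hy
    | neg x _ hx => rw [smul_neg]; exact neg_mem hx
  d := hatMap 𝒜.d.toAddMonoidHom fun b hb a => by
    have := 𝒜.leibniz a hb
    rw [h b hb, zero_mul, zero_add, Int.negOnePow_zero, one_smul] at this
    exact this
  d_mem {i m} hm := by
    induction hm using AddSubgroup.closure_induction with
    | mem x hx =>
      obtain ⟨l, a, ha, rfl⟩ := hx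
      exact AddSubgroup.subset_closure ⟨l, 𝒜.d a, 𝒜.d_mem ha, rfl⟩
    | zero => rw [map_zero]; exact zero_mem _
    | add x y _ _ hx hy => rw [map_add]; exact add_mem hx hy
    | neg x _ hx => rw [map_neg]; exact neg_mem hx
  d_d m := by
    induction m using hat_induction with
    | h0 => simp
    | hadd x y hx hy => rw [map_add, map_add, hx, hy, add_zero]
    | hmk l a =>
      change hatMk l (𝒜.d (𝒜.d a)) = 0
      rw [𝒜.d_d]
      exact map_zero (hatMkHom l)
  leibniz {i m} b hm := by
    induction hm using AddSubgroup.closure_induction with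
    | mem x hx =>
      obtain ⟨l, a, ha, rfl⟩ := hx
      change hatMkHom l (𝒜.d (a * b)) = hatMkHom l (𝒜.d a * b) +
        i.negOnePow • hatMkHom l (a * 𝒜.d b)
      rw [𝒜.leibniz b ha, map_add, Units.smul_def, map_zsmul]
      rfl
    | zero => simp
    | add x y _ _ hx hy => rw [smul_add, map_add, hx, hy, map_add, smul_add, smul_add, smul_add]; abel
    | neg x _ hx => rw [smul_neg, map_neg, hx, map_neg, smul_neg, smul_neg, smul_neg]; abel

end Hat

/-! ### The perfect derived category, its t-structure and heart -/

section Perfect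

variable (𝒜 : DGAlgebra.{u} k)

/-- `P` defines a strict full triangulated subcategory of `dgHot(𝒜)` containing `𝒜` and closed
under direct summands. As the distinguished triangles of `dgHot(𝒜)` are those isomorphic to the
mapping cone triangles of morphisms of dg modules, being a triangulated subcategory means being
closed under all shifts and under mapping cones. -/
structure IsThickContainingSelf (P : ObjectProperty (DGHot 𝒜)) : Prop where
  iso : P.IsClosedUnderIsomorphisms
  shift : ∀ (n : ℤ) (M : DGMod 𝒜), P ((toHot 𝒜).obj M) → P ((toHot 𝒜).obj (M.shift n))
  cone : ∀ {M N : DGMod 𝒜} (f : M ⟶ N), P ((toHot 𝒜).obj M) → P ((toHot 𝒜).obj N) →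
    P ((toHot 𝒜).obj (DGMod.cone f))
  summand : P.IsStableUnderRetracts
  self : P ((toHot 𝒜).obj (DGMod.self 𝒜))

/-- The category `dgPer(𝒜)` of perfect dg modules: the smallest full triangulated subcategory of
`dgHot(𝒜)` that contains `𝒜` and is closed under direct summands. -/
def dgPer : ObjectProperty (DGHot 𝒜) := fun X =>
  ∀ P : ObjectProperty (DGHot 𝒜), IsThickContainingSelf 𝒜 P → P X

/-- `dgPer^I`, the perfect dg modules `M` such that the support of `H(M̄)` is contained in `I`. -/
def dgPerOn (I : Set ℤ) : ObjectProperty (DGHot 𝒜) := fun X =>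
  dgPer 𝒜 X ∧ X.as.bar.cohomologySupport ⊆ I

/-- The aisle `dgPer^{≤ n}` (for `n = 0`: the first half of the t-structure). -/
def dgPerLE (n : ℤ) : ObjectProperty (DGHot 𝒜) := dgPerOn 𝒜 (Set.Iic n)

/-- The coaisle `dgPer^{≥ n}` (for `n = 0`: the second half of the t-structure). -/
def dgPerGE (n : ℤ) : ObjectProperty (DGHot 𝒜) := dgPerOn 𝒜 (Set.Ici n)

/-- The heart `dgPer^{≤ 0} ∩ dgPer^{≥ 0} = dgPer^{0}` of the t-structure. -/
def heart : ObjectProperty (DGHot 𝒜) := dgPerLE 𝒜 0 ⊓ dgPerGE 𝒜 0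

/-- The heart as a category. -/
abbrev Heart := (heart 𝒜).FullSubcategory

end Perfect

/-! ### Modules with an `L̂`-flag -/

section Flag

variable (𝒜 : DGAlgebra.{u} k) (hd : ∀ a ∈ 𝒜.gr 0, 𝒜.d a = 0)
  {W : Type w} (L : W → ModuleCat.{u} 𝒜.zeroPartᵐᵒᵖ)

/-- The dg modules `M` admitting a finite filtration `0 = F_0 ⊆ F_1 ⊆ ⋯ ⊆ F_n = M` by dg submodules
whose subquotients are isomorphic, in `dgMod(𝒜)`, to some of the `L̂_x`. -/
def dgFlag : ObjectProperty (DGMod 𝒜) := fun M =>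
  ∃ (n : ℕ) (F : Fin (n + 1) → M.Sub),
    (F 0).toSubmodule = ⊥ ∧ (F (Fin.last n)).toSubmodule = ⊤ ∧
    ∀ i : Fin n, (F i.castSucc).toSubmodule ≤ (F i.succ).toSubmodule ∧
      ∃ x : W, Nonempty (DGMod.Sub.subquotient (F i.castSucc) (F i.succ) ≅ hat (L x) hd)

/-- `(L_x)_{x ∈ W}` is a system of representatives of the isomorphism classes of simple right
`A^0`-modules. -/
structure IsSimpleSystem : Prop where
  simple : ∀ x, IsSimpleModule 𝒜.zeroPartᵐᵒᵖ (L x)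
  eq_of_iso : ∀ x y, Nonempty (L x ≅ L y) → x = y
  exists_iso : ∀ S : ModuleCat.{u} 𝒜.zeroPartᵐᵒᵖ, IsSimpleModule 𝒜.zeroPartᵐᵒᵖ S →
    ∃ x, Nonempty (S ≅ L x)

end Flag

/-- Objects of finite length: those obtained from zero objects by finitely many successive
extensions by simple objects, i.e. the objects having a finite composition series. -/
inductive HasFiniteLength {C : Type*} [Category* C] [Preadditive C] : C → Prop
  | of_isZero (X : C) (hX : IsZero X) : HasFiniteLength X
  | of_shortExact (S : ShortComplex C) (hS : S.ShortExact) (h₁ : HasFiniteLength S.X₁)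
      (h₃ : Simple S.X₃) : HasFiniteLength S.X₂

end DGPerf

end

/-!
Call a dg module sorted if it has a finite filtration whose subquotients are shifts of the `L̂_x`,
in weakly increasing degrees from the sub upwards. A subquotient of larger degree that comes below
one of smaller degree either can be moved past it or is joined to it by a differential, which is an
isomorphism; in the latter case the two cancel up to homotopy. Hence the modules homotopy
equivalent to a sorted one are closed under cones. They are closed under direct summands because a
null-homotopic endomorphism of a sorted module is nilpotent, so that idempotents lift, and a retract
of a sorted module is sorted. As `A^0` is semisimple, `A` is sorted, and so every perfect module is
homotopy equivalent to a sorted one.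

If `M` is sorted, then `d M ⊆ M A⁺`, so `H(M̄) = M̄`, and `M` lies in the heart exactly if all its
layers are in degree `0`, that is, if it has a flag. Such modules are generated in degree `0` and
vanish in degree `-1`, so they carry no nonzero homotopies, and the functor to the homotopy category
is fully faithful on them. The simple objects and the finiteness of length are read off in the
category of modules with a flag.
-/

noncomputable section

namespace DGPerf

variable {k : Type v} [CommRing k] {𝒜 : DGAlgebra.{u} k}

/-- The algebra `A` vanishes in negative degrees. -/
abbrev DGAlgebra.IsNonneg (𝒜 : DGAlgebra.{u} k) : Prop := ∀ i : ℤ, i < 0 → 𝒜.gr i = ⊥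

theorem one_mem_gr_zero : (1 : 𝒜.carrier) ∈ 𝒜.gr 0 := SetLike.GradedOne.one_mem

/-! ### Graded pieces as modules over `A^0` -/

theorem gradeProj_smul (M : DGMod 𝒜) {n : ℤ} {m : M.carrier} (hm : m ∈ M.gr n) (i : ℤ)
    (a : 𝒜.carrier) : gradeProj M.gr M.isInternal i (m <• a) =
      m <• gradeProj 𝒜.addGr 𝒜.isInternal (i - n) a := by
  let φ : 𝒜.carrier →+ M.carrier :=
    { toFun := fun a => m <• a
      map_zero' := by simp
      map_add' := fun a b => by simp [add_smul] }
  refine addHom_ext_of_isInternal 𝒜.isInternal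
    ((gradeProj M.gr M.isInternal i).comp φ)
    (φ.comp (gradeProj 𝒜.addGr 𝒜.isInternal (i - n))) (fun j x hx => ?_) a
  have hφx : φ x ∈ M.gr (n + j) := M.smul_mem hm hx
  by_cases hij : i = n + j
  · subst hij
    simp [gradeProj_same _ hφx, gradeProj_same 𝒜.isInternal hx]
  · simp [gradeProj_ne M.isInternal hij hφx,
      gradeProj_ne 𝒜.isInternal (by omega : i - n ≠ j) hx]

theorem smul_mem_gr (M : DGMod 𝒜) {n : ℤ} {m : M.carrier} (hm : m ∈ M.gr n) (r : 𝒜.zeroPart) :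
    m <• (r : 𝒜.carrier) ∈ M.gr n := by
  simpa only [add_zero] using M.smul_mem hm r.2

instance (M : DGMod 𝒜) (n : ℤ) : Module 𝒜.zeroPartᵐᵒᵖ (M.gr n) where
  smul r m := ⟨(m : M.carrier) <• (r.unop : 𝒜.carrier), smul_mem_gr M m.2 r.unop⟩
  one_smul m := Subtype.ext (one_smul _ (m : M.carrier))
  mul_smul r s m := Subtype.ext (mul_smul (MulOpposite.op (r.unop : 𝒜.carrier))
    (MulOpposite.op (s.unop : 𝒜.carrier)) (m : M.carrier))
  smul_zero _ := Subtype.ext (smul_zero _)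
  smul_add _ _ _ := Subtype.ext (smul_add _ _ _)
  add_smul r s m := Subtype.ext (add_smul (MulOpposite.op (r.unop : 𝒜.carrier))
    (MulOpposite.op (s.unop : 𝒜.carrier)) (m : M.carrier))
  zero_smul m := Subtype.ext (zero_smul _ (m : M.carrier))

@[simp] theorem coe_gr_smul (M : DGMod 𝒜) (n : ℤ) (r : 𝒜.zeroPartᵐᵒᵖ) (m : M.gr n) :
    ((r • m : M.gr n) : M.carrier) = (m : M.carrier) <• (r.unop : 𝒜.carrier) := rfl

/-- The `A^0`-linear map between graded pieces induced by an `A`-linear map. -/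
def grMap {M N : DGMod 𝒜} {n n' : ℤ} (f : M.carrier →ₗ[𝒜.carrierᵐᵒᵖ] N.carrier)
    (hf : ∀ m ∈ M.gr n, f m ∈ N.gr n') : M.gr n →ₗ[𝒜.zeroPartᵐᵒᵖ] N.gr n' where
  toFun m := ⟨f m, hf m m.2⟩
  map_add' _ _ := Subtype.ext (map_add f _ _)
  map_smul' _ _ := Subtype.ext (map_smul f _ _)

namespace DGMod

section Morphisms

variable {M N P : DGMod 𝒜}

/-- The `A^0`-linear map induced by a morphism in degree `n`. -/
abbrev Hom.deg (f : M ⟶ N) (n : ℤ) : M.gr n →ₗ[𝒜.zeroPartᵐᵒᵖ] N.gr n :=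
  grMap (Hom.toLin f) fun _ h => Hom.map_mem f h

theorem Hom.map_gradeProj (f : M ⟶ N) (i : ℤ) (m : M.carrier) :
    Hom.toLin f (gradeProj M.gr M.isInternal i m) =
      gradeProj N.gr N.isInternal i (Hom.toLin f m) :=
  DGPerf.map_gradeProj M.isInternal N.isInternal (Hom.toLin f).toAddMonoidHom
    (fun _ _ h => Hom.map_mem f h) i m

theorem Hom.mem_gr_of_injective {f : M ⟶ N} (hf : Function.Injective (Hom.toLin f)) {i : ℤ}
    {m : M.carrier} (hm : Hom.toLin f m ∈ N.gr i) : m ∈ M.gr i := by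
  rw [← hf ((Hom.map_gradeProj f i m).trans (gradeProj_same _ hm))]
  exact gradeProj_mem _ _ _

theorem Hom.deg_surjective {f : M ⟶ N} (hf : Function.Surjective (Hom.toLin f)) (n : ℤ) :
    Function.Surjective (Hom.deg f n) := fun y => by
  obtain ⟨x, hx⟩ := hf y
  refine ⟨⟨gradeProj M.gr M.isInternal n x, gradeProj_mem _ _ _⟩, Subtype.ext ?_⟩
  exact (Hom.map_gradeProj f n x).trans (by rw [hx, gradeProj_same _ y.2])

theorem toLin_comp_apply (f : M ⟶ N) (g : N ⟶ P) (m : M.carrier) :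
    Hom.toLin (f ≫ g) m = Hom.toLin g (Hom.toLin f m) := rfl

theorem hom_ext' {f g : M ⟶ N} (h : ∀ m, Hom.toLin f m = Hom.toLin g m) : f = g :=
  hom_ext (LinearMap.ext h)

theorem toLin_congr {f g : M ⟶ N} (h : f = g) (m : M.carrier) : Hom.toLin f m = Hom.toLin g m :=
  h ▸ rfl

theorem hom_inv_apply (e : M ≅ N) (m : M.carrier) : Hom.toLin e.inv (Hom.toLin e.hom m) = m :=
  toLin_congr e.hom_inv_id m

theorem inv_hom_apply (e : M ≅ N) (m : N.carrier) : Hom.toLin e.hom (Hom.toLin e.inv m) = m :=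
  toLin_congr e.inv_hom_id m

theorem bijective_of_iso (e : M ≅ N) : Function.Bijective (Hom.toLin e.hom) :=
  Function.bijective_iff_has_inverse.2 ⟨Hom.toLin e.inv, hom_inv_apply e, inv_hom_apply e⟩

/-- The linear equivalence induced by an isomorphism in degree `n`. -/
def degEquiv (e : M ≅ N) (n : ℤ) : M.gr n ≃ₗ[𝒜.zeroPartᵐᵒᵖ] N.gr n :=
  LinearEquiv.ofLinearMap (Hom.deg e.hom n) (Hom.deg e.inv n)
    (LinearMap.ext fun m => Subtype.ext (inv_hom_apply e m))
    (LinearMap.ext fun m => Subtype.ext (hom_inv_apply e m))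

/-- A bijective morphism of dg modules, as an isomorphism. -/
def isoOfBijective (f : M ⟶ N) (hf : Function.Bijective (Hom.toLin f)) : M ≅ N :=
  have hinv := (LinearEquiv.ofBijective (Hom.toLin f) hf).apply_symm_apply
  { hom := f
    inv :=
      { toLin := (LinearEquiv.ofBijective (Hom.toLin f) hf).symm.toLinearMap
        map_mem := fun {_ y} hy => Hom.mem_gr_of_injective hf.1 (by
          rw [LinearEquiv.coe_coe]
          exact (hinv y).symm ▸ hy)
        comm := fun y => hf.1 <|
          (hinv (N.d y)).trans ((congrArg N.d (hinv y)).symm.trans (Hom.comm f _).symm) }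
    hom_inv_id := hom_ext' (LinearEquiv.ofBijective (Hom.toLin f) hf).symm_apply_apply
    inv_hom_id := hom_ext' hinv }

end Morphisms

/-! ### Generation in a single degree -/

/-- `M` is generated over `A` by its homogeneous elements of degree `n`. -/
def GeneratedIn (M : DGMod 𝒜) (n : ℤ) : Prop :=
  Submodule.span 𝒜.carrierᵐᵒᵖ (M.gr n : Set M.carrier) = ⊤

namespace GeneratedIn

variable {M N : DGMod 𝒜} {n : ℤ}

theorem mem_span (hM : M.GeneratedIn n) (m : M.carrier) :
    m ∈ Submodule.span 𝒜.carrierᵐᵒᵖ (M.gr n : Set M.carrier) := by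
  rw [hM]; trivial

theorem of_le (h : ∀ m, m ∈ Submodule.span 𝒜.carrierᵐᵒᵖ (M.gr n : Set M.carrier)) :
    M.GeneratedIn n := (Submodule.eq_top_iff').2 h

theorem gr_le (hM : M.GeneratedIn n) (i : ℤ) :
    M.gr i ≤ AddSubgroup.closure {x | ∃ m ∈ M.gr n, ∃ a ∈ 𝒜.gr (i - n), x = m <• a} := by
  intro x hx
  rw [← gradeProj_same M.isInternal hx]
  clear hx
  induction hM.mem_span x using Submodule.closure_induction with
  | zero => rw [map_zero]; exact zero_mem _
  | add x y _ _ hx hy => rw [map_add]; exact add_mem hx hy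
  | smul_mem r x hx =>
    exact AddSubgroup.subset_closure
      ⟨x, hx, _, gradeProj_mem 𝒜.isInternal _ _, gradeProj_smul M hx i r.unop⟩

theorem gr_eq_bot (hM : M.GeneratedIn n) (hpos : 𝒜.IsNonneg) {i : ℤ} (hi : i < n) :
    M.gr i = ⊥ := by
  refine eq_bot_iff.2 ((hM.gr_le i).trans ((AddSubgroup.closure_le _).2 ?_))
  rintro _ ⟨m, _, a, ha, rfl⟩
  rw [hpos _ (by omega), Submodule.mem_bot] at ha
  simp [ha]

theorem map_mem (hM : M.GeneratedIn n) {n' : ℤ} (f : M.carrier →ₗ[𝒜.carrierᵐᵒᵖ] N.carrier)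
    (hf : ∀ m ∈ M.gr n, f m ∈ N.gr n') {i i' : ℤ} (hi : i - n = i' - n') {m : M.carrier}
    (hm : m ∈ M.gr i) : f m ∈ N.gr i' := by
  have : M.gr i ≤ (N.gr i').comap f.toAddMonoidHom := by
    refine (hM.gr_le i).trans ((AddSubgroup.closure_le _).2 ?_)
    rintro _ ⟨m, hm, a, ha, rfl⟩
    have hfma := N.smul_mem (hf m hm) ha
    rw [show n' + (i - n) = i' by omega] at hfma
    change f (m <• a) ∈ N.gr i'
    rwa [map_smul]
  exact this hm

theorem map_mem_span (hM : M.GeneratedIn n) {n' : ℤ}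
    (f : M.carrier →ₗ[𝒜.carrierᵐᵒᵖ] N.carrier) (hf : ∀ m ∈ M.gr n, f m ∈ N.gr n')
    (m : M.carrier) : f m ∈ Submodule.span 𝒜.carrierᵐᵒᵖ (N.gr n' : Set N.carrier) :=
  (Submodule.span_le (p := (Submodule.span _ _).comap f)).2
    (fun y hy => Submodule.subset_span (hf y hy)) (hM.mem_span m)

theorem of_surjective (hM : M.GeneratedIn n) (f : M ⟶ N)
    (hf : Function.Surjective (Hom.toLin f)) : N.GeneratedIn n := of_le fun y => by
  obtain ⟨x, rfl⟩ := hf y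
  exact hM.map_mem_span _ (fun _ hm => Hom.map_mem f hm) x

theorem linearMap_ext (hM : M.GeneratedIn n) {X : Type*} [AddCommGroup X]
    [Module 𝒜.carrierᵐᵒᵖ X] {f g : M.carrier →ₗ[𝒜.carrierᵐᵒᵖ] X}
    (hfg : ∀ m ∈ M.gr n, f m = g m) : f = g :=
  LinearMap.ext_on hM hfg

theorem hom_ext (hM : M.GeneratedIn n) {f g : M ⟶ N}
    (h : ∀ m ∈ M.gr n, Hom.toLin f m = Hom.toLin g m) : f = g :=
  DGMod.hom_ext (hM.linearMap_ext h)

theorem hom_eq_zero (hM : M.GeneratedIn n) (hN : N.gr n = ⊥) (f : M ⟶ N) : f = 0 :=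
  hM.hom_ext fun m hm => by
    have := Hom.map_mem f hm
    rwa [hN, AddSubgroup.mem_bot] at this

/-- The morphism underlying a linear map that is compatible with degrees and differentials on
generators annihilated by the differential. -/
def homMk (hM : M.GeneratedIn n) (hd : ∀ m ∈ M.gr n, M.d m = 0)
    (f : M.carrier →ₗ[𝒜.carrierᵐᵒᵖ] N.carrier) (hf : ∀ m ∈ M.gr n, f m ∈ N.gr n)
    (hfd : ∀ m ∈ M.gr n, N.d (f m) = 0) : M ⟶ N where
  toLin := f
  map_mem hm := hM.map_mem f hf rfl hm
  comm m := by
    induction hM.mem_span m using Submodule.closure_induction with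
    | zero => simp
    | add x y _ _ hx hy => simp [hx, hy]
    | smul_mem r x hx =>
      have hM' := M.leibniz r.unop hx
      have hN' := N.leibniz r.unop (hf x hx)
      rw [MulOpposite.op_unop] at hM' hN'
      simp only [map_smul f, hM', hN', hd x hx, hfd x hx, Units.smul_def, map_zsmul,
        smul_zero, zero_add]

end GeneratedIn

/-! ### Dg modules free on a graded piece -/

/-- `K` is freely generated over `A` by the `A^0`-module `K^n`, on which the differential
vanishes. Freeness is the universal property of `K^n ⊗_{A^0} A`, for balanced additive maps. -/
structure FreeOn (n : ℤ) (K : DGMod 𝒜) : Prop where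
  gen : K.GeneratedIn n
  d_zero : ∀ m ∈ K.gr n, K.d m = 0
  lift : ∀ (X : Type u) [AddCommGroup X] [Module 𝒜.carrierᵐᵒᵖ X] (φ : K.gr n →+ X),
    (∀ (r : 𝒜.zeroPart) (m : K.gr n), φ (MulOpposite.op r • m) = φ m <• (r : 𝒜.carrier)) →
    ∃ f : K.carrier →ₗ[𝒜.carrierᵐᵒᵖ] X, ∀ m : K.gr n, f m = φ m

namespace FreeOn

variable {n : ℤ} {K N : DGMod 𝒜}

theorem exists_linear {n' : ℤ} (hK : FreeOn n K) (φ : K.gr n →ₗ[𝒜.zeroPartᵐᵒᵖ] N.gr n') :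
    ∃ f : K.carrier →ₗ[𝒜.carrierᵐᵒᵖ] N.carrier, ∀ m : K.gr n, f m = φ m :=
  hK.lift N.carrier ((N.gr n').subtype.comp φ.toAddMonoidHom) fun r m =>
    congrArg Subtype.val (φ.map_smul (MulOpposite.op r) m)

theorem exists_hom (hK : FreeOn n K) (φ : K.gr n →ₗ[𝒜.zeroPartᵐᵒᵖ] N.gr n)
    (hφ : ∀ m, N.d (φ m) = 0) : ∃ f : K ⟶ N, ∀ m : K.gr n, Hom.toLin f m = φ m := by
  obtain ⟨f, hf⟩ := hK.exists_linear φ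
  refine ⟨hK.gen.homMk hK.d_zero f (fun m hm => ?_) (fun m hm => ?_), hf⟩
  · rw [hf ⟨m, hm⟩]; exact (φ _).2
  · rw [hf ⟨m, hm⟩]; exact hφ _

theorem isIso_of_bijective_deg (hK : FreeOn n K) (hN : FreeOn n N) (f : K ⟶ N)
    (hf : Function.Bijective (Hom.deg f n)) : IsIso f := by
  let e := LinearEquiv.ofBijective (Hom.deg f n) hf
  obtain ⟨g, hg⟩ := hN.exists_hom e.symm.toLinearMap fun m => hK.d_zero _ (e.symm m).2
  refine ⟨g, hK.gen.hom_ext fun m hm => ?_, hN.gen.hom_ext fun m hm => ?_⟩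
  · exact (hg (Hom.deg f n ⟨m, hm⟩)).trans (congrArg Subtype.val (e.symm_apply_apply ⟨m, hm⟩))
  · exact (congrArg (Hom.toLin f) (hg ⟨m, hm⟩)).trans
      (congrArg Subtype.val (e.apply_symm_apply ⟨m, hm⟩))

theorem nonempty_iso (hK : FreeOn n K) (hN : FreeOn n N)
    (e : K.gr n ≃ₗ[𝒜.zeroPartᵐᵒᵖ] N.gr n) : Nonempty (K ≅ N) := by
  obtain ⟨f, hf⟩ := hK.exists_hom e.toLinearMap fun m => hN.d_zero _ (e m).2
  have hfe : Hom.deg f n = e.toLinearMap := LinearMap.ext fun m => Subtype.ext (hf m)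
  have := hK.isIso_of_bijective_deg hN f (by rw [hfe]; exact e.bijective)
  exact ⟨asIso f⟩

protected theorem shift (j s : ℤ) (hj : j + s = n) (hK : FreeOn n K) : FreeOn j (K.shift s) := by
  subst hj
  refine ⟨hK.gen, fun m hm => ?_, hK.lift⟩
  change s.negOnePow • K.d m = 0
  rw [hK.d_zero m hm, smul_zero]

theorem of_iso (e : K ≅ N) (hK : FreeOn n K) : FreeOn n N where
  gen := hK.gen.of_surjective e.hom (bijective_of_iso e).2
  d_zero m hm := by
    rw [← inv_hom_apply e m, ← Hom.comm, hK.d_zero _ (Hom.map_mem e.inv hm), map_zero]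
  lift X _ _ φ hφ := by
    obtain ⟨f, hf⟩ := hK.lift X (φ.comp (degEquiv e n).toLinearMap.toAddMonoidHom) fun r m =>
      (congrArg φ (map_smul (degEquiv e n) (MulOpposite.op r) m)).trans (hφ r _)
    exact ⟨f.comp (Hom.toLin e.inv), fun m => (hf ((degEquiv e n).symm m)).trans
      (congrArg φ ((degEquiv e n).apply_symm_apply m))⟩

end FreeOn

/-- `K` is freely generated by the simple `A^0`-module `K^n`: up to isomorphism, `K` is a shift of
some `L̂` with `L` simple. -/
structure SimpleFreeOn (n : ℤ) (K : DGMod 𝒜) : Prop extends FreeOn n K where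
  simple : IsSimpleModule 𝒜.zeroPartᵐᵒᵖ (K.gr n)

namespace SimpleFreeOn

variable {n : ℤ} {K M : DGMod 𝒜}

theorem isIso_or_eq_zero (hK : SimpleFreeOn n K) (hM : SimpleFreeOn n M) (f : K ⟶ M) :
    IsIso f ∨ f = 0 := by
  have := hK.simple
  have := hM.simple
  exact (LinearMap.bijective_or_eq_zero (Hom.deg f n)).imp
    (hK.toFreeOn.isIso_of_bijective_deg hM.toFreeOn f) fun h => hK.gen.hom_ext
    fun m hm => congrArg Subtype.val (LinearMap.congr_fun h ⟨m, hm⟩)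

theorem exists_ne_zero (hK : SimpleFreeOn n K) : ∃ m ∈ K.gr n, m ≠ 0 := by
  have := hK.simple
  have := IsSimpleModule.nontrivial 𝒜.zeroPartᵐᵒᵖ (K.gr n)
  obtain ⟨m, hm⟩ := exists_ne (0 : K.gr n)
  exact ⟨m, m.2, fun h => hm (Subtype.ext h)⟩

protected theorem shift (j s : ℤ) (hj : j + s = n) (hK : SimpleFreeOn n K) :
    SimpleFreeOn j (K.shift s) := by
  refine ⟨hK.toFreeOn.shift j s hj, ?_⟩
  subst hj
  exact hK.simple

theorem of_iso (e : K ≅ M) (hK : SimpleFreeOn n K) : SimpleFreeOn n M where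
  toFreeOn := hK.toFreeOn.of_iso e
  simple := by
    have := hK.simple
    exact IsSimpleModule.congr (degEquiv e n).symm

end SimpleFreeOn

/-! ### Graded-split extensions -/

namespace Sub

variable {M N : DGMod 𝒜}

/-- The projection onto the quotient by a dg submodule. -/
def proj (V : Sub M) : M ⟶ V.quotient where
  toLin := V.toSubmodule.mkQ
  map_mem h := ⟨_, h, rfl⟩
  comm _ := rfl

theorem proj_surjective (V : Sub M) : Function.Surjective (Hom.toLin V.proj) :=
  V.toSubmodule.mkQ_surjective

theorem proj_eq_zero_iff (V : Sub M) {x : M.carrier} :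
    Hom.toLin V.proj x = 0 ↔ x ∈ V.toSubmodule :=
  Submodule.Quotient.mk_eq_zero _

/-- The morphism induced on the quotient by a morphism that vanishes on a dg submodule. -/
def desc (V : Sub M) (f : M ⟶ N) (hf : ∀ x ∈ V.toSubmodule, Hom.toLin f x = 0) :
    V.quotient ⟶ N where
  toLin := V.toSubmodule.liftQ (Hom.toLin f) hf
  map_mem := by
    rintro i _ ⟨m, hm, rfl⟩
    exact Hom.map_mem f hm
  comm x := by
    obtain ⟨m, rfl⟩ := V.proj_surjective x
    exact Hom.comm f m

/-- The image of a morphism of dg modules. -/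
def range (f : M ⟶ N) : Sub N where
  toSubmodule := LinearMap.range (Hom.toLin f)
  homogeneous := by
    rintro _ ⟨m, rfl⟩ i
    exact ⟨_, Hom.map_gradeProj f i m⟩
  d_mem := by
    rintro _ ⟨m, rfl⟩
    exact ⟨_, Hom.comm f m⟩

theorem proj_range_apply (f : M ⟶ N) (m : M.carrier) :
    Hom.toLin (range f).proj (Hom.toLin f m) = 0 :=
  (proj_eq_zero_iff _).2 (LinearMap.mem_range_self (Hom.toLin f) m)

theorem subsingleton_quotient_range (K : DGMod 𝒜) :
    Subsingleton (range (𝟙 K)).quotient.carrier := by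
  refine subsingleton_of_forall_eq 0 fun x => ?_
  obtain ⟨x, rfl⟩ := (range (𝟙 K)).proj_surjective x
  exact proj_range_apply (𝟙 K) x

end Sub

/-- An extension `K ⟶ E ⟶ Q` of dg modules together with a splitting of the underlying graded
modules. -/
structure SplitExt (K E Q : DGMod 𝒜) where
  /-- the inclusion -/
  i : K ⟶ E
  /-- the projection -/
  q : E ⟶ Q
  /-- the graded retraction -/
  ρ : E.carrier →ₗ[𝒜.carrierᵐᵒᵖ] K.carrier
  /-- the graded section -/
  σ : Q.carrier →ₗ[𝒜.carrierᵐᵒᵖ] E.carrier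
  ρ_mem : ∀ {n : ℤ} {x : E.carrier}, x ∈ E.gr n → ρ x ∈ K.gr n
  σ_mem : ∀ {n : ℤ} {x : Q.carrier}, x ∈ Q.gr n → σ x ∈ E.gr n
  ρ_i : ∀ x, ρ (Hom.toLin i x) = x
  q_σ : ∀ x, Hom.toLin q (σ x) = x
  sum : ∀ x, Hom.toLin i (ρ x) + σ (Hom.toLin q x) = x

namespace SplitExt

section Basic

variable {K E Q N : DGMod 𝒜} (s : SplitExt K E Q)

theorem i_injective : Function.Injective (Hom.toLin s.i) :=
  Function.LeftInverse.injective s.ρ_i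

theorem q_surjective : Function.Surjective (Hom.toLin s.q) :=
  Function.RightInverse.surjective s.q_σ

theorem q_i (x : K.carrier) : Hom.toLin s.q (Hom.toLin s.i x) = 0 := by
  have := congrArg (Hom.toLin s.q) (s.sum (Hom.toLin s.i x))
  rwa [map_add, s.q_σ, s.ρ_i, add_eq_right] at this

theorem i_comp_q : s.i ≫ s.q = 0 := hom_ext' s.q_i

theorem ρ_σ (x : Q.carrier) : s.ρ (s.σ x) = 0 := by
  have := congrArg s.ρ (s.sum (s.σ x))
  rwa [map_add, s.ρ_i, s.q_σ, add_eq_right] at this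

theorem i_ρ (x : E.carrier) : Hom.toLin s.i (s.ρ x) = x - s.σ (Hom.toLin s.q x) :=
  eq_sub_of_add_eq (s.sum x)

theorem i_ρ_of_q_eq_zero {x : E.carrier} (hx : Hom.toLin s.q x = 0) :
    Hom.toLin s.i (s.ρ x) = x := by
  rw [s.i_ρ, hx, map_zero, sub_zero]

theorem map_σ_q {X : Type*} [AddCommGroup X] [Module 𝒜.carrierᵐᵒᵖ X]
    (f : E.carrier →ₗ[𝒜.carrierᵐᵒᵖ] X) (hf : ∀ x, f (Hom.toLin s.i x) = 0) (e : E.carrier) :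
    f (s.σ (Hom.toLin s.q e)) = f e := by
  conv_rhs => rw [← s.sum e, map_add, hf, zero_add]

theorem epi_q : Epi s.q := ⟨fun f g hfg => hom_ext' fun x => by
  obtain ⟨e, rfl⟩ := s.q_surjective x
  exact toLin_congr hfg e⟩

/-- The morphism induced on the quotient by a morphism that vanishes on the sub. -/
def desc (f : E ⟶ N) (hf : s.i ≫ f = 0) : Q ⟶ N where
  toLin := (Hom.toLin f).comp s.σ
  map_mem h := Hom.map_mem f (s.σ_mem h)
  comm x := by
    have key := s.map_σ_q (Hom.toLin f) (toLin_congr hf)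
    obtain ⟨e, rfl⟩ := s.q_surjective x
    rw [LinearMap.comp_apply, LinearMap.comp_apply, ← Hom.comm s.q, key, key, Hom.comm]

theorem desc_q (f : E ⟶ N) (hf : s.i ≫ f = 0) (e : E.carrier) :
    Hom.toLin (s.desc f hf) (Hom.toLin s.q e) = Hom.toLin f e :=
  s.map_σ_q (Hom.toLin f) (toLin_congr hf) e

theorem q_comp_desc (f : E ⟶ N) (hf : s.i ≫ f = 0) : s.q ≫ s.desc f hf = f :=
  hom_ext' (s.desc_q f hf)

/-- The morphism to the sub induced by a morphism that vanishes in the quotient. -/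
def lift (f : N ⟶ E) (hf : f ≫ s.q = 0) : N ⟶ K where
  toLin := s.ρ.comp (Hom.toLin f)
  map_mem h := s.ρ_mem (Hom.map_mem f h)
  comm x := by
    have key := fun e => s.i_ρ_of_q_eq_zero (toLin_congr hf e)
    apply s.i_injective
    rw [LinearMap.comp_apply, LinearMap.comp_apply, Hom.comm s.i, key, key, Hom.comm]

theorem lift_comp_i (f : N ⟶ E) (hf : f ≫ s.q = 0) : s.lift f hf ≫ s.i = f :=
  hom_ext' fun e => s.i_ρ_of_q_eq_zero (toLin_congr hf e)

end Basic

section Constructions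

variable {K K' E E' Q : DGMod 𝒜}

/-- The extension of the cokernel of `i` by `K` defined by a graded retraction of `i`. -/
def ofRetraction (i : K ⟶ E) (ρ : E.carrier →ₗ[𝒜.carrierᵐᵒᵖ] K.carrier)
    (ρ_mem : ∀ {n : ℤ} {x : E.carrier}, x ∈ E.gr n → ρ x ∈ K.gr n)
    (ρ_i : ∀ x, ρ (Hom.toLin i x) = x) : SplitExt K E (Sub.range i).quotient where
  i := i
  q := (Sub.range i).proj
  ρ := ρ
  σ := (LinearMap.range (Hom.toLin i)).liftQ (LinearMap.id - (Hom.toLin i).comp ρ) <| by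
    rintro _ ⟨x, rfl⟩
    simp [ρ_i]
  ρ_mem := ρ_mem
  σ_mem := by
    rintro n _ ⟨x, hx, rfl⟩
    exact sub_mem hx (Hom.map_mem i (ρ_mem hx))
  ρ_i := ρ_i
  q_σ x := by
    obtain ⟨x, rfl⟩ := (Sub.range i).proj_surjective x
    change Hom.toLin (Sub.range i).proj (x - Hom.toLin i (ρ x)) = _
    rw [map_sub, Sub.proj_range_apply, sub_zero]
  sum x := by
    change Hom.toLin i (ρ x) + (x - Hom.toLin i (ρ x)) = x
    exact add_sub_cancel _ _

/-- The extension defined by a graded section of the second map of a short exact sequence. -/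
def ofSection (i : K ⟶ E) (q : E ⟶ Q) (σ : Q.carrier →ₗ[𝒜.carrierᵐᵒᵖ] E.carrier)
    (σ_mem : ∀ {n : ℤ} {x : Q.carrier}, x ∈ Q.gr n → σ x ∈ E.gr n)
    (q_σ : ∀ x, Hom.toLin q (σ x) = x) (hi : Function.Injective (Hom.toLin i))
    (hex : Function.Exact (Hom.toLin i) (Hom.toLin q)) : SplitExt K E Q :=
  have hp : ∀ x, x - σ (Hom.toLin q x) ∈ LinearMap.range (Hom.toLin i) := fun x =>
    (hex _).1 (by rw [map_sub, q_σ, sub_self])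
  let ρ : E.carrier →ₗ[𝒜.carrierᵐᵒᵖ] K.carrier :=
    (LinearEquiv.ofInjective (Hom.toLin i) hi).symm.toLinearMap.comp
      ((LinearMap.id - σ.comp (Hom.toLin q)).codRestrict _ hp)
  have i_ρ : ∀ x, Hom.toLin i (ρ x) = x - σ (Hom.toLin q x) := fun x =>
    LinearEquiv.ofInjective_symm_apply (h := hi) _ _
  { i := i
    q := q
    ρ := ρ
    σ := σ
    ρ_mem := fun {n x} hx => Hom.mem_gr_of_injective hi <| by
      rw [i_ρ]
      exact sub_mem hx (σ_mem (Hom.map_mem q hx))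
    σ_mem := σ_mem
    ρ_i := fun x => hi (by rw [i_ρ, hex.apply_apply_eq_zero, map_zero, sub_zero])
    q_σ := q_σ
    sum := fun x => by rw [i_ρ, sub_add_cancel] }

/-- Transport of an extension along isomorphisms of the sub and of the middle term. -/
def ofIso (s : SplitExt K E Q) (e : K ≅ K') (e' : E ≅ E') : SplitExt K' E' Q where
  i := e.inv ≫ s.i ≫ e'.hom
  q := e'.inv ≫ s.q
  ρ := (Hom.toLin e.hom).comp (s.ρ.comp (Hom.toLin e'.inv))
  σ := (Hom.toLin e'.hom).comp s.σ
  ρ_mem h := Hom.map_mem e.hom (s.ρ_mem (Hom.map_mem e'.inv h))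
  σ_mem h := Hom.map_mem e'.hom (s.σ_mem h)
  ρ_i x := by
    simp only [toLin_comp_apply, LinearMap.comp_apply, hom_inv_apply, inv_hom_apply, s.ρ_i]
  q_σ x := by simp only [toLin_comp_apply, LinearMap.comp_apply, hom_inv_apply, s.q_σ]
  sum x := by
    simp only [toLin_comp_apply, LinearMap.comp_apply, hom_inv_apply, ← map_add, s.sum,
      inv_hom_apply]

/-- `K` as an extension of a zero module by itself. -/
def refl (K : DGMod 𝒜) : SplitExt K K (Sub.range (𝟙 K)).quotient :=
  ofRetraction (𝟙 K) LinearMap.id (fun h => h) fun _ => rfl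

/-- If the sub vanishes, the projection is an isomorphism. -/
def isoOfSubsingleton (s : SplitExt K E Q) (h : Subsingleton K.carrier) : E ≅ Q :=
  isoOfBijective s.q ⟨(injective_iff_map_eq_zero _).2 fun x hx => by
    rw [← s.i_ρ_of_q_eq_zero hx, Subsingleton.elim (s.ρ x) 0, map_zero], s.q_surjective⟩

end Constructions

section Filtrations

variable {K K₁ E M N N₁ Q : DGMod 𝒜}

/- With `z = ρ₁ (q e)`, the retraction onto `K` that kills the lifted copy of `K₁` is
`e ↦ ρ (e - t z)`. -/
theorem exists_swap (s : SplitExt K E M) (s₁ : SplitExt K₁ M Q) (t : K₁ ⟶ E)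
    (ht : t ≫ s.q = s₁.i) :
    ∃ (Q' : DGMod 𝒜) (s₂ : SplitExt K₁ E Q'), s₂.i = t ∧ Nonempty (SplitExt K Q' Q) := by
  have q_t (x) : Hom.toLin s.q (Hom.toLin t x) = Hom.toLin s₁.i x := toLin_congr ht x
  let s₂ := ofRetraction t (s₁.ρ.comp (Hom.toLin s.q))
    (fun h => s₁.ρ_mem (Hom.map_mem s.q h)) fun x => by rw [LinearMap.comp_apply, q_t, s₁.ρ_i]
  have h0 : s₂.i ≫ s.q ≫ s₁.q = 0 := by
    rw [← Category.assoc, ← s₁.i_comp_q, ← ht]; rfl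
  let ρ : E.carrier →ₗ[𝒜.carrierᵐᵒᵖ] K.carrier :=
    s.ρ.comp (LinearMap.id - (Hom.toLin t).comp s₂.ρ)
  have ρ_t (x) : ρ (Hom.toLin s₂.i x) = 0 := by
    change s.ρ (Hom.toLin s₂.i x - Hom.toLin t (s₂.ρ (Hom.toLin s₂.i x))) = 0
    rw [s₂.ρ_i]
    exact (congrArg s.ρ (sub_self (Hom.toLin t x))).trans (map_zero _)
  refine ⟨_, s₂, rfl, ⟨{
    i := s.i ≫ s₂.q
    q := s₂.desc (s.q ≫ s₁.q) h0
    ρ := ρ.comp s₂.σ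
    σ := (Hom.toLin s₂.q).comp (s.σ.comp s₁.σ)
    ρ_mem := fun h => s.ρ_mem (sub_mem (s₂.σ_mem h) (Hom.map_mem t (s₂.ρ_mem (s₂.σ_mem h))))
    σ_mem := fun h => Hom.map_mem s₂.q (s.σ_mem (s₁.σ_mem h))
    ρ_i := fun x => (s₂.map_σ_q ρ ρ_t _).trans ?_
    q_σ := fun x => (s₂.desc_q _ h0 _).trans ?_
    sum := fun y => ?_ }⟩⟩
  · change s.ρ (Hom.toLin s.i x - Hom.toLin t (s₁.ρ (Hom.toLin s.q (Hom.toLin s.i x)))) = x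
    rw [s.q_i, map_zero, map_zero, sub_zero, s.ρ_i]
  · rw [toLin_comp_apply, LinearMap.comp_apply, s.q_σ, s₁.q_σ]
  · obtain ⟨e, rfl⟩ := s₂.q_surjective y
    rw [LinearMap.comp_apply, s₂.map_σ_q ρ ρ_t, s₂.desc_q]
    change Hom.toLin s₂.q (Hom.toLin s.i (s.ρ (e - Hom.toLin t (s₁.ρ (Hom.toLin s.q e))))) +
      Hom.toLin s₂.q (s.σ (s₁.σ (Hom.toLin s₁.q (Hom.toLin s.q e)))) = _
    rw [← map_add, s.i_ρ, map_sub, q_t, s₁.i_ρ, sub_sub_cancel, sub_add_cancel, map_sub]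
    exact sub_eq_self.2 (s₂.q_i _)

theorem exists_quotient (s : SplitExt N E Q) (s₁ : SplitExt K N N₁) :
    ∃ E₁, Nonempty (SplitExt K E E₁) ∧ Nonempty (SplitExt N₁ E₁ Q) := by
  let s₂ := ofRetraction (s₁.i ≫ s.i) (s₁.ρ.comp s.ρ)
    (fun h => s₁.ρ_mem (s.ρ_mem h)) fun x => by
      rw [LinearMap.comp_apply, toLin_comp_apply, s.ρ_i, s₁.ρ_i]
  have h0 : s₂.i ≫ s.q = 0 := (Category.assoc _ _ _).trans (by rw [s.i_comp_q, comp_zero])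
  have h1 : s₁.i ≫ s.i ≫ s₂.q = 0 := (Category.assoc _ _ _).symm.trans s₂.i_comp_q
  let ρ : E.carrier →ₗ[𝒜.carrierᵐᵒᵖ] N₁.carrier := (Hom.toLin s₁.q).comp s.ρ
  have ρ_i (x) : ρ (Hom.toLin s₂.i x) = 0 := by
    change Hom.toLin s₁.q (s.ρ (Hom.toLin s.i (Hom.toLin s₁.i x))) = 0
    rw [s.ρ_i, s₁.q_i]
  refine ⟨_, ⟨s₂⟩, ⟨{
    i := s₁.desc (s.i ≫ s₂.q) h1
    q := s₂.desc s.q h0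
    ρ := ρ.comp s₂.σ
    σ := (Hom.toLin s₂.q).comp s.σ
    ρ_mem := fun h => Hom.map_mem s₁.q (s.ρ_mem (s₂.σ_mem h))
    σ_mem := fun h => Hom.map_mem s₂.q (s.σ_mem h)
    ρ_i := fun x => ?_
    q_σ := fun x => (s₂.desc_q _ h0 _).trans (s.q_σ x)
    sum := fun y => ?_ }⟩⟩
  · obtain ⟨x, rfl⟩ := s₁.q_surjective x
    rw [desc_q, LinearMap.comp_apply, toLin_comp_apply, s₂.map_σ_q ρ ρ_i]
    exact congrArg (Hom.toLin s₁.q) (s.ρ_i x)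
  · obtain ⟨e, rfl⟩ := s₂.q_surjective y
    rw [LinearMap.comp_apply (f := ρ), s₂.map_σ_q ρ ρ_i, s₂.desc_q, LinearMap.comp_apply,
      LinearMap.comp_apply, desc_q, toLin_comp_apply, ← map_add, s.sum]

theorem exists_retract {M' : DGMod 𝒜} (r : Retract M' M) (κ : K ⟶ M') (s : SplitExt K M Q)
    (hs : s.i = κ ≫ r.i) :
    ∃ Q', Nonempty (SplitExt K M' Q') ∧ Nonempty (Retract Q' Q) := by
  let s' := ofRetraction κ (s.ρ.comp (Hom.toLin r.i)) (fun h => s.ρ_mem (Hom.map_mem r.i h))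
    fun x => (congrArg s.ρ (toLin_congr hs x).symm).trans (s.ρ_i x)
  have h1 : s'.i ≫ r.i ≫ s.q = 0 :=
    (Category.assoc κ _ _).symm.trans (by rw [← hs, s.i_comp_q])
  have h2 : s.i ≫ r.r ≫ s'.q = 0 := by
    rw [hs, Category.assoc, r.retract_assoc]
    exact s'.i_comp_q
  have := s'.epi_q
  exact ⟨_, ⟨s'⟩, ⟨{
    i := s'.desc _ h1
    r := s.desc _ h2
    retract := by
      rw [← cancel_epi s'.q, ← Category.assoc, q_comp_desc, Category.assoc, q_comp_desc,
        r.retract_assoc, Category.comp_id] }⟩⟩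

end Filtrations

end SplitExt

/-! ### Sorted modules -/

/-- `M` has a filtration of length `l` whose subquotients are free on simple `A^0`-modules in
degrees which belong to `I`, are at least `n`, and increase weakly from the sub upwards. -/
inductive Sorted (I : Set ℤ) : ℤ → ℕ → DGMod 𝒜 → Prop
  | zero {n : ℤ} {M : DGMod 𝒜} (h : Subsingleton M.carrier) : Sorted I n 0 M
  | ext {n n' : ℤ} {l : ℕ} {K E Q : DGMod 𝒜} (hn : n ≤ n') (hI : n' ∈ I)
      (hK : SimpleFreeOn n' K) (s : SplitExt K E Q) (hQ : Sorted I n' l Q) : Sorted I n (l + 1) E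

namespace Sorted

variable {I : Set ℤ} {n : ℤ} {l : ℕ} {K M : DGMod 𝒜}

theorem mono {n' : ℤ} (h : Sorted I n l M) (hn : n' ≤ n) : Sorted I n' l M := by
  cases h with
  | zero h => exact .zero h
  | ext h1 hI hK s hQ => exact .ext (hn.trans h1) hI hK s hQ

theorem of_simpleFreeOn (hI : n ∈ I) (hK : SimpleFreeOn n K) : Sorted I n 1 K :=
  .ext le_rfl hI hK (.refl K) (.zero (Sub.subsingleton_quotient_range K))

theorem gr_eq_bot (hpos : 𝒜.IsNonneg) (h : Sorted I n l M) {i : ℤ} (hi : i < n) :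
    M.gr i = ⊥ := by
  refine eq_bot_iff.2 fun x hx => ?_
  induction h with
  | zero h => exact Subsingleton.elim _ _
  | ext hn _ hK s _ ih =>
    have hq := ih (hi.trans_le hn) _ (Hom.map_mem s.q hx)
    have hρ := s.ρ_mem hx
    rw [hK.gen.gr_eq_bot hpos (hi.trans_le hn)] at hρ
    rw [AddSubgroup.mem_bot] at hq hρ ⊢
    rw [← s.sum x, hq, hρ, map_zero, map_zero, add_zero]

theorem exists_splitExt (hpos : 𝒜.IsNonneg) (hM : Sorted I n l M) (hK : SimpleFreeOn n K)
    (κ : K ⟶ M) (hκ : κ ≠ 0) :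
    ∃ (l' : ℕ) (Q : DGMod 𝒜) (s : SplitExt K M Q), l = l' + 1 ∧ s.i = κ ∧ Sorted I n l' Q := by
  induction hM with
  | zero h => exact (hκ (hom_ext' fun x => Subsingleton.elim _ _)).elim
  | @ext m n' l K₁ M Q₁ hn hI hK₁ s₁ hQ₁ ih =>
    obtain rfl : m = n' := by
      refine le_antisymm hn (not_lt.1 fun h => hκ (hK.gen.hom_eq_zero ?_ κ))
      exact (Sorted.ext le_rfl hI hK₁ s₁ hQ₁).gr_eq_bot hpos h
    by_cases h : κ ≫ s₁.q = 0
    · rcases hK.isIso_or_eq_zero hK₁ (s₁.lift κ h) with hiso | hzero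
      · refine ⟨l, Q₁, s₁.ofIso (asIso (s₁.lift κ h)).symm (Iso.refl M), rfl, ?_, hQ₁⟩
        change s₁.lift κ h ≫ s₁.i ≫ 𝟙 M = κ
        rw [Category.comp_id, s₁.lift_comp_i]
      · refine (hκ ?_).elim
        rw [← s₁.lift_comp_i κ h, hzero, zero_comp]
    · obtain ⟨l', Q₂, s₂, rfl, hs₂, hQ₂⟩ := ih hK (κ ≫ s₁.q) h
      obtain ⟨Q', s₃, hs₃, ⟨s₄⟩⟩ := s₁.exists_swap s₂ κ hs₂.symm
      exact ⟨l' + 1, Q', s₃, rfl, hs₃, .ext le_rfl hI hK₁ s₄ hQ₂⟩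

theorem retract (hpos : 𝒜.IsNonneg) {M' : DGMod 𝒜} (hM : Sorted I n l M) (r : Retract M' M) :
    ∃ l', Sorted I n l' M' := by
  induction l generalizing n M M' with
  | zero =>
    cases hM with
    | zero h =>
      have hr : Function.Injective (Hom.toLin r.i) :=
        Function.LeftInverse.injective (toLin_congr r.retract)
      exact ⟨0, .zero hr.subsingleton⟩
  | succ l ih =>
    cases hM with
    | @ext _ n' _ K _ Q hn hI hK s hQ =>
      by_cases h : s.i ≫ r.r = 0
      · let r' : Retract M' Q := ⟨r.i ≫ s.q, s.desc r.r h, by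
          rw [Category.assoc, s.q_comp_desc, r.retract]⟩
        obtain ⟨l', h'⟩ := ih hQ r'
        exact ⟨l', h'.mono hn⟩
      · have hκ : (s.i ≫ r.r) ≫ r.i ≠ 0 := fun h0 => h (by
          rw [← Category.comp_id (s.i ≫ r.r), ← r.retract, ← Category.assoc, h0, zero_comp])
        obtain ⟨l', Q₂, s₂, hl, hs₂, hQ₂⟩ :=
          (Sorted.ext le_rfl hI hK s hQ).exists_splitExt hpos hK _ hκ
        obtain rfl : l = l' := by omega
        obtain ⟨Q', ⟨s₃⟩, ⟨r'⟩⟩ := s₂.exists_retract r _ hs₂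
        obtain ⟨l'', h''⟩ := ih hQ₂ r'
        exact ⟨l'' + 1, .ext hn hI hK s₃ h''⟩

end Sorted

/-! ### Homotopy equivalences and mapping cones -/

variable {K K' E E' M M' N N' P Q Q' : DGMod 𝒜}

theorem toHot_map_eq_iff {f g : M ⟶ N} :
    (toHot 𝒜).map f = (toHot 𝒜).map g ↔ Homotopic f g :=
  Quotient.functor_map_eq_iff _ f g

instance : (toHot 𝒜).Additive where
  map_add := rfl

/-- Two dg modules are homotopy equivalent if they are isomorphic in `dgHot`. -/
def HotEquiv (M N : DGMod 𝒜) : Prop := Nonempty ((toHot 𝒜).obj M ≅ (toHot 𝒜).obj N)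

namespace HotEquiv

theorem refl (M : DGMod 𝒜) : HotEquiv M M := ⟨Iso.refl _⟩

theorem symm : HotEquiv M N → HotEquiv N M := fun ⟨e⟩ => ⟨e.symm⟩

theorem trans : HotEquiv M N → HotEquiv N P → HotEquiv M P := fun ⟨e⟩ ⟨e'⟩ => ⟨e ≪≫ e'⟩

theorem of_iso (e : M ≅ N) : HotEquiv M N := ⟨(toHot 𝒜).mapIso e⟩

theorem of_homs (f : M ⟶ N) (g : N ⟶ M) (h₁ : Homotopic (f ≫ g) (𝟙 M))
    (h₂ : Homotopic (g ≫ f) (𝟙 N)) : HotEquiv M N :=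
  ⟨⟨(toHot 𝒜).map f, (toHot 𝒜).map g, toHot_map_eq_iff.2 h₁, toHot_map_eq_iff.2 h₂⟩⟩

theorem exists_homs : HotEquiv M N →
    ∃ (f : M ⟶ N) (g : N ⟶ M), Homotopic (f ≫ g) (𝟙 M) ∧ Homotopic (g ≫ f) (𝟙 N) := by
  rintro ⟨e⟩
  obtain ⟨f, hf⟩ := (toHot 𝒜).map_surjective e.hom
  obtain ⟨g, hg⟩ := (toHot 𝒜).map_surjective e.inv
  refine ⟨f, g, toHot_map_eq_iff.1 ?_, toHot_map_eq_iff.1 ?_⟩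
  · rw [Functor.map_comp, hf, hg, e.hom_inv_id, CategoryTheory.Functor.map_id]
  · rw [Functor.map_comp, hf, hg, e.inv_hom_id, CategoryTheory.Functor.map_id]

end HotEquiv

section HomComplex

/-- The differential `d h - (-1)^j h d` of a graded linear map `h` of degree `j`. -/
def homDiff {j : ℤ} (h : M.carrier →ₗ[𝒜.carrierᵐᵒᵖ] N.carrier)
    (hh : ∀ i, ∀ m ∈ M.gr i, h m ∈ N.gr (i + j)) :
    M.carrier →ₗ[𝒜.carrierᵐᵒᵖ] N.carrier where
  toFun m := N.d (h m) - j.negOnePow • h (M.d m)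
  map_add' x y := by simp only [map_add, smul_add]; abel
  map_smul' r x := by
    let φ : M.carrier →+ N.carrier :=
      N.d.comp h.toAddMonoidHom - j.negOnePow • h.toAddMonoidHom.comp M.d
    refine addHom_ext_of_isInternal M.isInternal
      (φ.comp (DistribSMul.toAddMonoidHom _ r)) ((DistribSMul.toAddMonoidHom _ r).comp φ)
      (fun i m hm => ?_) x
    have leib := M.leibniz r.unop hm
    have leib' := N.leibniz r.unop (hh i m hm)
    rw [MulOpposite.op_unop] at leib leib'
    change N.d (h (r • m)) - j.negOnePow • h (M.d (r • m)) =
      r • (N.d (h m) - j.negOnePow • h (M.d m))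
    rw [map_smul, leib', leib, map_add, map_smul, Units.smul_def i.negOnePow, map_zsmul, map_smul,
      Int.negOnePow_add, smul_add, smul_sub, ← Units.smul_def, smul_smul, mul_comm i.negOnePow,
      smul_comm r, add_sub_add_right_eq_sub]

theorem homDiff_neg_one {h : M.carrier →ₗ[𝒜.carrierᵐᵒᵖ] N.carrier}
    (hh : ∀ i, ∀ m ∈ M.gr i, h m ∈ N.gr (i + -1)) (m : M.carrier) :
    homDiff h hh m = N.d (h m) + h (M.d m) := by
  change N.d (h m) - (-1 : ℤ).negOnePow • h (M.d m) = _
  simp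

theorem Homotopic.sub_homDiff (f : M ⟶ N) {h : M.carrier →ₗ[𝒜.carrierᵐᵒᵖ] N.carrier}
    (hh : ∀ i, ∀ m ∈ M.gr i, h m ∈ N.gr (i + -1)) :
    ∃ g : M ⟶ N, Hom.toLin g = Hom.toLin f - homDiff h hh ∧ Homotopic f g := by
  refine ⟨⟨Hom.toLin f - homDiff h hh, fun {i m} hm => ?_, fun m => ?_⟩, rfl,
    h, hh, fun m => (sub_sub_cancel _ _).trans (homDiff_neg_one hh m)⟩
  · have h1 := N.d_mem (hh i m hm)
    have h2 := hh _ _ (M.d_mem hm)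
    rw [neg_add_cancel_right] at h1
    rw [add_neg_cancel_right] at h2
    rw [LinearMap.sub_apply, homDiff_neg_one]
    exact sub_mem (Hom.map_mem f hm) (add_mem h1 h2)
  · simp only [LinearMap.sub_apply, homDiff_neg_one, map_sub, map_add, N.d_d, M.d_d, map_zero,
      Hom.comm, add_zero, zero_add]

end HomComplex

section Shift

/-- The shift of a morphism. -/
def shiftMap (n : ℤ) (f : M ⟶ N) : M.shift n ⟶ N.shift n where
  toLin := (Hom.toLin f : M.carrier →ₗ[𝒜.carrierᵐᵒᵖ] N.carrier)
  map_mem h := Hom.map_mem f h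
  comm m := (map_zsmul (Hom.toLin f) (n.negOnePow : ℤ) (M.d m)).trans
    (congrArg (n.negOnePow • ·) (Hom.comm f m))

theorem Homotopic.shift (n : ℤ) {f g : M ⟶ N} (h : Homotopic f g) :
    Homotopic (shiftMap n f) (shiftMap n g) := by
  obtain ⟨h, h1, h2⟩ := h
  refine ⟨(n.negOnePow : ℤ) • h, fun i m hm => ?_, fun m => ?_⟩
  · have := h1 _ m hm
    rw [add_sub_right_comm] at this
    exact zsmul_mem this _
  · change Hom.toLin f m - Hom.toLin g m = n.negOnePow • N.d (n.negOnePow • h m) +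
      n.negOnePow • h (n.negOnePow • M.d m)
    simp only [Units.smul_def, map_zsmul, smul_smul, ← Units.val_mul, Int.units_mul_self,
      Units.val_one, one_smul]
    exact h2 m

theorem HotEquiv.shift (h : HotEquiv M N) (n : ℤ) : HotEquiv (M.shift n) (N.shift n) := by
  obtain ⟨f, g, h₁, h₂⟩ := h.exists_homs
  exact .of_homs (shiftMap n f) (shiftMap n g) (h₁.shift n) (h₂.shift n)

/-- The shift of a split extension. -/
def SplitExt.shift (s : SplitExt K E Q) (n : ℤ) :
    SplitExt (K.shift n) (E.shift n) (Q.shift n) where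
  i := shiftMap n s.i
  q := shiftMap n s.q
  ρ := (s.ρ : E.carrier →ₗ[𝒜.carrierᵐᵒᵖ] K.carrier)
  σ := (s.σ : Q.carrier →ₗ[𝒜.carrierᵐᵒᵖ] E.carrier)
  ρ_mem h := s.ρ_mem h
  σ_mem h := s.σ_mem h
  ρ_i := s.ρ_i
  q_σ := s.q_σ
  sum := s.sum

end Shift

namespace SplitExt

/-- `φ` is a morphism of extensions inducing `a` on the subs and `b` on the quotients. -/
structure IsMap (s : SplitExt K E Q) (s' : SplitExt K' E' Q') (a : K ⟶ K') (φ : E ⟶ E')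
    (b : Q ⟶ Q') : Prop where
  i_comp : s.i ≫ φ = a ≫ s'.i
  comp_q : φ ≫ s'.q = s.q ≫ b

namespace IsMap

variable {s : SplitExt K E Q} {s' : SplitExt K' E' Q'} {a a' : K ⟶ K'} {φ : E ⟶ E'} {b b' : Q ⟶ Q'}

theorem comp {K'' E'' Q'' : DGMod 𝒜} {s'' : SplitExt K'' E'' Q''} {a₁ : K' ⟶ K''} {φ₁ : E' ⟶ E''}
    {b₁ : Q' ⟶ Q''} (h : s.IsMap s' a φ b) (h₁ : s'.IsMap s'' a₁ φ₁ b₁) :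
    s.IsMap s'' (a ≫ a₁) (φ ≫ φ₁) (b ≫ b₁) where
  i_comp := by rw [← Category.assoc, h.i_comp, Category.assoc, h₁.i_comp, Category.assoc]
  comp_q := by rw [Category.assoc, h₁.comp_q, ← Category.assoc, h.comp_q, Category.assoc]

theorem isIso_of_id {φ : E ⟶ E} (h : s.IsMap s (𝟙 K) φ (𝟙 Q)) : IsIso φ := by
  have hq : (φ - 𝟙 E) ≫ s.q = 0 := by
    rw [Preadditive.sub_comp, h.comp_q, Category.comp_id, Category.id_comp, sub_self]
  have hi : s.i ≫ (φ - 𝟙 E) = 0 := by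
    rw [Preadditive.comp_sub, h.i_comp, Category.comp_id, Category.id_comp, sub_self]
  have hsq : (φ - 𝟙 E) ≫ (φ - 𝟙 E) = 0 := by
    nth_rw 1 [← s.lift_comp_i _ hq]
    rw [Category.assoc, hi, comp_zero]
  let ν : End E := φ - 𝟙 E
  have hν : IsNilpotent ν := ⟨2, (pow_two ν).trans hsq⟩
  have hφ : 1 + ν = φ := add_sub_cancel (𝟙 E) φ
  rw [← isUnit_iff_isIso, ← hφ]
  exact hν.isUnit_one_add

/- Subtract from `φ` the differential of the graded map assembled from the two homotopies. -/
theorem exists_homotopic (h : s.IsMap s' a φ b) (ha : Homotopic a a') (hb : Homotopic b b') :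
    ∃ φ', s.IsMap s' a' φ' b' ∧ Homotopic φ φ' := by
  obtain ⟨u, hu, hau⟩ := ha
  obtain ⟨v, hv, hbv⟩ := hb
  let H : E.carrier →ₗ[𝒜.carrierᵐᵒᵖ] E'.carrier :=
    (Hom.toLin s'.i).comp (u.comp s.ρ) + s'.σ.comp (v.comp (Hom.toLin s.q))
  have hH : ∀ i, ∀ m ∈ E.gr i, H m ∈ E'.gr (i + -1) := fun i m hm =>
    add_mem (Hom.map_mem s'.i (hu i _ (s.ρ_mem hm)))
      (s'.σ_mem (hv i _ (Hom.map_mem s.q hm)))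
  have H_i (x) : H (Hom.toLin s.i x) = Hom.toLin s'.i (u x) := by
    simp [H, s.ρ_i, s.q_i]
  have q_H (x) : Hom.toLin s'.q (H x) = v (Hom.toLin s.q x) := by
    simp [H, s'.q_i, s'.q_σ]
  obtain ⟨φ', hφ', hφφ'⟩ := Homotopic.sub_homDiff φ hH
  have φ'_apply (x) : Hom.toLin φ' x = Hom.toLin φ x - (E'.d (H x) + H (E.d x)) := by
    rw [hφ', LinearMap.sub_apply, homDiff_neg_one]
  refine ⟨φ', ⟨hom_ext' fun x => ?_, hom_ext' fun x => ?_⟩, hφφ'⟩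
  · have hφi := toLin_congr h.i_comp x
    have hu := hau x
    simp only [toLin_comp_apply] at hφi ⊢
    rw [φ'_apply, hφi, ← Hom.comm, H_i, H_i, ← Hom.comm, ← map_add, ← hu, map_sub, sub_sub_cancel]
  · have hqφ := toLin_congr h.comp_q x
    have hv := hbv (Hom.toLin s.q x)
    simp only [toLin_comp_apply] at hqφ ⊢
    rw [φ'_apply, map_sub, hqφ, map_add, Hom.comm, q_H, q_H, Hom.comm, ← hv, sub_sub_cancel]

theorem hotEquiv {ψ : E' ⟶ E} {a' : K' ⟶ K} {b' : Q' ⟶ Q} (h : s.IsMap s' a φ b)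
    (h' : s'.IsMap s a' ψ b') (ha : Homotopic (a ≫ a') (𝟙 K)) (ha' : Homotopic (a' ≫ a) (𝟙 K'))
    (hb : Homotopic (b ≫ b') (𝟙 Q)) (hb' : Homotopic (b' ≫ b) (𝟙 Q')) : HotEquiv E E' := by
  obtain ⟨χ, hχ, hφψ⟩ := (h.comp h').exists_homotopic ha hb
  obtain ⟨χ', hχ', hψφ⟩ := (h'.comp h).exists_homotopic ha' hb'
  have := hχ.isIso_of_id
  have := hχ'.isIso_of_id
  let F := (toHot 𝒜).map φ
  let G := (toHot 𝒜).map ψ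
  have hFG : F ≫ G = (toHot 𝒜).map χ :=
    (Functor.map_comp _ _ _).symm.trans (toHot_map_eq_iff.2 hφψ)
  have hGF : G ≫ F = (toHot 𝒜).map χ' :=
    (Functor.map_comp _ _ _).symm.trans (toHot_map_eq_iff.2 hψφ)
  have : IsIso (F ≫ G) := hFG ▸ inferInstance
  have : IsIso (G ≫ F) := hGF ▸ inferInstance
  have : Mono F := mono_of_mono F G
  have : IsSplitEpi F := .mk' ⟨inv (G ≫ F) ≫ G, by rw [Category.assoc, IsIso.inv_hom_id]⟩
  have := isIso_of_mono_of_isSplitEpi F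
  exact ⟨asIso F⟩

end IsMap

end SplitExt

/-! ### Mapping cones -/

section Cone

variable {M M' N N' : DGMod 𝒜} (f : M ⟶ N)

/-- The inclusion of the target into the cone, as a graded linear map. -/
def coneInl : N.carrier →ₗ[𝒜.carrierᵐᵒᵖ] (cone f).carrier := LinearMap.inl _ N.carrier M.carrier

/-- The inclusion of the source into the cone, as a graded linear map of degree `-1`. -/
def coneInr : M.carrier →ₗ[𝒜.carrierᵐᵒᵖ] (cone f).carrier := LinearMap.inr _ N.carrier M.carrier

/-- The projection of the cone onto the target, as a graded linear map. -/
def coneFst : (cone f).carrier →ₗ[𝒜.carrierᵐᵒᵖ] N.carrier := LinearMap.fst _ N.carrier M.carrier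

/-- The projection of the cone onto the source, as a graded linear map of degree `1`. -/
def coneSnd : (cone f).carrier →ₗ[𝒜.carrierᵐᵒᵖ] M.carrier := LinearMap.snd _ N.carrier M.carrier

@[simp] theorem coneFst_inl (x) : coneFst f (coneInl f x) = x := rfl
@[simp] theorem coneSnd_inl (x) : coneSnd f (coneInl f x) = 0 := rfl
@[simp] theorem coneFst_inr (x) : coneFst f (coneInr f x) = 0 := rfl
@[simp] theorem coneSnd_inr (x) : coneSnd f (coneInr f x) = x := rfl

@[simp] theorem coneFst_d (x) :
    coneFst f ((cone f).d x) = N.d (coneFst f x) + Hom.toLin f (coneSnd f x) := rfl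

@[simp] theorem coneSnd_d (x) : coneSnd f ((cone f).d x) = -M.d (coneSnd f x) := rfl

variable {f}

theorem cone_ext {x y : (cone f).carrier} (h₁ : coneFst f x = coneFst f y)
    (h₂ : coneSnd f x = coneSnd f y) : x = y := Prod.ext h₁ h₂

theorem coneInl_d (y : N.carrier) : coneInl f (N.d y) = (cone f).d (coneInl f y) :=
  cone_ext (by simp) (by simp)

variable (f)

theorem cone_sum (x : (cone f).carrier) :
    coneInl f (coneFst f x) + coneInr f (coneSnd f x) = x :=
  cone_ext (by simp) (by simp)

/-- The cone of `f : M ⟶ N` as an extension of `M.shift 1` by `N`. -/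
def coneExt : SplitExt N (cone f) (M.shift 1) where
  i := { toLin := coneInl f
         map_mem := fun h => ⟨h, zero_mem _⟩
         comm := coneInl_d }
  q := { toLin := coneSnd f
         map_mem := fun h => h.2
         comm := fun m => by
          change coneSnd f ((cone f).d m) = (1 : ℤ).negOnePow • M.d (coneSnd f m)
          rw [coneSnd_d, Int.negOnePow_one, Units.neg_smul, one_smul] }
  ρ := coneFst f
  σ := coneInr f
  ρ_mem h := h.1
  σ_mem h := ⟨zero_mem _, h⟩
  ρ_i _ := rfl
  q_σ _ := rfl
  sum := cone_sum f

/-- The cone of `f : Q.shift (-1) ⟶ K` as an extension of `Q` by `K`. -/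
def coneExt' {K Q : DGMod 𝒜} (f : Q.shift (-1) ⟶ K) : SplitExt K (cone f) Q where
  i := (coneExt f).i
  q := { toLin := coneSnd f
         map_mem := fun {i m} h => by
          have : coneSnd f m ∈ Q.gr (i + 1 + -1) := h.2
          rwa [add_neg_cancel_right] at this
         comm := fun m => by
          change -((-1 : ℤ).negOnePow • Q.d (coneSnd f m)) = Q.d (coneSnd f m)
          simp }
  ρ := coneFst f
  σ := coneInr f
  ρ_mem h := h.1
  σ_mem {i x} h := ⟨zero_mem _, by
    change x ∈ Q.gr (i + 1 + -1)
    rwa [add_neg_cancel_right]⟩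
  ρ_i _ := rfl
  q_σ _ := rfl
  sum := cone_sum f

theorem contractible_cone [IsIso f] : Homotopic (𝟙 (cone f)) 0 := by
  let g := inv f
  have fg (x) : Hom.toLin f (Hom.toLin g x) = x := inv_hom_apply (asIso f) x
  have gf (x) : Hom.toLin g (Hom.toLin f x) = x := hom_inv_apply (asIso f) x
  refine ⟨(coneInr f).comp ((Hom.toLin g).comp (coneFst f)),
    fun i m hm => ⟨zero_mem _, ?_⟩, fun m => cone_ext ?_ ?_⟩
  · rw [sub_add_cancel]
    exact Hom.map_mem g hm.1
  · simp [fg]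
  · simp [gf, Hom.comm g]

theorem exists_coneMap {f' : M' ⟶ N'} {a : N ⟶ N'} {b : M ⟶ M'}
    (h : Homotopic (f ≫ a) (b ≫ f')) :
    ∃ φ, (coneExt f).IsMap (coneExt f') a φ (shiftMap 1 b) := by
  obtain ⟨u, hu, hfa⟩ := h
  refine ⟨{
    toLin := (coneInl f').comp ((Hom.toLin a).comp (coneFst f) + u.comp (coneSnd f)) +
      (coneInr f').comp ((Hom.toLin b).comp (coneSnd f))
    map_mem := fun {i x} hx => ?_
    comm := fun x => cone_ext ?_ ?_ }, ⟨hom_ext' fun x => cone_ext ?_ ?_, hom_ext' fun x => ?_⟩⟩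
  · have hux := hu _ _ hx.2
    rw [add_sub_cancel_right] at hux
    exact add_mem (s := (cone f').gr i) ⟨add_mem (Hom.map_mem a hx.1) hux, zero_mem _⟩
      ⟨zero_mem _, Hom.map_mem b hx.2⟩
  · have := hfa (coneSnd f x)
    rw [sub_eq_iff_eq_add] at this
    simp only [toLin_comp, LinearMap.comp_apply] at this
    simp [this, Hom.comm a]
    abel
  · simp [Hom.comm b]
  · change Hom.toLin a x + u 0 + 0 = Hom.toLin a x
    rw [map_zero, add_zero, add_zero]
  · change 0 + Hom.toLin b 0 = 0
    rw [map_zero, add_zero]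
  · exact zero_add _

theorem HotEquiv.exists_cone (hM : HotEquiv M M') (hN : HotEquiv N N') :
    ∃ f' : M' ⟶ N', HotEquiv (cone f) (cone f') := by
  obtain ⟨u, u', hu, hu'⟩ := hM.exists_homs
  obtain ⟨v, v', hv, hv'⟩ := hN.exists_homs
  let f' := u' ≫ f ≫ v
  have hf : Homotopic (f ≫ v) (u ≫ f') := by
    have := toHot_map_eq_iff.2 hu
    rw [Functor.map_comp, CategoryTheory.Functor.map_id] at this
    rw [← toHot_map_eq_iff]
    simp only [f', Functor.map_comp, reassoc_of% this]
  have hf' : Homotopic (f' ≫ v') (u' ≫ f) := by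
    have := toHot_map_eq_iff.2 hv
    rw [Functor.map_comp, CategoryTheory.Functor.map_id] at this
    rw [← toHot_map_eq_iff]
    simp only [f', Functor.map_comp, Category.assoc, this, Category.comp_id]
  obtain ⟨φ, hφ⟩ := exists_coneMap f hf
  obtain ⟨ψ, hψ⟩ := exists_coneMap f' hf'
  exact ⟨f', hφ.hotEquiv hψ hv hv' (hu.shift 1) (hu'.shift 1)⟩

end Cone

namespace SplitExt

variable {K K₁ E Q Q' M : DGMod 𝒜} (s : SplitExt K E Q)

/-- The linear map of degree one underlying the connecting morphism of an extension, that is, the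
component in the sub of the differential of the graded section. -/
def connectingLin : Q.carrier →ₗ[𝒜.carrierᵐᵒᵖ] K.carrier :=
  s.ρ.comp (homDiff (j := 0) s.σ fun _ _ hm => by simpa only [add_zero] using s.σ_mem hm)

theorem connectingLin_apply (x : Q.carrier) : s.connectingLin x = s.ρ (E.d (s.σ x)) := by
  change s.ρ (E.d (s.σ x) - (0 : ℤ).negOnePow • s.σ (Q.d x)) = _
  rw [Int.negOnePow_zero, one_smul, map_sub, s.ρ_σ, sub_zero]

theorem d_σ (x : Q.carrier) :
    E.d (s.σ x) = Hom.toLin s.i (s.connectingLin x) + s.σ (Q.d x) := by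
  rw [connectingLin_apply, s.i_ρ, Hom.comm, s.q_σ, sub_add_cancel]

theorem ρ_d (x : E.carrier) :
    s.ρ (E.d x) = K.d (s.ρ x) + s.connectingLin (Hom.toLin s.q x) := by
  conv_lhs => rw [← s.sum x, map_add, map_add, ← Hom.comm, s.ρ_i, ← connectingLin_apply]

theorem connectingLin_d (x : Q.carrier) :
    s.connectingLin (Q.d x) = -K.d (s.connectingLin x) := by
  have h := s.ρ_d (E.d (s.σ x))
  rw [E.d_d, map_zero, Hom.comm, s.q_σ, ← connectingLin_apply] at h
  exact (neg_eq_of_add_eq_zero_right h.symm).symm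

/-- The connecting morphism of an extension, whose cone is the extension. -/
def connecting : Q.shift (-1) ⟶ K where
  toLin := s.connectingLin
  map_mem {i x} hx := by
    have := s.ρ_mem (E.d_mem (s.σ_mem hx))
    rw [neg_add_cancel_right] at this
    exact (s.connectingLin_apply x).symm ▸ this
  comm x := by
    change s.connectingLin ((-1 : ℤ).negOnePow • Q.d x) = K.d (s.connectingLin x)
    rw [Int.negOnePow_neg, Int.negOnePow_one, Units.neg_smul, one_smul, map_neg]
    exact neg_eq_iff_eq_neg.2 (s.connectingLin_d x)

theorem connectingLin_coneExt' (f : Q.shift (-1) ⟶ K) (x : Q.carrier) :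
    (coneExt' f).connectingLin x = Hom.toLin f x := by
  rw [connectingLin_apply]
  exact (congrArg (· + Hom.toLin f x) (map_zero K.d)).trans (zero_add _)

/-- An extension is isomorphic to the cone of its connecting morphism. -/
def isoCone : E ≅ cone s.connecting :=
  let c := coneExt' s.connecting
  isoOfBijective
    { toLin := (Hom.toLin c.i).comp s.ρ + c.σ.comp (Hom.toLin s.q)
      map_mem := fun h =>
        add_mem (Hom.map_mem c.i (s.ρ_mem h)) (c.σ_mem (Hom.map_mem s.q h))
      comm := fun x => by
        have hc := c.d_σ (Hom.toLin s.q x)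
        rw [connectingLin_coneExt'] at hc
        simp only [LinearMap.add_apply, LinearMap.comp_apply, map_add, s.ρ_d, Hom.comm s.q, hc,
          ← Hom.comm c.i]
        rw [add_assoc]
        rfl }
    (Function.bijective_iff_has_inverse.2
      ⟨(Hom.toLin s.i).comp c.ρ + s.σ.comp (Hom.toLin c.q), fun x => by
        simp [c.ρ_i, c.ρ_σ, c.q_i, c.q_σ, s.sum], fun x => by
        simp [s.ρ_i, s.ρ_σ, s.q_i, s.q_σ, c.sum]⟩)

theorem replace_right (s : SplitExt K E Q) (h : HotEquiv Q Q') :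
    ∃ E', HotEquiv E E' ∧ Nonempty (SplitExt K E' Q') := by
  obtain ⟨f, hf⟩ := HotEquiv.exists_cone s.connecting (h.shift (-1)) (.refl K)
  exact ⟨_, (HotEquiv.of_iso s.isoCone).trans hf, ⟨coneExt' f⟩⟩

theorem hotEquiv_of_contractible (s : SplitExt K E Q) (hK : Homotopic (𝟙 K) 0) : HotEquiv E Q := by
  let Z := (Sub.range (𝟙 K)).quotient
  have hZ : Subsingleton Z.carrier := Sub.subsingleton_quotient_range K
  have hKZ : HotEquiv K Z := .of_homs 0 0
    (by rw [zero_comp]; exact Congruence.equivalence.symm hK)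
    (toHot_map_eq_iff.1 (congrArg _ (hom_ext' fun x => Subsingleton.elim (α := Z.carrier) _ _)))
  obtain ⟨f, hf⟩ := HotEquiv.exists_cone s.connecting (.refl _) hKZ
  exact (HotEquiv.of_iso s.isoCone).trans
    (hf.trans (.of_iso ((coneExt' f).isoOfSubsingleton hZ)))

theorem d_σ_i (s : SplitExt K E M) (s₁ : SplitExt K₁ M Q) (x : K₁.carrier) :
    E.d (s.σ (Hom.toLin s₁.i x)) =
      Hom.toLin s.i (s.connectingLin (Hom.toLin s₁.i x)) + s.σ (Hom.toLin s₁.i (K₁.d x)) := by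
  rw [s.d_σ, Hom.comm]

/-- The preimage in `E` of the sub `K₁` of `M`, as the cone of the restricted connecting
morphism. -/
def assoc (s : SplitExt K E M) (s₁ : SplitExt K₁ M Q) :
    SplitExt (cone (shiftMap (-1) s₁.i ≫ s.connecting)) E Q :=
  let c := coneExt' (shiftMap (-1) s₁.i ≫ s.connecting)
  have hc (x) : c.connectingLin x = s.connectingLin (Hom.toLin s₁.i x) :=
    connectingLin_coneExt' _ x
  { i :=
      { toLin := (Hom.toLin s.i).comp c.ρ + s.σ.comp ((Hom.toLin s₁.i).comp (Hom.toLin c.q))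
        map_mem := fun h => add_mem (Hom.map_mem s.i (c.ρ_mem h))
          (s.σ_mem (Hom.map_mem s₁.i (Hom.map_mem c.q h)))
        comm := fun x => by
          simp only [LinearMap.add_apply, LinearMap.comp_apply, map_add, s.d_σ_i, c.ρ_d, hc,
            Hom.comm, add_assoc] }
    q := s.q ≫ s₁.q
    ρ := (Hom.toLin c.i).comp s.ρ + c.σ.comp (s₁.ρ.comp (Hom.toLin s.q))
    σ := s.σ.comp s₁.σ
    ρ_mem := fun h => add_mem (Hom.map_mem c.i (s.ρ_mem h))
      (c.σ_mem (s₁.ρ_mem (Hom.map_mem s.q h)))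
    σ_mem := fun h => s.σ_mem (s₁.σ_mem h)
    ρ_i := fun x => by
      simp only [LinearMap.add_apply, LinearMap.comp_apply, map_add, s.ρ_i, s.ρ_σ, s.q_i, s.q_σ,
        map_zero, add_zero, zero_add, s₁.ρ_i, c.sum]
    q_σ := fun x => by
      simp only [LinearMap.comp_apply, toLin_comp_apply, s.q_σ, s₁.q_σ]
    sum := fun x => by
      simp only [LinearMap.add_apply, LinearMap.comp_apply, toLin_comp_apply, map_add, c.ρ_i,
        c.ρ_σ, c.q_i, c.q_σ, map_zero, add_zero, zero_add, add_assoc]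
      rw [← map_add s.σ, s₁.sum, s.sum] }

end SplitExt

/-! ### Cones of sorted modules -/

namespace SplitExt

variable {K K₁ E M Q : DGMod 𝒜}

/-- The lift to `E` of the sub `K₁` of `M` when the connecting morphism vanishes on it. -/
def liftSub (s : SplitExt K E M) (s₁ : SplitExt K₁ M Q)
    (h : shiftMap (-1) s₁.i ≫ s.connecting = 0) : K₁ ⟶ E where
  toLin := s.σ.comp (Hom.toLin s₁.i)
  map_mem h := s.σ_mem (Hom.map_mem s₁.i h)
  comm x := by
    have h0 : s.connectingLin (Hom.toLin s₁.i x) = 0 := toLin_congr h x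
    rw [LinearMap.comp_apply, LinearMap.comp_apply, s.d_σ_i, h0, map_zero, zero_add]

theorem liftSub_comp_q (s : SplitExt K E M) (s₁ : SplitExt K₁ M Q)
    (h : shiftMap (-1) s₁.i ≫ s.connecting = 0) : s.liftSub s₁ h ≫ s.q = s₁.i :=
  hom_ext' fun _ => s.q_σ _

end SplitExt

theorem SimpleFreeOn.isIso_or_eq_zero_of_le (hpos : 𝒜.IsNonneg) {m n : ℤ} {K K' : DGMod 𝒜}
    (hK : SimpleFreeOn n K) (hK' : SimpleFreeOn m K') (hnm : n ≤ m) (f : K ⟶ K') :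
    IsIso f ∨ f = 0 := by
  obtain rfl | h := hnm.eq_or_lt
  · exact hK.isIso_or_eq_zero hK' f
  · exact .inr (hK.gen.hom_eq_zero (hK'.gen.gr_eq_bot hpos h) f)

namespace Sorted

variable {I : Set ℤ} {n m : ℤ} {l l' : ℕ} {K M N E Q : DGMod 𝒜}

protected theorem shift (h : Sorted Set.univ n l M) (j : ℤ) :
    Sorted Set.univ (n - j) l (M.shift j) := by
  induction h with
  | zero h => exact .zero h
  | ext hn _ hK s _ ih =>
    exact .ext (sub_le_sub_right hn j) trivial (hK.shift _ j (sub_add_cancel _ _)) (s.shift j) ih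

/- If the lowest layer `K₁` of `M` sits in a smaller degree than `K`, the connecting morphism is
zero or invertible on it: then `K₁` can be moved below `K`, or cancels against it. -/
theorem exists_hotEquiv_of_simpleFreeOn (hpos : 𝒜.IsNonneg) (hI : n ∈ I) (hK : SimpleFreeOn n K)
    (s : SplitExt K E M) (hM : Sorted I m l M) :
    ∃ l' G, Sorted I (min n m) l' G ∧ HotEquiv E G := by
  induction hM generalizing E with
  | zero h => exact ⟨_, E, .ext (min_le_left _ _) hI hK s (.zero h), .refl E⟩
  | @ext m n' l K₁ M Q hn hI' hK₁ s₁ hQ ih =>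
    rcases le_or_gt n n' with h | h
    · exact ⟨_, E, .ext (min_le_left _ _) hI hK s (.ext h hI' hK₁ s₁ hQ), .refl E⟩
    rcases (hK₁.shift (n' + 1) (-1) (by ring)).isIso_or_eq_zero_of_le hpos hK h
      (shiftMap (-1) s₁.i ≫ s.connecting) with h' | h'
    · exact ⟨l, Q, hQ.mono ((min_le_right _ _).trans hn),
        (s.assoc s₁).hotEquiv_of_contractible (contractible_cone _)⟩
    · obtain ⟨Q', s₂, -, ⟨s₃⟩⟩ := s.exists_swap s₁ _ (s.liftSub_comp_q s₁ h')
      obtain ⟨l', G, hG, hQG⟩ := ih s₃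
      obtain ⟨E', hE, ⟨s₄⟩⟩ := s₂.replace_right hQG
      rw [min_eq_right h.le] at hG
      exact ⟨_, E', .ext ((min_le_right _ _).trans hn) hI' hK₁ s₄ hG, hE⟩

theorem exists_hotEquiv_of_splitExt (hpos : 𝒜.IsNonneg) (s : SplitExt N E Q)
    (hN : Sorted I n l N) (hQ : Sorted I m l' Q) :
    ∃ j l'' G, Sorted I j l'' G ∧ HotEquiv E G := by
  induction hN generalizing E with
  | zero h => exact ⟨m, l', Q, hQ, .of_iso (s.isoOfSubsingleton h)⟩
  | ext _ hI hK s₁ _ ih =>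
    obtain ⟨E₁, ⟨s₂⟩, ⟨s₃⟩⟩ := s.exists_quotient s₁
    obtain ⟨j, l'', G, hG, hE₁⟩ := ih s₃
    obtain ⟨E', hE, ⟨s₄⟩⟩ := s₂.replace_right hE₁
    obtain ⟨l₃, G', hG', hE'⟩ := exists_hotEquiv_of_simpleFreeOn hpos hI hK s₄ hG
    exact ⟨_, l₃, G', hG', hE.trans hE'⟩

theorem of_splitExt (hpos : 𝒜.IsNonneg) (s : SplitExt N E Q) (hN : Sorted {n} n l N)
    (hQ : Sorted {n} n l' Q) : ∃ l'', Sorted {n} n l'' E := by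
  induction l generalizing N E with
  | zero =>
    cases hN with
    | zero h => exact hQ.retract hpos (s.isoOfSubsingleton h).retract
  | succ l ih =>
    cases hN with
    | @ext _ n' _ K _ N₁ hn hI hK s₁ hN =>
      obtain rfl : n' = n := hI
      obtain ⟨E₁, ⟨s₂⟩, ⟨s₃⟩⟩ := s.exists_quotient s₁
      obtain ⟨l'', h⟩ := ih s₃ hN
      exact ⟨_, .ext le_rfl rfl hK s₂ h⟩

end Sorted

/-- `M` is homotopy equivalent to a sorted module. -/
def IsHotSorted (M : DGMod 𝒜) : Prop :=
  ∃ (n : ℤ) (l : ℕ) (G : DGMod 𝒜), Sorted Set.univ n l G ∧ HotEquiv M G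

theorem IsHotSorted.cone (hpos : 𝒜.IsNonneg) {M N : DGMod 𝒜} (f : M ⟶ N)
    (hM : IsHotSorted M) (hN : IsHotSorted N) : IsHotSorted (cone f) := by
  obtain ⟨n, l, G, hG, hMG⟩ := hM
  obtain ⟨n', l', G', hG', hNG'⟩ := hN
  obtain ⟨f', hf⟩ := HotEquiv.exists_cone f hMG hNG'
  obtain ⟨j, l'', G'', hG'', hf'⟩ :=
    Sorted.exists_hotEquiv_of_splitExt hpos (coneExt f') hG' (hG.shift 1)
  exact ⟨j, l'', G'', hG'', hf.trans hf'⟩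

/-! ### Minimality of sorted modules -/

section Plus

variable {M N : DGMod 𝒜} {n i : ℤ}

theorem map_mem_plus (f : M.carrier →ₗ[𝒜.carrierᵐᵒᵖ] N.carrier)
    (hf : ∀ i, ∃ j, ∀ m ∈ M.gr i, f m ∈ N.gr j) {x : M.carrier}
    (hx : x ∈ M.plus.toSubmodule) : f x ∈ N.plus.toSubmodule := by
  suffices M.plus.toSubmodule ≤ N.plus.toSubmodule.comap f from this hx
  refine Submodule.span_le.2 ?_
  rintro _ ⟨i, i', m, a, hm, ha, hi', rfl⟩
  obtain ⟨j, hj⟩ := hf i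
  exact Submodule.subset_span ⟨j, i', f m, a, hj m hm, ha, hi', map_smul _ _ _⟩

theorem GeneratedIn.mem_plus (hM : M.GeneratedIn n) (hi : n < i) {x : M.carrier}
    (hx : x ∈ M.gr i) : x ∈ M.plus.toSubmodule := by
  suffices M.gr i ≤ M.plus.toSubmodule.toAddSubgroup from this hx
  refine (hM.gr_le i).trans ((AddSubgroup.closure_le _).2 ?_)
  rintro _ ⟨m, hm, a, ha, rfl⟩
  exact Submodule.subset_span ⟨n, i - n, m, a, hm, ha, sub_pos.2 hi, rfl⟩

theorem map_eq_zero_of_mem_plus (hpos : 𝒜.IsNonneg) (f : M ⟶ N)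
    (hf : ∀ j < i, ∀ m ∈ M.gr j, Hom.toLin f m = 0) {x : M.carrier} (hx : x ∈ M.gr i)
    (hx' : x ∈ M.plus.toSubmodule) : Hom.toLin f x = 0 := by
  rw [← gradeProj_same N.isInternal (Hom.map_mem f hx)]
  clear hx
  induction hx' using Submodule.closure_induction with
  | zero => rw [map_zero, map_zero]
  | add x y _ _ hx hy => rw [map_add, map_add, hx, hy, add_zero]
  | smul_mem r x hx =>
    obtain ⟨p, q, m, a, hm, ha, hq, rfl⟩ := hx
    rw [map_smul (Hom.toLin f) r]
    rcases lt_or_ge p i with h | h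
    · rw [map_smul (Hom.toLin f), hf p h m hm, smul_zero, smul_zero, map_zero]
    · have hr : gradeProj 𝒜.addGr 𝒜.isInternal (i - (p + q)) r.unop = 0 := by
        have := gradeProj_mem 𝒜.isInternal (i - (p + q)) r.unop
        rwa [DGAlgebra.addGr, hpos _ (by omega)] at this
      rw [← MulOpposite.op_unop r,
        gradeProj_smul N (Hom.map_mem f (M.smul_mem hm ha)), hr, MulOpposite.op_zero, zero_smul]

end Plus

theorem Sorted.d_mem_plus (hpos : 𝒜.IsNonneg) {I : Set ℤ} {n : ℤ} {l : ℕ} {M : DGMod 𝒜}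
    (h : Sorted I n l M) (m : M.carrier) : M.d m ∈ M.plus.toSubmodule := by
  induction h with
  | zero h => rw [Subsingleton.elim (DGMod.d _ m) 0]; exact zero_mem _
  | @ext n n' l K E Q _ hI hK s hQ ih =>
    refine mem_of_gradeProj_mem E.isInternal (E.plus.toSubmodule.toAddSubgroup.comap E.d) m
      fun i => ?_
    have hx := gradeProj_mem E.isInternal i m
    generalize gradeProj E.gr E.isInternal i m = x at hx
    change E.d x ∈ E.plus.toSubmodule
    rcases lt_or_ge i n' with h | h
    · rw [(Sorted.ext le_rfl hI hK s hQ).gr_eq_bot hpos h, AddSubgroup.mem_bot] at hx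
      rw [hx, map_zero]
      exact zero_mem _
    · rw [← s.sum (E.d x), Hom.comm s.q]
      have hρ : s.ρ (E.d x) ∈ K.plus.toSubmodule :=
        hK.gen.mem_plus (by omega) (s.ρ_mem (E.d_mem hx))
      exact add_mem (map_mem_plus _ (fun i => ⟨i, fun _ => Hom.map_mem s.i⟩) hρ)
        (map_mem_plus _ (fun i => ⟨i, fun _ => s.σ_mem⟩) (ih _))

/-! ### Lifting homotopy idempotents -/

namespace Sorted

variable {I : Set ℤ} {n : ℤ} {l : ℕ} {M : DGMod 𝒜}

theorem exists_generators_le (h : Sorted I n l M) :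
    ∃ b, ∀ S : Submodule 𝒜.carrierᵐᵒᵖ M.carrier, (∀ i ≤ b, ∀ m ∈ M.gr i, m ∈ S) → S = ⊤ := by
  induction h with
  | zero h => exact ⟨0, fun S _ => Subsingleton.elim _ _⟩
  | @ext _ n' _ K E Q _ _ hK s _ ih =>
    obtain ⟨b, hb⟩ := ih
    refine ⟨max n' b, fun S hS => Submodule.eq_top_iff'.2 fun x => ?_⟩
    have hi : Submodule.span _ (K.gr n' : Set K.carrier) ≤ S.comap (Hom.toLin s.i) :=
      Submodule.span_le.2 fun m hm => hS n' (le_max_left _ _) _ (Hom.map_mem s.i hm)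
    have hσ : S.comap s.σ = ⊤ :=
      hb _ fun i hib m hm => hS i (hib.trans (le_max_right _ _)) _ (s.σ_mem hm)
    rw [← s.sum x]
    exact add_mem (hi (hK.gen.mem_span _)) (Submodule.eq_top_iff'.1 hσ _)

/- Each application of `f` moves an element into a layer generated in strictly lower degrees. -/
theorem isNilpotent (hpos : 𝒜.IsNonneg) (hM : Sorted I n l M) (f : End M)
    (hf : ∀ m, Hom.toLin f m ∈ M.plus.toSubmodule) : IsNilpotent f := by
  have hzero (c : ℕ) : ∀ i < n + c, ∀ m ∈ M.gr i, Hom.toLin (f ^ c) m = 0 := by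
    induction c with
    | zero =>
      intro i hi m hm
      rw [hM.gr_eq_bot hpos (by simpa using hi), AddSubgroup.mem_bot] at hm
      rw [hm, map_zero]
    | succ c ih =>
      intro i hi m hm
      rw [pow_succ]
      exact map_eq_zero_of_mem_plus hpos (f ^ c) (fun j hj => ih j (by push_cast at hi; omega))
        (Hom.map_mem f hm) (hf m)
  obtain ⟨b, hb⟩ := hM.exists_generators_le
  refine ⟨(b + 1 - n).toNat, hom_ext (LinearMap.ker_eq_top.1 (hb _ fun i hi m hm => ?_))⟩
  exact hzero _ i (by omega) m hm

theorem isNilpotent_of_homotopic_zero (hpos : 𝒜.IsNonneg) (hM : Sorted I n l M) (f : End M)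
    (hf : Homotopic f 0) : IsNilpotent f := by
  obtain ⟨h, h1, h2⟩ := hf
  refine hM.isNilpotent hpos f fun m => ?_
  have hfm : Hom.toLin f m = M.d (h m) + h (M.d m) := (sub_zero _).symm.trans (h2 m)
  rw [hfm]
  exact add_mem (hM.d_mem_plus hpos _)
    (map_mem_plus h (fun i => ⟨i - 1, h1 i⟩) (hM.d_mem_plus hpos m))

theorem exists_idempotent (hpos : 𝒜.IsNonneg) (hM : Sorted I n l M)
    (p : End ((toHot 𝒜).obj M)) (hp : p ≫ p = p) :
    ∃ e : M ⟶ M, e ≫ e = e ∧ (toHot 𝒜).map e = p := by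
  let φ : End M →+* End ((toHot 𝒜).obj M) :=
    { (toHot 𝒜).mapEnd M with
      map_zero' := (toHot 𝒜).map_zero M M
      map_add' := fun _ _ => (toHot 𝒜).map_add }
  obtain ⟨g, hg⟩ := (toHot 𝒜).map_surjective p
  refine exists_isIdempotentElem_eq_of_ker_isNilpotent φ (fun f hf => ?_) p ⟨g, hg⟩ hp
  exact hM.isNilpotent_of_homotopic_zero hpos f
    (toHot_map_eq_iff.1 (hf.trans ((toHot 𝒜).map_zero M M).symm))

end Sorted

/-- An idempotent splits through its image. -/
def retractOfIdempotent {M : DGMod 𝒜} (e : M ⟶ M) (he : e ≫ e = e) :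
    Retract (Sub.range e).toDGMod M where
  i := (Sub.range e).incl
  r :=
    { toLin := (Hom.toLin e).rangeRestrict
      map_mem := fun h => Hom.map_mem e h
      comm := fun m => Subtype.ext (Hom.comm e m) }
  retract := hom_ext' fun ⟨_, x, hx⟩ => Subtype.ext (by subst hx; exact toLin_congr he x)

/- Endomorphisms of `M` that vanish in `dgHot` are nilpotent, so the idempotent of `dgHot` cutting
out `X` lifts to an idempotent of `dgMod`. -/
theorem Sorted.exists_iso_of_retract (hpos : 𝒜.IsNonneg) {I : Set ℤ} {n : ℤ} {l : ℕ}
    {M : DGMod 𝒜} (hM : Sorted I n l M) {X : DGHot 𝒜} (r : Retract X ((toHot 𝒜).obj M)) :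
    ∃ l' M', Sorted I n l' M' ∧ Nonempty (X ≅ (toHot 𝒜).obj M') := by
  obtain ⟨e, he, her⟩ := hM.exists_idempotent hpos (r.r ≫ r.i) (by simp)
  let r' := (retractOfIdempotent e he).map (toHot 𝒜)
  have hr' : r'.r ≫ r'.i = r.r ≫ r.i := her
  obtain ⟨l', h⟩ := hM.retract hpos (retractOfIdempotent e he)
  refine ⟨l', _, h, ⟨⟨r.i ≫ r'.r, r'.i ≫ r.r, ?_, ?_⟩⟩⟩
  · rw [Category.assoc, reassoc_of% hr', r.retract, Category.comp_id, r.retract]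
  · rw [Category.assoc, ← reassoc_of% hr', r'.retract_assoc, r'.retract]

end DGMod

/-! ### The free modules `𝒜` and `L̂` -/

section HatCarrier

variable {L : Type u} [AddCommGroup L] [Module 𝒜.zeroPartᵐᵒᵖ L]

/-- The universal property of `L ⊗_{A^0} A`: balanced biadditive maps on `A × L` induce additive
maps. -/
def hatLift {X : Type*} [AddCommGroup X] (f : 𝒜.carrier →+ L →+ X)
    (hf : ∀ (b : 𝒜.zeroPart) (a : 𝒜.carrier) (l : L), f ((b : 𝒜.carrier) * a) l = f a (l <• b)) :
    HatCarrier 𝒜 L →+ X :=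
  quotLift (hatRel 𝒜 L) (TensorProduct.liftAddHom f fun n a l => by
    rw [map_zsmul, map_zsmul, AddMonoidHom.zsmul_apply]) <| by
      intro x hx
      induction hx using Submodule.closure_induction with
      | zero => rw [map_zero]
      | add x y _ _ hx hy => rw [map_add, hx, hy, add_zero]
      | smul_mem r x hx =>
        obtain ⟨b, a, l, rfl⟩ := hx
        have hr : r • (((b : 𝒜.carrier) * a) ⊗ₜ[ℤ] l - a ⊗ₜ[ℤ] (l <• b)) =
            ((b : 𝒜.carrier) * (a * r.unop)) ⊗ₜ[ℤ] l - (a * r.unop) ⊗ₜ[ℤ] (l <• b) := by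
          rw [smul_sub, TensorProduct.smul_tmul', TensorProduct.smul_tmul', ← mul_assoc]
          rfl
        rw [hr, map_sub, TensorProduct.liftAddHom_tmul, TensorProduct.liftAddHom_tmul, hf, sub_self]

theorem hatMk_smul_left (l : L) (b : 𝒜.zeroPart) (a : 𝒜.carrier) :
    hatMk (l <• b) a = hatMk l ((b : 𝒜.carrier) * a) := by
  have h : ((b : 𝒜.carrier) * a) ⊗ₜ[ℤ] l - a ⊗ₜ[ℤ] (l <• b) ∈ hatRel 𝒜 L :=
    Submodule.subset_span ⟨b, a, l, rfl⟩
  exact ((Submodule.Quotient.eq _).2 h).symm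

theorem hatMk_add_left (l l' : L) (a : 𝒜.carrier) :
    hatMk (l + l') a = hatMk l a + hatMk l' a :=
  congrArg (hatRel 𝒜 L).mkQ (TensorProduct.tmul_add a l l')

/-- The projection of `A` onto `A^0`. -/
def zeroProj (𝒜 : DGAlgebra.{u} k) : 𝒜.carrier →+ 𝒜.zeroPart where
  toFun a := ⟨gradeProj 𝒜.addGr 𝒜.isInternal 0 a, gradeProj_mem 𝒜.isInternal 0 a⟩
  map_zero' := Subtype.ext (map_zero _)
  map_add' _ _ := Subtype.ext (map_add _ _ _)

theorem zeroProj_coe (b : 𝒜.zeroPart) : zeroProj 𝒜 (b : 𝒜.carrier) = b :=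
  Subtype.ext (gradeProj_same 𝒜.isInternal b.2)

theorem zeroProj_mul (b : 𝒜.zeroPart) (a : 𝒜.carrier) :
    zeroProj 𝒜 ((b : 𝒜.carrier) * a) = b * zeroProj 𝒜 a :=
  Subtype.ext (selfProj_mul 0 (b : 𝒜.carrier) b.2 a)

/-- The map `L̂ → L` sending `l ⊗ a` to `l a_0`. -/
def hatToBase : HatCarrier 𝒜 L →+ L :=
  hatLift
    { toFun := fun a => DistribSMul.toAddMonoidHom L (MulOpposite.op (zeroProj 𝒜 a))
      map_zero' := by
        ext l
        rw [map_zero]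
        exact zero_smul 𝒜.zeroPartᵐᵒᵖ l
      map_add' := fun a b => by ext l; simp [add_smul] }
    fun b a l => by simp [zeroProj_mul, mul_smul]

theorem hatToBase_mk (l : L) (a : 𝒜.carrier) : hatToBase (hatMk l a) = l <• zeroProj 𝒜 a := rfl

end HatCarrier

section Hat

variable (L : Type u) [AddCommGroup L] [Module 𝒜.zeroPartᵐᵒᵖ L] (hd : ∀ a ∈ 𝒜.gr 0, 𝒜.d a = 0)

theorem hatMk_mem_gr (l : L) {i : ℤ} {a : 𝒜.carrier} (ha : a ∈ 𝒜.gr i) :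
    hatMk l a ∈ (hat L hd).gr i :=
  AddSubgroup.subset_closure ⟨l, a, ha, rfl⟩

theorem exists_hatMk_eq {x : HatCarrier 𝒜 L} (hx : x ∈ (hat L hd).gr 0) :
    ∃ l : L, hatMk l 1 = x := by
  induction hx using AddSubgroup.closure_induction with
  | mem x hx =>
    obtain ⟨l, a, ha, rfl⟩ := hx
    exact ⟨l <• (⟨a, ha⟩ : 𝒜.zeroPart), by rw [hatMk_smul_left, mul_one]⟩
  | zero => exact ⟨0, congrArg (hatRel 𝒜 L).mkQ (TensorProduct.tmul_zero _ _)⟩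
  | add x y _ _ hx hy =>
    obtain ⟨⟨l, rfl⟩, ⟨l', rfl⟩⟩ := hx, hy
    exact ⟨l + l', hatMk_add_left l l' 1⟩
  | neg x _ hx =>
    obtain ⟨l, rfl⟩ := hx
    exact ⟨-l, congrArg (hatRel 𝒜 L).mkQ (TensorProduct.tmul_neg _ _)⟩

/-- The degree zero part of `L̂` is `L`. -/
def hatZeroEquiv : L ≃ₗ[𝒜.zeroPartᵐᵒᵖ] (hat L hd).gr 0 :=
  have hleft (l : L) : hatToBase (hatMk l (1 : 𝒜.carrier)) = l := by
    have : zeroProj 𝒜 1 = 1 := zeroProj_coe 1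
    rw [hatToBase_mk, this, MulOpposite.op_one, one_smul]
  { toFun := fun l => ⟨hatMk l 1, hatMk_mem_gr L hd l one_mem_gr_zero⟩
    map_add' := fun l l' => Subtype.ext (hatMk_add_left l l' 1)
    map_smul' := fun r l => Subtype.ext <| by
      refine (hatMk_smul_left l r.unop 1).trans ?_
      rw [mul_one, coe_gr_smul]
      exact (congrArg (hatMk l) (one_mul _).symm).trans (hatMk_smul l 1 _).symm
    invFun := fun x => hatToBase x.1
    left_inv := hleft
    right_inv := fun ⟨x, hx⟩ => Subtype.ext <| by
      obtain ⟨l, rfl⟩ := exists_hatMk_eq L hd hx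
      exact congrArg (hatMk · 1) (hleft l) }

theorem hatMk_one_smul (l : L) (a : 𝒜.carrier) :
    hatMk l (1 : 𝒜.carrier) <• a = hatMk l a := by
  rw [hatMk_smul, one_mul]

theorem exists_hat_linearMap {X : Type u} [AddCommGroup X] [Module 𝒜.carrierᵐᵒᵖ X] (φ : L →+ X)
    (hφ : ∀ (b : 𝒜.zeroPart) (l : L), φ (l <• b) = φ l <• (b : 𝒜.carrier)) :
    ∃ f : HatCarrier 𝒜 L →ₗ[𝒜.carrierᵐᵒᵖ] X, ∀ l, f (hatMk l 1) = φ l := by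
  let f : HatCarrier 𝒜 L →+ X := hatLift
    { toFun := fun a => (DistribSMul.toAddMonoidHom X (MulOpposite.op a)).comp φ
      map_zero' := by ext l; simp
      map_add' := fun a b => by ext l; simp [add_smul] }
    fun b a l => by
      change φ l <• ((b : 𝒜.carrier) * a) = φ (l <• b) <• a
      rw [hφ, MulOpposite.op_mul, mul_smul]
  have hf (l : L) (a : 𝒜.carrier) : f (hatMk l a) = φ l <• a := rfl
  refine ⟨{ f with map_smul' := fun r x => ?_ }, fun l => ?_⟩
  · change f (r • x) = r • f x
    induction x using hat_induction with
    | h0 => simp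
    | hadd x y hx hy => rw [smul_add, map_add, hx, hy, map_add, smul_add]
    | hmk l a =>
      rw [← MulOpposite.op_unop r, hatMk_smul, hf, hf, MulOpposite.op_mul, mul_smul]
  · exact (hf l 1).trans (one_smul _ _)

end Hat

namespace DGMod

section FreeModules

variable {X : Type u} [AddCommGroup X] [Module 𝒜.carrierᵐᵒᵖ X]

/-- The orbit map `a ↦ x a` of an element of a right `A`-module. -/
def orbitMap (x : X) : 𝒜.carrier →ₗ[𝒜.carrierᵐᵒᵖ] X where
  toFun a := x <• a
  map_add' a b := by rw [MulOpposite.op_add, add_smul]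
  map_smul' r a := by
    change x <• (a * r.unop) = r • (x <• a)
    rw [MulOpposite.op_mul, mul_smul, MulOpposite.op_unop]

theorem orbitMap_one (x : X) : orbitMap (𝒜 := 𝒜) x 1 = x := one_smul _ x

/-- The morphism `𝒜 ⟶ K`, `a ↦ x a`, given by a cocycle `x` of degree zero. -/
def selfHom {K : DGMod 𝒜} {x : K.carrier} (hx : x ∈ K.gr 0) (hdx : K.d x = 0) : self 𝒜 ⟶ K where
  toLin := orbitMap x
  map_mem {i a} ha := by
    have h := K.smul_mem hx ha
    rwa [zero_add] at h
  comm a := by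
    refine Eq.symm ((K.leibniz a hx).trans ?_)
    rw [hdx, smul_zero, zero_add, Int.negOnePow_zero, one_smul]
    rfl

variable (hd : ∀ a ∈ 𝒜.gr 0, 𝒜.d a = 0)

include hd in
theorem freeOn_self : FreeOn 0 (self 𝒜) where
  gen := GeneratedIn.of_le fun (a : 𝒜.carrier) => by
    have ha := Submodule.smul_mem
      (Submodule.span 𝒜.carrierᵐᵒᵖ ((self 𝒜).gr 0 : Set (self 𝒜).carrier))
      (MulOpposite.op a) (Submodule.subset_span (one_mem_gr_zero (𝒜 := 𝒜)))
    exact (one_mul a : (1 : 𝒜.carrier) <• a = a) ▸ ha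
  d_zero := hd
  lift X _ _ φ hφ := by
    let o : (self 𝒜).gr 0 := ⟨(1 : 𝒜.carrier), one_mem_gr_zero⟩
    refine ⟨orbitMap (φ o), fun m => ?_⟩
    exact (hφ ⟨m.1, m.2⟩ o).symm.trans
      (congrArg φ (Subtype.ext (one_mul (M := 𝒜.carrier) m.1)))

variable (L : Type u) [AddCommGroup L] [Module 𝒜.zeroPartᵐᵒᵖ L]

theorem freeOn_hat : FreeOn 0 (hat L hd) where
  gen := GeneratedIn.of_le fun (x : HatCarrier 𝒜 L) => by
    induction x using hat_induction with
    | h0 => exact zero_mem _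
    | hadd x y hx hy => exact add_mem hx hy
    | hmk l a =>
      rw [← hatMk_one_smul]
      exact Submodule.smul_mem _ _ (Submodule.subset_span (hatMk_mem_gr L hd l one_mem_gr_zero))
  d_zero m hm := by
    obtain ⟨l, rfl⟩ := exists_hatMk_eq L hd hm
    change hatMk l (𝒜.d 1) = 0
    rw [hd 1 one_mem_gr_zero]
    exact map_zero (hatMkHom l)
  lift X _ _ φ hφ := by
    let e := hatZeroEquiv L hd
    obtain ⟨f, hf⟩ := exists_hat_linearMap L (φ.comp e.toLinearMap.toAddMonoidHom) fun b l =>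
      (congrArg φ (map_smul e _ l)).trans (hφ b (e l))
    refine ⟨f, fun m => ?_⟩
    obtain ⟨l, rfl⟩ := e.surjective m
    exact hf l

theorem simpleFreeOn_hat [IsSimpleModule 𝒜.zeroPartᵐᵒᵖ L] : SimpleFreeOn 0 (hat L hd) :=
  ⟨freeOn_hat hd L, IsSimpleModule.congr (hatZeroEquiv L hd).symm⟩

end FreeModules

namespace FreeOn

variable {n : ℤ} {K E Q : DGMod 𝒜}

theorem nonempty_splitExt_of_equiv_prod (hK : FreeOn n K) (hE : FreeOn n E) (hQ : FreeOn n Q)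
    (e : E.gr n ≃ₗ[𝒜.zeroPartᵐᵒᵖ] K.gr n × Q.gr n) : Nonempty (SplitExt K E Q) := by
  have exists_hom {M N : DGMod 𝒜} (hM : FreeOn n M) (hN : FreeOn n N)
      (φ : M.gr n →ₗ[𝒜.zeroPartᵐᵒᵖ] N.gr n) :
      ∃ f : M ⟶ N, ∀ m hm, Hom.toLin f m = φ ⟨m, hm⟩ := by
    obtain ⟨f, hf⟩ := hM.exists_hom φ fun m => hN.d_zero _ (φ m).2
    exact ⟨f, fun m hm => hf ⟨m, hm⟩⟩
  obtain ⟨i, hi⟩ := exists_hom hK hE (e.symm.toLinearMap.comp (LinearMap.inl _ _ _))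
  obtain ⟨q, hq⟩ := exists_hom hE hQ ((LinearMap.snd _ _ _).comp e.toLinearMap)
  obtain ⟨ρ, hρ⟩ := exists_hom hE hK ((LinearMap.fst _ _ _).comp e.toLinearMap)
  obtain ⟨σ, hσ⟩ := exists_hom hQ hE (e.symm.toLinearMap.comp (LinearMap.inr _ _ _))
  have hi' : i ≫ ρ = 𝟙 K := hK.gen.hom_ext fun m hm => by
    rw [toLin_comp_apply, hi m hm, hρ _ (Subtype.prop _)]
    simp
  have hσ' : σ ≫ q = 𝟙 Q := hQ.gen.hom_ext fun m hm => by
    rw [toLin_comp_apply, hσ m hm, hq _ (Subtype.prop _)]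
    simp
  have hsum : ρ ≫ i + q ≫ σ = 𝟙 E := hE.gen.hom_ext fun m hm => by
    rw [toLin_add, LinearMap.add_apply, toLin_comp_apply, toLin_comp_apply, hρ m hm, hq m hm,
      hi _ (Subtype.prop _), hσ _ (Subtype.prop _), ← AddSubgroup.coe_add]
    refine congrArg Subtype.val (e.injective ?_ : _ = (⟨m, hm⟩ : E.gr n))
    simp
  exact ⟨{
    i := i
    q := q
    ρ := Hom.toLin ρ
    σ := Hom.toLin σ
    ρ_mem := Hom.map_mem ρ
    σ_mem := Hom.map_mem σ
    ρ_i := toLin_congr hi'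
    q_σ := toLin_congr hσ'
    sum := toLin_congr hsum }⟩

theorem exists_section (hss : IsSemisimpleRing 𝒜.zeroPart) (hQ : FreeOn n Q) (q : E ⟶ Q)
    (hq : Function.Surjective (Hom.deg q n)) :
    ∃ σ : Q.carrier →ₗ[𝒜.carrierᵐᵒᵖ] E.carrier,
      (∀ m ∈ Q.gr n, σ m ∈ E.gr n) ∧ ∀ x, Hom.toLin q (σ x) = x := by
  have : Module.Projective 𝒜.zeroPartᵐᵒᵖ (Q.gr n) := Module.projective_of_isSemisimpleRing _ _
  obtain ⟨ψ, hψ⟩ := Module.projective_lifting_property (Hom.deg q n) LinearMap.id hq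
  obtain ⟨σ, hσ⟩ := hQ.exists_linear ψ
  refine ⟨σ, fun m hm => hσ ⟨m, hm⟩ ▸ (ψ _).2, fun x => ?_⟩
  refine LinearMap.congr_fun (f := (Hom.toLin q).comp σ) (g := LinearMap.id)
    (hQ.gen.linearMap_ext fun m hm => ?_) x
  rw [LinearMap.comp_apply, hσ ⟨m, hm⟩]
  exact congrArg Subtype.val (LinearMap.congr_fun hψ ⟨m, hm⟩)

theorem nonempty_splitExt_of_exact (hss : IsSemisimpleRing 𝒜.zeroPart) (hQ : FreeOn n Q)
    (i : K ⟶ E) (q : E ⟶ Q) (hi : Function.Injective (Hom.toLin i))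
    (hex : Function.Exact (Hom.toLin i) (Hom.toLin q))
    (hq : Function.Surjective (Hom.toLin q)) : Nonempty (SplitExt K E Q) := by
  obtain ⟨σ, hσ, q_σ⟩ := hQ.exists_section hss q (Hom.deg_surjective hq n)
  exact ⟨SplitExt.ofSection i q σ (hQ.gen.map_mem σ hσ rfl) q_σ hi hex⟩

theorem subsingleton (hK : FreeOn n K) [Subsingleton (K.gr n)] : Subsingleton K.carrier := by
  have h0 : 𝟙 K = 0 := hK.gen.hom_ext fun m hm =>
    congrArg Subtype.val (Subsingleton.elim (⟨m, hm⟩ : K.gr n) 0)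
  exact subsingleton_of_forall_eq 0 (toLin_congr h0)

theorem exists_sorted (hpos : 𝒜.IsNonneg) (hss : IsSemisimpleRing 𝒜.zeroPart)
    (hd : ∀ a ∈ 𝒜.gr 0, 𝒜.d a = 0) {V : Type u} [AddCommGroup V] [Module 𝒜.zeroPartᵐᵒᵖ V]
    (hV : IsFiniteLength 𝒜.zeroPartᵐᵒᵖ V) (hK : FreeOn 0 K)
    (e : K.gr 0 ≃ₗ[𝒜.zeroPartᵐᵒᵖ] V) : ∃ l, Sorted {0} 0 l K := by
  induction hV generalizing K with
  | of_subsingleton =>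
    have := e.toEquiv.subsingleton
    exact ⟨0, .zero hK.subsingleton⟩
  | @of_simple_quotient V _ _ N _ _ ih =>
    obtain ⟨C, hC⟩ := exists_isCompl N
    obtain ⟨l, hl⟩ := ih (freeOn_hat hd N) (hatZeroEquiv N hd).symm
    obtain ⟨s⟩ := (freeOn_hat hd N).nonempty_splitExt_of_equiv_prod hK (freeOn_hat hd (V ⧸ N))
      ((e.trans (N.prodEquivOfIsCompl C hC).symm).trans ((hatZeroEquiv N hd).prodCongr
        ((N.quotientEquivOfIsCompl C hC).symm.trans (hatZeroEquiv (V ⧸ N) hd))))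
    exact Sorted.of_splitExt hpos s hl (.of_simpleFreeOn rfl (simpleFreeOn_hat hd (V ⧸ N)))

end FreeOn

theorem exists_sorted_self (hpos : 𝒜.IsNonneg) (hss : IsSemisimpleRing 𝒜.zeroPart)
    (hd : ∀ a ∈ 𝒜.gr 0, 𝒜.d a = 0) : ∃ l, Sorted {0} 0 l (self 𝒜) := by
  let f : 𝒜.zeroPartᵐᵒᵖ →ₗ[𝒜.zeroPartᵐᵒᵖ] (self 𝒜).gr 0 :=
    LinearMap.toSpanSingleton _ _ ⟨(1 : 𝒜.carrier), one_mem_gr_zero⟩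
  have hf : Function.Surjective f := fun x =>
    ⟨MulOpposite.op ⟨x.1, x.2⟩, Subtype.ext (one_mul (M := 𝒜.carrier) x.1)⟩
  have hfin : IsFiniteLength 𝒜.zeroPartᵐᵒᵖ 𝒜.zeroPartᵐᵒᵖ :=
    (IsSemisimpleModule.finite_tfae.out 0 3).1
      (inferInstance : Module.Finite 𝒜.zeroPartᵐᵒᵖ 𝒜.zeroPartᵐᵒᵖ)
  exact (freeOn_self hd).exists_sorted hpos hss hd (hfin.of_surjective hf) (.refl _ _)

end DGMod

/-! ### Perfect modules and sorted modules -/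

namespace DGMod

variable {I J : Set ℤ} {n : ℤ} {l : ℕ} {K E Q M : DGMod 𝒜}

theorem Sorted.of_subset (hIJ : I ⊆ J) (h : Sorted I n l M) : Sorted J n l M := by
  induction h with
  | zero h => exact .zero h
  | ext hn hI hK s _ ih => exact .ext hn (hIJ hI) hK s ih

variable (𝒜) in
/-- The property of being homotopy equivalent to a sorted module. -/
def hotSorted : ObjectProperty (DGHot 𝒜) := fun X => IsHotSorted X.as

theorem isThickContainingSelf_hotSorted (hpos : 𝒜.IsNonneg)
    (hss : IsSemisimpleRing 𝒜.zeroPart) (hd : ∀ a ∈ 𝒜.gr 0, 𝒜.d a = 0) :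
    IsThickContainingSelf 𝒜 (hotSorted 𝒜) where
  iso := ⟨by
    rintro X Y e ⟨n, l, G, hG, h⟩
    exact ⟨n, l, G, hG, HotEquiv.trans (M := Y.as) (N := X.as) ⟨e.symm⟩ h⟩⟩
  shift := by
    rintro n M ⟨m, l, G, hG, h⟩
    exact ⟨m - n, l, G.shift n, hG.shift n, h.shift n⟩
  cone f hM hN := IsHotSorted.cone hpos f hM hN
  summand := ⟨by
    rintro X Y r ⟨n, l, G, hG, ⟨e⟩⟩
    obtain ⟨l', G', hG', h⟩ := hG.exists_iso_of_retract hpos (r.trans (.ofIso e))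
    exact ⟨n, l', G', hG', h⟩⟩
  self := by
    obtain ⟨l, h⟩ := exists_sorted_self hpos hss hd
    exact ⟨0, l, _, h.of_subset (Set.subset_univ _), .refl _⟩

variable (𝒜) in
theorem isThickContainingSelf_dgPer : IsThickContainingSelf 𝒜 (dgPer 𝒜) where
  iso := ⟨fun e h P hP => hP.iso.of_iso e (h P hP)⟩
  shift n M h P hP := hP.shift n M (h P hP)
  cone f hM hN P hP := hP.cone f (hM P hP) (hN P hP)
  summand := ⟨fun r h P hP => hP.summand.of_retract r (h P hP)⟩
  self _ hP := hP.self

theorem dgPer_of_retract (r : Retract M E) (hE : dgPer 𝒜 ((toHot 𝒜).obj E)) :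
    dgPer 𝒜 ((toHot 𝒜).obj M) :=
  (isThickContainingSelf_dgPer 𝒜).summand.of_retract (r.map (toHot 𝒜)) hE

theorem SplitExt.dgPer (s : SplitExt K E Q) (hK : dgPer 𝒜 ((toHot 𝒜).obj K))
    (hQ : dgPer 𝒜 ((toHot 𝒜).obj Q)) : dgPer 𝒜 ((toHot 𝒜).obj E) :=
  have h := isThickContainingSelf_dgPer 𝒜
  h.iso.of_iso ((toHot 𝒜).mapIso s.isoCone.symm) (h.cone _ (h.shift _ _ hQ) hK)

/- A nonzero element of the simple module `K^0` gives a surjection `A^0 → K^0`, which splits. -/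
theorem SimpleFreeOn.dgPer (hss : IsSemisimpleRing 𝒜.zeroPart) (hd : ∀ a ∈ 𝒜.gr 0, 𝒜.d a = 0)
    (hK : SimpleFreeOn 0 K) : dgPer 𝒜 ((toHot 𝒜).obj K) := by
  obtain ⟨x, hx, hx0⟩ := hK.exists_ne_zero
  have := hK.simple
  let p : self 𝒜 ⟶ K := selfHom hx (hK.d_zero x hx)
  have hp : Function.Surjective (Hom.deg p 0) := by
    refine LinearMap.surjective_of_ne_zero fun h => hx0 ?_
    have h1 := congrArg Subtype.val (LinearMap.congr_fun h ⟨(1 : 𝒜.carrier), one_mem_gr_zero⟩)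
    exact (orbitMap_one x).symm.trans h1
  obtain ⟨σ, hσ, p_σ⟩ := hK.exists_section hss p hp
  obtain ⟨i, hi⟩ : ∃ i : K ⟶ self 𝒜, Hom.toLin i = σ :=
    ⟨hK.gen.homMk hK.d_zero σ hσ fun m hm => hd _ (hσ m hm), rfl⟩
  exact dgPer_of_retract ⟨i, p, hom_ext' fun y => by rw [toLin_comp_apply, hi, p_σ]; rfl⟩
    (isThickContainingSelf_dgPer 𝒜).self

theorem Sorted.dgPer (hss : IsSemisimpleRing 𝒜.zeroPart) (hd : ∀ a ∈ 𝒜.gr 0, 𝒜.d a = 0)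
    (h : Sorted {0} n l M) : dgPer 𝒜 ((toHot 𝒜).obj M) := by
  induction h with
  | zero h =>
    exact dgPer_of_retract ⟨0, 0, hom_ext' fun _ => Subsingleton.elim _ _⟩
      (isThickContainingSelf_dgPer 𝒜).self
  | ext hn hI hK s hQ ih =>
    obtain rfl : _ = (0 : ℤ) := hI
    exact s.dgPer (hK.dgPer hss hd) ih

end DGMod

/-! ### The cohomology of the reduction and the heart -/

namespace DGMod

variable {I : Set ℤ} {n : ℤ} {l : ℕ} {M N P : DGMod 𝒜}

theorem mem_cohomologySupport {i : ℤ} : i ∈ M.cohomologySupport ↔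
    ∃ z ∈ M.gr i, M.d z = 0 ∧ ∀ y ∈ M.gr (i - 1), M.d y ≠ z := by
  change Nontrivial (_ ⧸ _) ↔ _
  rw [QuotientAddGroup.nontrivial_iff]
  constructor
  · intro h
    obtain ⟨z, hz⟩ := not_forall.1 (mt (AddSubgroup.eq_top_iff' _).2 h)
    exact ⟨z, z.2.1, z.2.2, fun y hy hyz => hz ⟨y, hy, hyz⟩⟩
  · rintro ⟨z, hz, hdz, hy⟩ h
    obtain ⟨y, hy', hyz⟩ := (AddSubgroup.eq_top_iff' _).1 h ⟨z, hz, hdz⟩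
    exact hy y hy' hyz

theorem cohomologySupport_subset (f : M ⟶ N) (g : N ⟶ M) (h : Homotopic (𝟙 M) (f ≫ g)) :
    M.cohomologySupport ⊆ N.cohomologySupport := by
  obtain ⟨h, h_mem, h_eq⟩ := h
  intro i hi
  obtain ⟨z, hz, hdz, hy⟩ := mem_cohomologySupport.1 hi
  refine mem_cohomologySupport.2 ⟨Hom.toLin f z, Hom.map_mem f hz, ?_, fun y hy' hyz => ?_⟩
  · rw [← Hom.comm, hdz, map_zero]
  · refine hy (Hom.toLin g y + h z) (add_mem (Hom.map_mem g hy') (h_mem i z hz)) ?_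
    have h3 := h_eq z
    rw [hdz, map_zero, add_zero, toLin_comp_apply, ← hyz, Hom.comm g] at h3
    rw [map_add, ← h3]
    exact add_sub_cancel _ _

/-- The morphism `M̄ ⟶ N̄` induced by `f : M ⟶ N`. -/
def barMap (f : M ⟶ N) : M.bar ⟶ N.bar :=
  M.plus.desc (f ≫ N.plus.proj) fun _ hx => (Sub.proj_eq_zero_iff _).2
    (map_mem_plus (Hom.toLin f) (fun i => ⟨i, fun _ => Hom.map_mem f⟩) hx)

theorem barMap_id (M : DGMod 𝒜) : barMap (𝟙 M) = 𝟙 M.bar := hom_ext' fun x => by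
  obtain ⟨x, rfl⟩ := M.plus.proj_surjective x
  rfl

theorem barMap_comp (f : M ⟶ N) (g : N ⟶ P) :
    barMap (f ≫ g) = barMap f ≫ barMap g := hom_ext' fun x => by
  obtain ⟨x, rfl⟩ := M.plus.proj_surjective x
  rfl

theorem Homotopic.bar {f g : M ⟶ N} (h : Homotopic f g) :
    Homotopic (barMap f) (barMap g) := by
  obtain ⟨h, h_mem, h_eq⟩ := h
  refine ⟨M.plus.toSubmodule.mapQ N.plus.toSubmodule h
    fun x hx => map_mem_plus h (fun i => ⟨i - 1, h_mem i⟩) hx, ?_, fun x => ?_⟩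
  · rintro i _ ⟨m, hm, rfl⟩
    exact ⟨h m, h_mem i m hm, rfl⟩
  · obtain ⟨x, rfl⟩ := M.plus.proj_surjective x
    exact congrArg (Hom.toLin N.plus.proj) (h_eq x)

theorem HotEquiv.cohomologySupport_bar_subset (h : HotEquiv M N) :
    M.bar.cohomologySupport ⊆ N.bar.cohomologySupport := by
  obtain ⟨f, g, hfg, -⟩ := h.exists_homs
  have := (toHot_map_eq_iff.1 (toHot_map_eq_iff.2 hfg).symm).bar
  rw [barMap_id, barMap_comp] at this
  exact cohomologySupport_subset _ _ this

theorem GeneratedIn.eq_zero_of_mem_plus (hpos : 𝒜.IsNonneg) (hM : M.GeneratedIn n)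
    {x : M.carrier} (hx : x ∈ M.gr n) (hx' : x ∈ M.plus.toSubmodule) : x = 0 :=
  map_eq_zero_of_mem_plus hpos (𝟙 M)
    (fun _ hj _ hm => (AddSubgroup.mem_bot).1 (hM.gr_eq_bot hpos hj ▸ hm)) hx hx'

theorem GeneratedIn.cohomologySupport_bar_subset (hpos : 𝒜.IsNonneg) (hM : M.GeneratedIn n) :
    M.bar.cohomologySupport ⊆ {n} := by
  intro i hi
  obtain ⟨_, ⟨m, hm, rfl⟩, -, hy⟩ := mem_cohomologySupport.1 hi
  by_contra hin
  refine hy 0 (zero_mem _) ((map_zero _).trans ((Sub.proj_eq_zero_iff _).2 ?_).symm)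
  rcases lt_or_gt_of_ne hin with hin | hin
  · have hm : m = 0 := AddSubgroup.mem_bot.1 (hM.gr_eq_bot hpos hin ▸ hm)
    exact hm ▸ zero_mem _
  · exact hM.mem_plus hin hm

namespace Sorted

theorem generatedIn {m : ℤ} (h : Sorted {n} m l M) : M.GeneratedIn n := by
  induction h with
  | @zero _ M h => exact .of_le fun x => Subsingleton.elim 0 x ▸ zero_mem _
  | ext _ hI hK s hQ ih =>
    obtain rfl : _ = n := hI
    refine .of_le fun x => ?_
    rw [← s.sum x]
    exact add_mem (hK.gen.map_mem_span _ (fun _ => Hom.map_mem s.i) _)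
      (ih.map_mem_span _ (fun _ => s.σ_mem) _)

theorem of_mem_plus (hpos : 𝒜.IsNonneg) (h : Sorted I n l M)
    (hM : ∀ i ≠ 0, ∀ x ∈ M.gr i, x ∈ M.plus.toSubmodule) : Sorted {0} 0 l M := by
  induction h with
  | zero h => exact .zero h
  | @ext n n' l K E Q hn hI hK s hQ ih =>
    obtain ⟨x, hx, hx0⟩ := hK.exists_ne_zero
    obtain rfl : n' = 0 := by
      by_contra h0
      refine hx0 (hK.gen.eq_zero_of_mem_plus hpos hx ?_)
      have h := map_mem_plus s.ρ (fun i => ⟨i, fun _ => s.ρ_mem⟩)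
        (hM n' h0 _ (Hom.map_mem s.i hx))
      rwa [s.ρ_i] at h
    refine .ext le_rfl rfl hK s (ih fun i hi y hy => ?_)
    have h := map_mem_plus (Hom.toLin s.q) (fun i => ⟨i, fun _ => Hom.map_mem s.q⟩)
      (hM i hi (s.σ y) (s.σ_mem hy))
    rwa [s.q_σ] at h

/- The differential of `M̄` vanishes, so the hypothesis says that `M̄` lives in degree `0`. -/
theorem of_cohomologySupport (hpos : 𝒜.IsNonneg) (h : Sorted I n l M)
    (hM : M.bar.cohomologySupport ⊆ {0}) : Sorted {0} 0 l M := by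
  have d_bar (y : M.carrier) : M.bar.d (Hom.toLin M.plus.proj y) = 0 :=
    (Hom.comm M.plus.proj y).symm.trans ((Sub.proj_eq_zero_iff _).2 (h.d_mem_plus hpos y))
  refine h.of_mem_plus hpos fun i hi x hx => by_contra fun hxp => hi (hM (mem_cohomologySupport.2
    ⟨Hom.toLin M.plus.proj x, Hom.map_mem M.plus.proj hx, d_bar x, fun y _ hyx => hxp ?_⟩))
  obtain ⟨y, rfl⟩ := M.plus.proj_surjective y
  exact (Sub.proj_eq_zero_iff _).1 (hyx.symm.trans (d_bar y))

end Sorted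

theorem heart_iff (hpos : 𝒜.IsNonneg) (hss : IsSemisimpleRing 𝒜.zeroPart)
    (hd : ∀ a ∈ 𝒜.gr 0, 𝒜.d a = 0) :
    heart 𝒜 ((toHot 𝒜).obj M) ↔ ∃ l G, Sorted {0} 0 l G ∧ HotEquiv M G := by
  constructor
  · rintro ⟨⟨hper, hle⟩, -, hge⟩
    obtain ⟨n, l, G, hG, h⟩ := hper _ (isThickContainingSelf_hotSorted hpos hss hd)
    have hsupp := h.symm.cohomologySupport_bar_subset
    exact ⟨l, G, hG.of_cohomologySupport hpos fun i hi =>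
      le_antisymm (hle (hsupp hi)) (hge (hsupp hi)), h⟩
  · rintro ⟨l, G, hG, h⟩
    have hper : dgPer 𝒜 ((toHot 𝒜).obj M) := by
      obtain ⟨e⟩ := h
      exact (isThickContainingSelf_dgPer 𝒜).iso.of_iso e.symm (hG.dgPer hss hd)
    have hsupp : M.bar.cohomologySupport ⊆ {0} :=
      h.cohomologySupport_bar_subset.trans (hG.generatedIn.cohomologySupport_bar_subset hpos)
    exact ⟨⟨hper, fun i hi => (hsupp hi).le⟩, hper, fun i hi => (hsupp hi).ge⟩

end DGMod

/-! ### Modules with an `L̂`-flag -/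

namespace DGMod

variable {M N K E Q : DGMod 𝒜}

namespace Sub

/-- A morphism with values in a dg submodule, as a morphism into it. -/
def lift (V : Sub M) (f : N ⟶ M) (hf : ∀ x, Hom.toLin f x ∈ V.toSubmodule) : N ⟶ V.toDGMod where
  toLin := (Hom.toLin f).codRestrict V.toSubmodule hf
  map_mem h := Hom.map_mem f h
  comm m := Subtype.ext (Hom.comm f m)

theorem nonempty_subquotient_iso (U V : Sub M) (f : V.toDGMod ⟶ N)
    (hf : Function.Surjective (Hom.toLin f))
    (hU : ∀ x, Hom.toLin f x = 0 ↔ Hom.toLin V.incl x ∈ U.toSubmodule) :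
    Nonempty (subquotient U V ≅ N) := by
  let g : subquotient U V ⟶ N := (U.restrict V).desc f fun x hx => (hU x).2 hx
  refine ⟨isoOfBijective g ⟨(injective_iff_map_eq_zero _).2 fun x hx => ?_, fun y => ?_⟩⟩
  · obtain ⟨x, rfl⟩ := (U.restrict V).proj_surjective x
    exact (proj_eq_zero_iff _).2 ((hU x).1 hx)
  · obtain ⟨x, rfl⟩ := hf y
    exact ⟨Hom.toLin (U.restrict V).proj x, rfl⟩

/-- The preimage of a dg submodule. -/
def comap (f : M ⟶ N) (V : Sub N) : Sub M where
  toSubmodule := V.toSubmodule.comap (Hom.toLin f)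
  homogeneous m hm i := by
    change Hom.toLin f _ ∈ V.toSubmodule
    rw [Hom.map_gradeProj]
    exact V.homogeneous _ hm i
  d_mem m hm := by
    change Hom.toLin f (M.d m) ∈ V.toSubmodule
    rw [Hom.comm]
    exact V.d_mem _ hm

theorem nonempty_subquotient_comap_iso (f : M ⟶ N) (hf : Function.Surjective (Hom.toLin f))
    (U V : Sub N) : Nonempty (subquotient (U.comap f) (V.comap f) ≅ subquotient U V) := by
  refine nonempty_subquotient_iso _ _
    (V.lift ((V.comap f).incl ≫ f) (fun x => x.2) ≫ (U.restrict V).proj) (fun y => ?_)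
    fun x => proj_eq_zero_iff _
  obtain ⟨⟨y, hy⟩, rfl⟩ := proj_surjective _ y
  obtain ⟨x, rfl⟩ := hf y
  exact ⟨⟨x, hy⟩, rfl⟩

variable (M) in
/-- The zero dg submodule. -/
def bot : Sub M where
  toSubmodule := ⊥
  homogeneous m hm i := by
    rw [(Submodule.mem_bot _).1 hm, map_zero]
    exact zero_mem _
  d_mem m hm := by
    rw [(Submodule.mem_bot _).1 hm, map_zero]
    exact zero_mem _

end Sub

theorem SplitExt.nonempty_subquotient_iso (s : SplitExt K E Q) (V : Sub Q)
    (hV : V.toSubmodule = ⊥) : Nonempty (Sub.subquotient (.bot E) (V.comap s.q) ≅ K) := by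
  have q_incl (x : (V.comap s.q).toDGMod.carrier) :
      Hom.toLin s.q (Hom.toLin (V.comap s.q).incl x) = 0 := by
    have h : Hom.toLin s.q (Hom.toLin (V.comap s.q).incl x) ∈ V.toSubmodule := x.2
    rwa [hV, Submodule.mem_bot] at h
  have i_mem (y : K.carrier) : Hom.toLin s.i y ∈ (V.comap s.q).toSubmodule := by
    change Hom.toLin s.q (Hom.toLin s.i y) ∈ V.toSubmodule
    rw [s.q_i]
    exact zero_mem _
  refine Sub.nonempty_subquotient_iso _ _ (s.lift (V.comap s.q).incl (hom_ext' q_incl))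
    (fun y => ⟨⟨Hom.toLin s.i y, i_mem y⟩, s.ρ_i y⟩) fun x => ?_
  change s.ρ (Hom.toLin (V.comap s.q).incl x) = 0 ↔ _ ∈ (⊥ : Submodule _ _)
  rw [Submodule.mem_bot]
  refine ⟨fun h => ?_, fun h => by rw [h, map_zero]⟩
  rw [← s.i_ρ_of_q_eq_zero (q_incl x), h, map_zero]

variable (hd : ∀ a ∈ 𝒜.gr 0, 𝒜.d a = 0) {W : Type w} {L : W → ModuleCat.{u} 𝒜.zeroPartᵐᵒᵖ}

include hd in
theorem SimpleFreeOn.exists_iso_hat (hL : IsSimpleSystem 𝒜 L) (hK : SimpleFreeOn 0 K) :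
    ∃ x, Nonempty (K ≅ hat (L x) hd) := by
  obtain ⟨x, ⟨e⟩⟩ := hL.exists_iso (ModuleCat.of _ (K.gr 0)) hK.simple
  exact ⟨x, hK.toFreeOn.nonempty_iso (freeOn_hat hd (L x))
    (e.toLinearEquiv.trans (hatZeroEquiv (L x) hd))⟩

theorem SplitExt.dgFlag (s : SplitExt K E Q) (hK : ∃ x, Nonempty (K ≅ hat (L x) hd))
    (hQ : dgFlag 𝒜 hd L Q) : dgFlag 𝒜 hd L E := by
  obtain ⟨n, F, hF0, hFn, hF⟩ := hQ
  refine ⟨n + 1, Fin.cons (Sub.bot E) fun j => (F j).comap s.q, rfl, ?_, fun j => ?_⟩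
  · change (F (Fin.last n)).toSubmodule.comap (Hom.toLin s.q) = ⊤
    rw [hFn, Submodule.comap_top]
  · induction j using Fin.cases with
    | zero =>
      obtain ⟨x, ⟨e⟩⟩ := hK
      obtain ⟨e'⟩ := s.nonempty_subquotient_iso (F 0) hF0
      exact ⟨bot_le, x, ⟨e' ≪≫ e⟩⟩
    | succ j =>
      obtain ⟨hle, x, ⟨e⟩⟩ := hF j
      obtain ⟨e'⟩ := Sub.nonempty_subquotient_comap_iso s.q s.q_surjective (F j.castSucc) (F j.succ)
      exact ⟨fun x hx => hle hx, x, ⟨e' ≪≫ e⟩⟩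

theorem Sorted.dgFlag (hL : IsSimpleSystem 𝒜 L) {n : ℤ} {l : ℕ} (h : Sorted {0} n l M) :
    dgFlag 𝒜 hd L M := by
  induction h with
  | @zero _ M h => exact ⟨0, fun _ => Sub.bot M, rfl, Subsingleton.elim _ _, fun i => i.elim0⟩
  | ext hn hI hK s hQ ih =>
    obtain rfl : _ = (0 : ℤ) := hI
    exact s.dgFlag hd (hK.exists_iso_hat hd hL) ih

theorem Sub.nonempty_splitExt (hss : IsSemisimpleRing 𝒜.zeroPart) (U V : Sub M)
    (hUV : U.toSubmodule ≤ V.toSubmodule) (hK : FreeOn 0 (subquotient U V)) :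
    Nonempty (SplitExt U.toDGMod V.toDGMod (subquotient U V)) :=
  hK.nonempty_splitExt_of_exact hss (V.lift U.incl fun x => hUV x.2) (U.restrict V).proj
    (fun _ _ h => Subtype.ext (congrArg (Hom.toLin V.incl) h))
    (fun _ => (proj_eq_zero_iff _).trans ⟨fun hx => ⟨⟨_, hx⟩, rfl⟩, fun ⟨y, hy⟩ => hy ▸ y.2⟩)
    (U.restrict V).proj_surjective

theorem dgFlag_induction (hss : IsSemisimpleRing 𝒜.zeroPart) (hL : IsSimpleSystem 𝒜 L)
    {P : DGMod 𝒜 → Prop} (zero : ∀ M : DGMod 𝒜, Subsingleton M.carrier → P M)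
    (ext : ∀ {M E K : DGMod 𝒜}, SplitExt M E K → SimpleFreeOn 0 K → P M → P E)
    (hM : dgFlag 𝒜 hd L M) : P M := by
  obtain ⟨n, F, hF0, hFn, hF⟩ := hM
  suffices ∀ j N, ((F j).toDGMod ≅ N) → P N from
    this (Fin.last n) M (isoOfBijective (F (Fin.last n)).incl
      ⟨Subtype.val_injective, fun x => ⟨⟨x, hFn ▸ trivial⟩, rfl⟩⟩)
  intro j
  induction j using Fin.induction with
  | zero =>
    have : Subsingleton (F 0).toDGMod.carrier := Submodule.subsingleton_iff_eq_bot.2 hF0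
    exact fun N e => zero N (bijective_of_iso e).2.subsingleton
  | succ j ih =>
    intro N e
    obtain ⟨hle, x, ⟨e'⟩⟩ := hF j
    have := hL.simple x
    have hK := (simpleFreeOn_hat hd (L x)).of_iso e'.symm
    obtain ⟨s⟩ := (F j.castSucc).nonempty_splitExt hss (F j.succ) hle hK.toFreeOn
    exact ext (s.ofIso (Iso.refl _) e) hK (ih _ (Iso.refl _))

theorem dgFlag_iff (hpos : 𝒜.IsNonneg) (hss : IsSemisimpleRing 𝒜.zeroPart)
    (hL : IsSimpleSystem 𝒜 L) : DGPerf.dgFlag 𝒜 hd L M ↔ ∃ l, Sorted {0} 0 l M :=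
  ⟨dgFlag_induction (P := fun M => ∃ l, Sorted {0} 0 l M) hd hss hL (fun _ h => ⟨0, .zero h⟩)
    fun s hK ⟨_, hM⟩ => Sorted.of_splitExt hpos s hM (.of_simpleFreeOn rfl hK),
    fun ⟨_, h⟩ => h.dgFlag hd hL⟩

end DGMod

/-! ### Short exact sequences and finite length -/

section ShortExact

variable {C : Type*} [Category* C] [Preadditive C] {S : ShortComplex C} {Z : C}

/-- The left homology of a complex whose first map is a kernel of the second, computed by a zero
object. -/
def leftHomologyDataOfIsLimit (hZ : IsZero Z) (hf : IsLimit (KernelFork.ofι S.f S.zero)) :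
    S.LeftHomologyData :=
  have : Epi (0 : S.X₁ ⟶ Z) := ⟨fun _ _ _ => hZ.eq_of_src _ _⟩
  have lift_self : hf.lift (KernelFork.ofι S.f S.zero) = 𝟙 S.X₁ := hf.lift_self
  { K := S.X₁
    H := Z
    i := S.f
    π := 0
    wi := S.zero
    hi := hf
    wπ := comp_zero
    hπ := CokernelCofork.IsColimit.ofπ' _ _ fun x hx =>
      ⟨0, by rw [zero_comp, ← Category.id_comp x, ← lift_self]; exact hx.symm⟩ }

/-- The right homology of a complex whose second map is a cokernel of the first, computed by a zero
object. -/
def rightHomologyDataOfIsColimit (hZ : IsZero Z) (hg : IsColimit (CokernelCofork.ofπ S.g S.zero)) :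
    S.RightHomologyData :=
  have : Mono (0 : Z ⟶ S.X₃) := ⟨fun _ _ _ => hZ.eq_of_tgt _ _⟩
  have desc_self : hg.desc (CokernelCofork.ofπ S.g S.zero) = 𝟙 S.X₃ := hg.desc_self
  { Q := S.X₃
    H := Z
    p := S.g
    ι := 0
    wp := S.zero
    hp := hg
    wι := zero_comp
    hι := KernelFork.IsLimit.ofι' _ _ fun x hx =>
      ⟨0, by rw [comp_zero, ← Category.comp_id x, ← desc_self]; exact hx.symm⟩ }

theorem shortExact_of_isLimit_of_isColimit (hZ : IsZero Z)
    (hf : IsLimit (KernelFork.ofι S.f S.zero)) (hg : IsColimit (CokernelCofork.ofπ S.g S.zero)) :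
    S.ShortExact where
  exact := ⟨⟨⟨leftHomologyDataOfIsLimit hZ hf, rightHomologyDataOfIsColimit hZ hg, Iso.refl Z,
    zero_comp.trans S.zero.symm⟩, hZ⟩⟩
  mono_f := mono_of_isLimit_fork hf
  epi_g := epi_of_isColimit_cofork hg

end ShortExact

namespace HasFiniteLength

variable {C : Type*} [Category* C] [Preadditive C] {X Y : C}

theorem of_iso (e : X ≅ Y) (h : HasFiniteLength X) : HasFiniteLength Y := by
  cases h with
  | of_isZero _ hX => exact .of_isZero _ (hX.of_iso e.symm)
  | of_shortExact S hS h₁ h₃ =>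
    let S' : ShortComplex C := ShortComplex.mk (S.f ≫ e.hom) (e.inv ≫ S.g) (by simp)
    let e' : S ≅ S' := ShortComplex.isoMk (Iso.refl _) e (Iso.refl _) (by simp [S']) (by simp [S'])
    exact .of_shortExact S' (ShortComplex.shortExact_of_iso e' hS) h₁ h₃

theorem map {D : Type*} [Category* D] [Preadditive D] (F : C ⥤ D) [F.IsEquivalence]
    [F.PreservesZeroMorphisms] (h : HasFiniteLength X) : HasFiniteLength (F.obj X) := by
  induction h with
  | of_isZero X hX => exact .of_isZero _ (F.map_isZero hX)
  | of_shortExact S hS _ _ ih =>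
    exact .of_shortExact (S.map F) (hS.map_of_exact F) ih (simple_obj F S.X₃)

end HasFiniteLength

namespace DGMod

section FullSubcategory

variable {P : ObjectProperty (DGMod 𝒜)} {X Y : P.FullSubcategory}

theorem isZero_of_subsingleton (h : Subsingleton X.obj.carrier) : IsZero X :=
  (IsZero.iff_id_eq_zero X).2 (ObjectProperty.hom_ext _ (hom_ext' fun _ => h.elim _ _))

theorem toLin_hom_congr {f g : X ⟶ Y} (h : f = g) (x : X.obj.carrier) :
    Hom.toLin f.hom x = Hom.toLin g.hom x := h ▸ rfl

theorem mono_of_injective (f : X ⟶ Y) (hf : Function.Injective (Hom.toLin f.hom)) : Mono f where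
  right_cancellation _ _ hgh :=
    ObjectProperty.hom_ext _ (hom_ext' fun x => hf (toLin_hom_congr hgh x))

theorem SplitExt.shortExact {X₁ X₂ X₃ Z : P.FullSubcategory} (hZ : IsZero Z)
    (s : SplitExt X₁.obj X₂.obj X₃.obj) : (ShortComplex.mk (P.homMk s.i) (P.homMk s.q)
      (ObjectProperty.hom_ext _ s.i_comp_q)).ShortExact := by
  have : Mono (P.homMk s.i) := mono_of_injective _ s.i_injective
  have : Epi (P.homMk s.q) := ⟨fun _ _ hgh => ObjectProperty.hom_ext _
    (have := s.epi_q; (cancel_epi s.q).1 (hom_ext' (toLin_hom_congr hgh)))⟩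
  exact shortExact_of_isLimit_of_isColimit hZ
    (KernelFork.IsLimit.ofι' (P.homMk s.i) (ObjectProperty.hom_ext _ s.i_comp_q) fun f hf =>
      have hf' : f.hom ≫ s.q = 0 := hom_ext' (toLin_hom_congr hf)
      ⟨P.homMk (s.lift f.hom hf'), ObjectProperty.hom_ext _ (s.lift_comp_i f.hom hf')⟩)
    (CokernelCofork.IsColimit.ofπ' (P.homMk s.q) (ObjectProperty.hom_ext _ s.i_comp_q) fun f hf =>
      have hf' : s.i ≫ f.hom = 0 := hom_ext' (toLin_hom_congr hf)
      ⟨P.homMk (s.desc f.hom hf'), ObjectProperty.hom_ext _ (s.q_comp_desc f.hom hf')⟩)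

end FullSubcategory

theorem Homotopic.eq_of_generatedIn {M N : DGMod 𝒜} {n : ℤ} (hM : M.GeneratedIn n)
    (hN : N.gr (n - 1) = ⊥) {f g : M ⟶ N} (hfg : Homotopic f g) : f = g := by
  obtain ⟨h, h_mem, h_eq⟩ := hfg
  have h_zero : h = 0 := hM.linearMap_ext fun m hm => by
    have := h_mem n m hm
    rwa [hN, AddSubgroup.mem_bot] at this
  refine hom_ext' fun m => sub_eq_zero.1 ?_
  rw [h_eq, h_zero, LinearMap.zero_apply, LinearMap.zero_apply, map_zero, add_zero]

/-! ### Simple objects and finite length -/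

section Flag

variable (hpos : 𝒜.IsNonneg) (hss : IsSemisimpleRing 𝒜.zeroPart)
  (hd : ∀ a ∈ 𝒜.gr 0, 𝒜.d a = 0) {W : Type w} {L : W → ModuleCat.{u} 𝒜.zeroPartᵐᵒᵖ}
  (hL : IsSimpleSystem 𝒜 L)

include hL

theorem exists_isZero_dgFlag : ∃ Z : (dgFlag 𝒜 hd L).FullSubcategory, IsZero Z := by
  have h : Subsingleton (Sub.bot (self 𝒜)).toDGMod.carrier :=
    Submodule.subsingleton_iff_eq_bot.2 rfl
  exact ⟨⟨_, (Sorted.zero (n := 0) h).dgFlag hd hL⟩, isZero_of_subsingleton h⟩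

theorem SimpleFreeOn.dgFlag {K : DGMod 𝒜} (hK : SimpleFreeOn 0 K) : dgFlag 𝒜 hd L K :=
  (Sorted.of_simpleFreeOn (I := {0}) rfl hK).dgFlag hd hL

theorem dgFlag_hat (x : W) : dgFlag 𝒜 hd L (hat (L x) hd) :=
  have := hL.simple x
  (simpleFreeOn_hat hd (L x)).dgFlag hd hL

include hpos hss

theorem exists_mono_of_not_isZero {X : (dgFlag 𝒜 hd L).FullSubcategory} (hX : ¬ IsZero X) :
    ∃ (K : (dgFlag 𝒜 hd L).FullSubcategory) (i : K ⟶ X),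
      SimpleFreeOn 0 K.obj ∧ Mono i ∧ i ≠ 0 := by
  obtain ⟨l, h⟩ := (dgFlag_iff hd hpos hss hL).1 X.property
  obtain ⟨M, hM⟩ := X
  cases h with
  | zero h => exact (hX (isZero_of_subsingleton h)).elim
  | @ext _ _ _ K _ Q hn hI hK s hQ =>
    obtain rfl : _ = (0 : ℤ) := hI
    let i : (⟨K, hK.dgFlag hd hL⟩ : (dgFlag 𝒜 hd L).FullSubcategory) ⟶ ⟨M, hM⟩ :=
      ObjectProperty.homMk s.i
    refine ⟨_, i, hK, mono_of_injective i s.i_injective, fun h => ?_⟩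
    obtain ⟨x, -, hx⟩ := hK.exists_ne_zero
    exact hx (s.i_injective ((toLin_hom_congr h x).trans (map_zero (Hom.toLin s.i)).symm))

theorem simple_of_simpleFreeOn {X : (dgFlag 𝒜 hd L).FullSubcategory}
    (hX : SimpleFreeOn 0 X.obj) : Simple X where
  mono_isIso_iff_nonzero {Y} f _ := by
    constructor
    · rintro _ rfl
      obtain ⟨x, -, hx⟩ := hX.exists_ne_zero
      have id_eq_zero : 𝟙 X = 0 := by rw [← IsIso.inv_hom_id (0 : Y ⟶ X), comp_zero]
      exact hx (toLin_hom_congr id_eq_zero x)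
    · intro hf
      obtain ⟨K, i, hK, _, hi⟩ := exists_mono_of_not_isZero hpos hss hd hL
        (X := Y) fun h => hf (h.eq_of_src _ _)
      have if_ne_zero : (i ≫ f).hom ≠ 0 := fun h => hi (by
        rw [← cancel_mono f, zero_comp]
        exact ObjectProperty.hom_ext _ h)
      have : IsIso (i ≫ f) := (ObjectProperty.isIso_hom_iff _).1
        ((hK.isIso_or_eq_zero hX (i ≫ f).hom).resolve_right if_ne_zero)
      have : IsSplitEpi f := ⟨⟨⟨inv (i ≫ f) ≫ i, by rw [Category.assoc, IsIso.inv_hom_id]⟩⟩⟩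
      exact isIso_of_mono_of_isSplitEpi f

theorem simple_hat (x : W) :
    Simple (⟨hat (L x) hd, dgFlag_hat hd hL x⟩ : (dgFlag 𝒜 hd L).FullSubcategory) :=
  have := hL.simple x
  simple_of_simpleFreeOn hpos hss hd hL (simpleFreeOn_hat hd (L x))

theorem exists_iso_of_simple {X : (dgFlag 𝒜 hd L).FullSubcategory} (hX : Simple X) :
    ∃ x, Nonempty (X.obj ≅ hat (L x) hd) := by
  obtain ⟨K, i, hK, _, hi⟩ := exists_mono_of_not_isZero hpos hss hd hL
    fun h : IsZero X => id_nonzero X (h.eq_of_src _ _)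
  have : IsIso i := isIso_of_mono_of_nonzero hi
  obtain ⟨x, ⟨e⟩⟩ := hK.exists_iso_hat hd hL
  exact ⟨x, ⟨(asIso i.hom).symm ≪≫ e⟩⟩

theorem hasFiniteLength_dgFlag (X : (dgFlag 𝒜 hd L).FullSubcategory) : HasFiniteLength X := by
  obtain ⟨Z, hZ⟩ := exists_isZero_dgFlag hd hL
  refine (dgFlag_induction (P := fun M => ∃ hM : dgFlag 𝒜 hd L M,
    HasFiniteLength (⟨M, hM⟩ : (dgFlag 𝒜 hd L).FullSubcategory)) hd hss hL
    (fun M h => ?_) (fun {M E K} s hK ⟨hM, ih⟩ => ?_) X.property).2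
  · exact ⟨(Sorted.zero (n := 0) h).dgFlag hd hL, .of_isZero _ (isZero_of_subsingleton h)⟩
  · obtain ⟨_, hMs⟩ := (dgFlag_iff hd hpos hss hL).1 hM
    obtain ⟨_, hEs⟩ := Sorted.of_splitExt hpos s hMs (.of_simpleFreeOn rfl hK)
    have hE := hEs.dgFlag hd hL
    exact ⟨hE, .of_shortExact _
      (SplitExt.shortExact (X₁ := ⟨M, hM⟩) (X₂ := ⟨E, hE⟩) (X₃ := ⟨K, hK.dgFlag hd hL⟩) hZ s) ih
      (simple_of_simpleFreeOn hpos hss hd hL hK)⟩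

/-! ### The equivalence with the heart -/

theorem heart_of_dgFlag (M : (dgFlag 𝒜 hd L).FullSubcategory) :
    heart 𝒜 (((dgFlag 𝒜 hd L).ι ⋙ toHot 𝒜).obj M) := by
  obtain ⟨l, h⟩ := (dgFlag_iff hd hpos hss hL).1 M.property
  exact (heart_iff hpos hss hd).2 ⟨l, M.obj, h, .refl M.obj⟩

theorem faithful_dgFlag : ((dgFlag 𝒜 hd L).ι ⋙ toHot 𝒜).Faithful where
  map_injective {X Y} f g hfg := by
    obtain ⟨_, hX⟩ := (dgFlag_iff hd hpos hss hL).1 X.property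
    obtain ⟨_, hY⟩ := (dgFlag_iff hd hpos hss hL).1 Y.property
    exact ObjectProperty.hom_ext _ ((toHot_map_eq_iff.1 hfg).eq_of_generatedIn hX.generatedIn
      (hY.gr_eq_bot hpos (by omega)))

theorem isEquivalence_lift : ((heart 𝒜).lift ((dgFlag 𝒜 hd L).ι ⋙ toHot 𝒜)
    (heart_of_dgFlag hpos hss hd hL)).IsEquivalence := by
  have := faithful_dgFlag hpos hss hd hL
  have essSurj : ((heart 𝒜).lift ((dgFlag 𝒜 hd L).ι ⋙ toHot 𝒜)
      (heart_of_dgFlag hpos hss hd hL)).EssSurj := ⟨fun X => by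
    obtain ⟨l, G, hG, ⟨e⟩⟩ := (heart_iff (M := X.obj.as) hpos hss hd).1 X.property
    exact ⟨⟨G, hG.dgFlag hd hL⟩, ⟨ObjectProperty.isoMk _ e.symm⟩⟩⟩
  exact {}

theorem eq_of_hotEquiv_hat {x y : W} (h : HotEquiv (hat (L x) hd) (hat (L y) hd)) : x = y := by
  have := faithful_dgFlag hpos hss hd hL
  obtain ⟨e⟩ := h
  let X : (dgFlag 𝒜 hd L).FullSubcategory := ⟨_, dgFlag_hat hd hL x⟩
  let Y : (dgFlag 𝒜 hd L).FullSubcategory := ⟨_, dgFlag_hat hd hL y⟩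
  let e' : X ≅ Y := ((dgFlag 𝒜 hd L).ι ⋙ toHot 𝒜).preimageIso e
  let e₀ := degEquiv ((dgFlag 𝒜 hd L).ι.mapIso e') 0
  exact hL.eq_of_iso x y
    ⟨((hatZeroEquiv (L x) hd).trans (e₀.trans (hatZeroEquiv (L y) hd).symm)).toModuleIso⟩

end Flag

end DGMod

end DGPerf

end

open DGPerf in
theorem proposition6p5 {k : Type v} [CommRing k] (𝒜 : DGAlgebra.{u} k)
    (hpos : ∀ i : ℤ, i < 0 → 𝒜.gr i = ⊥)
    (hss : IsSemisimpleRing 𝒜.zeroPart)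
    (hd : ∀ a ∈ 𝒜.gr 0, 𝒜.d a = 0)
    {W : Type w} (L : W → ModuleCat.{u} 𝒜.zeroPartᵐᵒᵖ) (hL : IsSimpleSystem 𝒜 L) :
    (∃ h : ∀ M : (dgFlag 𝒜 hd L).FullSubcategory,
        heart 𝒜 (((dgFlag 𝒜 hd L).ι ⋙ toHot 𝒜).obj M),
      ((heart 𝒜).lift ((dgFlag 𝒜 hd L).ι ⋙ toHot 𝒜) h).IsEquivalence) ∧
    (∀ X : Heart 𝒜, HasFiniteLength X) ∧
    (∀ x : W, ∃ hx : heart 𝒜 ((toHot 𝒜).obj (hat (L x) hd)),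
      Simple (⟨(toHot 𝒜).obj (hat (L x) hd), hx⟩ : Heart 𝒜)) ∧
    (∀ X : Heart 𝒜, Simple X → ∃ x : W, Nonempty (X.obj ≅ (toHot 𝒜).obj (hat (L x) hd))) ∧
    (∀ x y : W, Nonempty ((toHot 𝒜).obj (hat (L x) hd) ≅ (toHot 𝒜).obj (hat (L y) hd)) →
      x = y) := by
  have h := DGMod.heart_of_dgFlag hpos hss hd hL
  have hF := DGMod.isEquivalence_lift hpos hss hd hL
  set F := (heart 𝒜).lift ((dgFlag 𝒜 hd L).ι ⋙ toHot 𝒜) h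
  have : F.PreservesZeroMorphisms := ⟨fun _ _ => rfl⟩
  refine ⟨⟨h, hF⟩, fun X => ?_, fun x => ⟨h ⟨_, DGMod.dgFlag_hat hd hL x⟩, ?_⟩, fun X hX => ?_,
    fun x y => DGMod.eq_of_hotEquiv_hat hpos hss hd hL⟩
  · exact ((DGMod.hasFiniteLength_dgFlag hpos hss hd hL (F.objPreimage X)).map F).of_iso
      (F.objObjPreimageIso X)
  · have := DGMod.simple_hat hpos hss hd hL x
    exact simple_obj F ⟨_, DGMod.dgFlag_hat hd hL x⟩
  · have := Simple.of_iso (F.objObjPreimageIso X)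
    obtain ⟨x, ⟨e⟩⟩ := DGMod.exists_iso_of_simple hpos hss hd hL
      ((simple_obj_iff F (F.objPreimage X)).1 this)
    exact ⟨x, ⟨(heart 𝒜).ι.mapIso (F.objObjPreimageIso X).symm ≪≫ (toHot 𝒜).mapIso e⟩⟩
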